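/- **Conventions.** $\mathbb N=\{1,2,\dots\}$, $\omega=\mathbb N\cup\{0\}$, and $[x]$ is the largest integer $\le x$. All functions $g$ below are real valued and defined on some half-line $[x_0,\infty)$, $x_0\ge 0$; only their behaviour for large $x$ matters (finitely many $n$ with $g(n)$ undefined are irrelevant to the averages below). Write $g_2\prec g_1$ if $g_2(x)/g_1(x)\to 0$ as $x\to\infty$, and $g_2\ll g_1$ if $|g_2(x)|\le C|g_1(x)|$ for some constant $C$ and all large $x$. A function $g$ that is $(i+1)$-times continuously differentiable on $[x_0,\infty)$ is *tempered of degree $i\in\omega$* ($\deg g=i$) if $g^{(i+1)}(x)$ tends monotonically to $0$ and $x|g^{(i+1)}(x)|\to\infty$ as $x\to\infty$. Let $\mathcal R$ be the set of $C^\infty$ functions $g$ on half-lines such that $\lim_{x\to\infty} xg^{(j+1)}(x)/g^{(j)}(x)$ exists in $\mathbb R$ for all $j\in\omega$ (in particular $g^{(j)}(x)\neq0$ for large $x$). Let $\mathcal T_i$ be the set of $g\in\mathcal R$ with $\lim_{x\to\infty} xg'(x)/g(x)=\alpha$ for some $i<\alpha\le i+1$ and $\lim_{x\to\infty} g^{(i+1)}(x)=0$,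 and let $\mathcal T=\bigcup_{i\ge0}\mathcal T_i$. For $g\in\mathcal T$ let $\mathcal C(g)$ be the set of finite sums $\sum_s k_s\,g(x+h_s)$ with $k_s\in\mathbb Z$, $h_s\in\omega$. For $\ell,m\in\mathbb N$, an ordered family $((g_{1,1},\dots,g_{\ell,1}),\dots,(g_{1,m},\dots,g_{\ell,m}))$ of $\ell$-tuples is *nice* if there are $g_1,\dots,g_\ell\in\mathcal T$ with $g_{i,j}\in\mathcal C(g_i)$ for all $i,j$, and 1. $1\prec g_{1,1}-g_{1,j}$ and $g_{1,j}\ll g_{1,1}$ for $2\le j\le m$; 2. $g_{i,j}\prec g_{1,1}$ for $2\le i\le\ell$, $1\le j\le m$; 3. $g_{i,1}-g_{i,j}\prec g_{1,1}-g_{1,j}$ for $2\le i\le\ell$, $2\le j\le m$. A *system* $(X,\mathcal B,\mu,T_1,\dots,T_\ell)$ is a probability space with commuting invertible measure preserving transformations $T_i$; $Tf=f\circ T$. For a measure preserving invertible $T$ and $f\in L^\infty(\mu)$ (complex valued), the Host–Kra seminorms are defined by $|||f|||_{1,T}=\|\mathbb E(f\mid\mathcal I(T))\|_{L^2(\mu)}$,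 where $\mathcal I(T)$ is the $\sigma$-algebra of $T$-invariant sets, and, for $k\ge1$, $$|||f|||_{k+1,T}^{2^{k+1}}=\lim_{N-M\to\infty}\frac1{N-M}\sum_{n=M}^{N-1}|||\bar f\cdot T^nf|||_{k,T}^{2^k}.$$ **Proposition.** For all $d\in\omega$ and $\ell,m\in\mathbb N$ there is $k=k(d,\ell,m)\in\mathbb N$ with the following property. Let $(X,\mathcal B,\mu,T_1,\dots,T_\ell)$ be a system, $f_1,\dots,f_m\in L^\infty(\mu)$, and $((g_{1,1},\dots,g_{\ell,1}),\dots,(g_{1,m},\dots,g_{\ell,m}))$ a nice ordered family of $\ell$-tuples of functions with $\deg g_{1,1}=d$. If $|||f_1|||_{k,T_1}=0$, then $$\lim_{N\to\infty}\ \sup_{E\subseteq\mathbb N}\ \Big\|\frac1N\sum_{n=1}^N\ \prod_{j=1}^m\big(T_1^{[g_{1,j}(n)]}\cdots T_\ell^{[g_{\ell,j}(n)]}\big)f_j\cdot\mathbf 1_E(n)\Big\|_{L^2(\mu)}=0 .$$ -/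

import Mathlib

open MeasureTheory Filter Topology Asymptotics
open scoped ContDiff ENNReal ComplexConjugate

namespace TemperedAverages

noncomputable section

/-! ### Classes of functions

A real function defined on some half-line `[x₀, ∞)` is represented by a total function `ℝ → ℝ`;
its values to the left of `x₀` play no role. -/

/-- `g` is a tempered function of degree `i`. -/
def IsTempered (i : ℕ) (g : ℝ → ℝ) : Prop :=
  ∃ x₀ : ℝ, 0 ≤ x₀ ∧ ContDiffOn ℝ (i + 1 : ℕ) g (Set.Ici x₀) ∧
    (MonotoneOn (iteratedDeriv (i + 1) g) (Set.Ioi x₀) ∨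
      AntitoneOn (iteratedDeriv (i + 1) g) (Set.Ioi x₀)) ∧
    Tendsto (iteratedDeriv (i + 1) g) atTop (𝓝 0) ∧
    Tendsto (fun x => x * |iteratedDeriv (i + 1) g x|) atTop atTop

/-- The class `𝓡`: smooth functions on a half-line such that for every `j ≥ 0` the quotient
`x g^{(j+1)}(x) / g^{(j)}(x)` is defined for large `x` and has a finite limit as `x → ∞`. -/
def ClassR : Set (ℝ → ℝ) :=
  {g | (∃ x₀ : ℝ, 0 ≤ x₀ ∧ ContDiffOn ℝ ∞ g (Set.Ici x₀)) ∧
    ∀ j : ℕ, (∀ᶠ x in atTop, iteratedDeriv j g x ≠ 0) ∧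
      ∃ β : ℝ, Tendsto (fun x => x * iteratedDeriv (j + 1) g x / iteratedDeriv j g x) atTop (𝓝 β)}

/-- The class `𝓣ᵢ`. -/
def ClassTi (i : ℕ) : Set (ℝ → ℝ) :=
  {g | g ∈ ClassR ∧
    (∃ α : ℝ, (i : ℝ) < α ∧ α ≤ i + 1 ∧ Tendsto (fun x => x * deriv g x / g x) atTop (𝓝 α)) ∧
    Tendsto (iteratedDeriv (i + 1) g) atTop (𝓝 0)}

/-- The class `𝓣 = ⋃ᵢ 𝓣ᵢ`. -/
def ClassT : Set (ℝ → ℝ) := ⋃ i : ℕ, ClassTi i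

/-- The family `𝓒(g)` of integer combinations of shifts of `g` by whole numbers.  As the functions
are only considered on half-lines, the identity is required for all large `x`. -/
def ShiftComb (g : ℝ → ℝ) : Set (ℝ → ℝ) :=
  {φ | ∃ (r : ℕ) (k : Fin r → ℤ) (h : Fin r → ℕ),
    φ =ᶠ[atTop] fun x => ∑ s, (k s : ℝ) * g (x + h s)}

/-- `IsNice g` says that the ordered family of the `m` tuples `(g 0 j, …, g (ℓ-1) j)` is nice.
The relation `g₂ ≺ g₁` is `g₂ =o[atTop] g₁` and `g₂ ≪ g₁` is `g₂ =O[atTop] g₁`. -/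
structure IsNice {ℓ m : ℕ} [NeZero ℓ] [NeZero m] (g : Fin ℓ → Fin m → ℝ → ℝ) : Prop where
  mem : ∃ G : Fin ℓ → ℝ → ℝ, (∀ i, G i ∈ ClassT) ∧ ∀ i j, g i j ∈ ShiftComb (G i)
  one_prec : ∀ j, j ≠ 0 → (fun _ : ℝ => (1 : ℝ)) =o[atTop] (g 0 0 - g 0 j)
  first_ll : ∀ j, j ≠ 0 → g 0 j =O[atTop] g 0 0
  prec_first : ∀ i j, i ≠ 0 → g i j =o[atTop] g 0 0
  diff_prec : ∀ i j, i ≠ 0 → j ≠ 0 → (g i 0 - g i j) =o[atTop] (g 0 0 - g 0 j)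

/-! ### Ergodic notions -/

variable {X : Type*} [MeasurableSpace X]

/-- The integer power `T ^ n` of an invertible transformation, as a map. -/
def iter (T : X ≃ᵐ X) (n : ℤ) : X → X := ⇑((T.toEquiv : Equiv.Perm X) ^ n)

/-- The Host–Kra seminorm `|||f|||_{k, μ, T}`, for `k ≥ 1` (the value for `k = 0` is a dummy).
`|||f|||₁` is the `L²` norm of the conditional expectation on the `T`-invariant sets, and
`|||f|||_{k+1} ^ (2 ^ (k+1))` is the limit, as `N - M → ∞`, of the averages over `M ≤ n < N` of
`|||conj f · Tⁿ f|||_k ^ (2 ^ k)`. -/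
def hostKraSeminorm (μ : Measure X) (T : X ≃ᵐ X) : ℕ → (X → ℂ) → ℝ
  | 0, _ => 0
  | 1, f => (eLpNorm (μ[f | MeasurableSpace.invariants T]) 2 μ).toReal
  | k + 2, f =>
      (limUnder (comap (fun p : ℤ × ℤ => p.2 - p.1) atTop) fun p : ℤ × ℤ =>
        ((p.2 - p.1 : ℤ) : ℝ)⁻¹ * ∑ n ∈ Finset.Ico p.1 p.2,
          hostKraSeminorm μ T (k + 1) (fun x => conj (f x) * f (iter T n x)) ^ 2 ^ (k + 1)) ^
      ((1 : ℝ) / 2 ^ (k + 2))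

/-- The transformation `T_1^{a_1} ⋯ T_ℓ^{a_ℓ}`. -/
def jointIter {ℓ : ℕ} (T : Fin ℓ → X ≃ᵐ X) (a : Fin ℓ → ℤ) : X → X :=
  ⇑(List.ofFn fun i => ((T i).toEquiv : Equiv.Perm X) ^ a i).prod

/-- The average `(1/N) ∑_{n=1}^N ∏_j (T_1^{[g_{1,j}(n)]} ⋯ T_ℓ^{[g_{ℓ,j}(n)]}) f_j · 1_E(n)`,
where `T f = f ∘ T` and `[·]` is the floor. -/
def niceAverage {ℓ m : ℕ} (T : Fin ℓ → X ≃ᵐ X) (f : Fin m → X → ℂ)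
    (g : Fin ℓ → Fin m → ℝ → ℝ) (E : Set ℕ) (N : ℕ) (x : X) : ℂ :=
  (N : ℂ)⁻¹ * ∑ n ∈ Finset.Icc 1 N,
    (∏ j, f j (jointIter T (fun i => ⌊g i j n⌋) x)) * E.indicator (fun _ => (1 : ℂ)) n

end

end TemperedAverages

open TemperedAverages

/-! Let F_n be the product of the iterates at time n. The square of the L² norm of the average is at
most the mean over n of |∫ φ·F_n|, where φ is the conjugate of the average. Since φ is bounded
independently of E and N, it suffices that these correlations tend to zero in mean, uniformly over
all φ with a given bound (`SmallCorrelations`). The absolute values absorb the set E, and van der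
Corput's inequality reproduces properties of this kind.

Only values at integers matter. A function of class 𝓣 sampled at integers is a tempered sequence: as
long as the degree lasts, each difference is smaller than the previous one by a factor of exact
order n (`isTemperedSeq_of_mem_classTi`). A member of 𝓒(g) is an integer polynomial q in the shift
applied to the sample of g. The order of vanishing of q at 1 governs its growth: for u(1) ≠ 0, the
polynomial (X - 1)^r u acts like u(1) Δ^r, up to the degree of the sequence. Dividing out common
powers of X - 1 brings all rows to degree at most d, and niceness becomes a condition on tuples of
polynomials (`IsNice.exists_isNiceFamily`).

Van der Corput's trick with step h turns the tuples p_j into X^h p_j - p_z and p_j - p_z, for a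
normalizing member z of free choice (`SmallCorrelations.of_differences`). Tuples are filtered by
their order at 1, row after row, and a family is weighed by the number of classes on each level,
compared lexicographically. Multiplication by X^h does not change the class on a level, so
normalizing by a member of the deepest occupied level lowers the weight
(`familyWeight_vdcFamily_lt`). Such a z can be chosen so that the family stays nice for all large h
(`IsNiceFamily.exists_vdcFamily`). Members annihilating every sequence are bounded and dropped.

The induction stops when the first row of the dominating member is, up to a bounded error, a
multiple of a sequence γ whose increments decrease to 0 but are not O(1/n). All first rows are then
c_j γ + O(1) with c_o ≠ 0 and c_j ≠ c_o for j ≠ o, while the other rows move more slowly. On a block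
where γ grows by L, up to finitely many errors, only ⌊γ⌋ moves; it runs through L consecutive
integers with controlled multiplicities (`smallCorrelations_of_isSlowlyGrowing`). What remains are
linear averages along powers of T_1, controlled by a seminorm of order one more than the number of
members (`exists_avg_correlation_le`). Since each differencing at most doubles the number of
members, only finitely many weights can follow a given one, so the order is uniform
(`exists_seminormOrderSuffices`).

The seminorms are defined by limits whose existence has to be proved: along multiplicative
differences their powers form positive definite sequences, and the uniform averages of such
sequences converge (`isPosDef_hostKraPow`, `exists_tendsto_intervalAvg_of_posDef`). -/

namespace TemperedAverages

/-! ### Uniform Cesàro averages and positive definite sequences -/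

/-- The filter of integer intervals `[M, N)` whose length tends to infinity. -/
noncomputable def longIntervals : Filter (ℤ × ℤ) := comap (fun p : ℤ × ℤ => p.2 - p.1) atTop

/-- The average of `a` over the integer interval `[M, N)`. -/
noncomputable def intervalAvg (a : ℤ → ℝ) (p : ℤ × ℤ) : ℝ :=
  ((p.2 - p.1 : ℤ) : ℝ)⁻¹ * ∑ n ∈ Finset.Ico p.1 p.2, a n

theorem tendsto_length : Tendsto (fun p : ℤ × ℤ => p.2 - p.1) longIntervals atTop :=
  tendsto_comap

instance longIntervals_neBot : longIntervals.NeBot := by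
  refine comap_neBot_iff.2 fun t ht => ?_
  obtain ⟨a, ha⟩ := mem_atTop_sets.1 ht
  exact ⟨(0, a), by simpa using ha a le_rfl⟩

theorem eventually_longIntervals {P : ℤ × ℤ → Prop} :
    (∀ᶠ p in longIntervals, P p) ↔ ∃ L : ℤ, ∀ p : ℤ × ℤ, L ≤ p.2 - p.1 → P p := by
  rw [longIntervals, eventually_comap, eventually_atTop]
  constructor
  · rintro ⟨L, hL⟩
    exact ⟨L, fun p hp => hL _ hp _ rfl⟩
  · rintro ⟨L, hL⟩
    exact ⟨L, fun b hb p hp => hL p (hp ▸ hb)⟩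

theorem tendsto_range_longIntervals :
    Tendsto (fun N : ℕ => ((0 : ℤ), (N : ℤ))) atTop longIntervals := by
  refine tendsto_comap_iff.2 ?_
  simpa [Function.comp_def] using tendsto_natCast_atTop_atTop (R := ℤ)

theorem sum_Ico_int_telescope {E : Type*} [AddCommGroup E] (g : ℤ → E) {M N : ℤ} (h : M ≤ N) :
    ∑ n ∈ Finset.Ico M N, (g (n + 1) - g n) = g N - g M := by
  induction N, h using Int.leInduction with
  | base => simp
  | succ n hn ih =>
    rw [← Finset.insert_Ico_right_eq_Ico_add_one hn, Finset.sum_insert (by simp), ih]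
    abel

/-- A shift by one changes only the two end terms; a shift by i is |i| such shifts. -/
theorem norm_sum_shift_sub_le {E : Type*} [SeminormedAddCommGroup E] {v : ℤ → E} {R : ℝ}
    (hv : ∀ n, ‖v n‖ ≤ R) {M N : ℤ} (h : M ≤ N) (i : ℤ) :
    ‖∑ n ∈ Finset.Ico M N, v (n + i) - ∑ n ∈ Finset.Ico M N, v n‖ ≤ 2 * R * |(i : ℝ)| := by
  have step : ∀ i : ℤ, ‖∑ n ∈ Finset.Ico M N, v (n + (i + 1)) - ∑ n ∈ Finset.Ico M N, v (n + i)‖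
      ≤ 2 * R := by
    intro i
    have := sum_Ico_int_telescope (fun n => v (n + i)) h
    rw [← Finset.sum_sub_distrib]
    have e : ∀ n, n + (i + 1) = n + 1 + i := fun n => by ring
    simp only [e]
    rw [this]
    calc _ ≤ ‖v (N + i)‖ + ‖v (M + i)‖ := norm_sub_le _ _
      _ ≤ _ := by linarith [hv (N + i), hv (M + i)]
  induction i using Int.induction_on with
  | zero => simp
  | succ i ih =>
    have := norm_add_le (∑ n ∈ Finset.Ico M N, v (n + ((i : ℤ) + 1)) -
      ∑ n ∈ Finset.Ico M N, v (n + i)) (∑ n ∈ Finset.Ico M N, v (n + i) - ∑ n ∈ Finset.Ico M N, v n)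
    rw [sub_add_sub_cancel] at this
    refine this.trans ((add_le_add (step i) ih).trans ?_)
    push_cast
    rw [abs_of_nonneg (by positivity), abs_of_nonneg (by positivity)]
    linarith
  | pred i ih =>
    have := norm_sub_le (∑ n ∈ Finset.Ico M N, v (n + (-(i : ℤ))) - ∑ n ∈ Finset.Ico M N, v n)
      (∑ n ∈ Finset.Ico M N, v (n + (-(i : ℤ) - 1 + 1)) -
      ∑ n ∈ Finset.Ico M N, v (n + (-(i : ℤ) - 1)))
    rw [sub_add_cancel, sub_sub_sub_cancel_left] at this
    have e := step (-(i : ℤ) - 1)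
    rw [sub_add_cancel] at e
    refine this.trans ((add_le_add ih e).trans ?_)
    push_cast
    have h1 : |-(i : ℝ) - 1| = i + 1 := by rw [← neg_add', abs_neg, abs_of_nonneg (by positivity)]
    rw [h1, abs_neg, abs_of_nonneg (by positivity)]
    linarith

/-- A stationary sequence of vectors has convergent uniform averages, tested against any vector. -/
theorem exists_tendsto_intervalAvg_inner {E : Type*} [SeminormedAddCommGroup E]
    [InnerProductSpace ℝ E] (v : ℤ → E)
    (hv : ∀ i j t, inner ℝ (v (i + t)) (v (j + t)) = inner ℝ (v i) (v j)) (y : E) :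
    ∃ l, Tendsto (intervalAvg fun n => inner ℝ (v n) y) longIntervals (𝓝 l) := by
  -- Stationarity makes the norm of the combination Φ t c independent of t. Coefficients in A have
  -- sum 1, without any sign condition.
  set Φ : ℤ → (ℤ →₀ ℝ) →ₗ[ℝ] E := fun t => Finsupp.linearCombination ℝ fun i => v (i + t) with hΦ
  set A : Set (ℤ →₀ ℝ) := {c | c.sum (fun _ x => x) = 1} with hA
  set u : ℤ × ℤ → E := fun p => ((p.2 - p.1 : ℤ) : ℝ)⁻¹ • ∑ n ∈ Finset.Ico p.1 p.2, v n with hu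
  have hR : ∀ n, ‖v n‖ ≤ ‖v 0‖ := by
    intro n
    have h := hv 0 0 n
    simp only [zero_add, real_inner_self_eq_norm_sq] at h
    exact (sq_le_sq₀ (norm_nonneg _) (norm_nonneg _)).1 h.le
  have hΦn : ∀ t c, ‖Φ t c‖ = ‖Φ 0 c‖ := by
    intro t c
    have : ‖Φ t c‖ ^ 2 = ‖Φ 0 c‖ ^ 2 := by
      simp only [← real_inner_self_eq_norm_sq, hΦ, Finsupp.linearCombination_apply, Finsupp.sum,
        sum_inner, inner_sum, inner_smul_left, inner_smul_right, hv, add_zero]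
    exact (pow_left_inj₀ (norm_nonneg _) (norm_nonneg _) two_ne_zero).1 this
  have hAv : ∀ c ∈ A, ∃ C, ∀ p : ℤ × ℤ, p.1 ≤ p.2 →
      ‖∑ n ∈ Finset.Ico p.1 p.2, v n‖ ≤ (p.2 - p.1 : ℤ) * ‖Φ 0 c‖ + C := by
    intro c hc
    refine ⟨∑ i ∈ c.support, |c i| * (2 * ‖v 0‖ * |(i : ℝ)|), fun p hp => ?_⟩
    have h1 : ∑ t ∈ Finset.Ico p.1 p.2, Φ t c - ∑ n ∈ Finset.Ico p.1 p.2, v n =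
        ∑ i ∈ c.support, c i • (∑ n ∈ Finset.Ico p.1 p.2, v (n + i) -
          ∑ n ∈ Finset.Ico p.1 p.2, v n) := by
      have : ∑ n ∈ Finset.Ico p.1 p.2, v n =
          ∑ i ∈ c.support, c i • ∑ n ∈ Finset.Ico p.1 p.2, v n := by
        rw [← Finset.sum_smul]
        have : ∑ i ∈ c.support, c i = 1 := hc
        rw [this, one_smul]
      conv_lhs => rw [this]
      simp only [smul_sub, Finset.sum_sub_distrib, hΦ, Finsupp.linearCombination_apply, Finsupp.sum,
        Finset.smul_sum]
      rw [Finset.sum_comm]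
      simp only [add_comm]
    have h2 : ‖∑ t ∈ Finset.Ico p.1 p.2, Φ t c‖ ≤ (p.2 - p.1 : ℤ) * ‖Φ 0 c‖ := by
      refine (norm_sum_le _ _).trans ?_
      simp only [hΦn]
      rw [Finset.sum_const, Int.card_Ico, nsmul_eq_mul]
      have : (((p.2 - p.1).toNat : ℤ) : ℝ) = ((p.2 - p.1 : ℤ) : ℝ) := by
        rw [Int.toNat_of_nonneg (by omega)]
      rw [← this, Int.cast_natCast]
    have h3 : ‖∑ t ∈ Finset.Ico p.1 p.2, Φ t c - ∑ n ∈ Finset.Ico p.1 p.2, v n‖ ≤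
        ∑ i ∈ c.support, |c i| * (2 * ‖v 0‖ * |(i : ℝ)|) := by
      rw [h1]
      refine (norm_sum_le _ _).trans (Finset.sum_le_sum fun i _ => ?_)
      rw [norm_smul, Real.norm_eq_abs]
      exact mul_le_mul_of_nonneg_left (norm_sum_shift_sub_le hR hp i) (abs_nonneg _)
    have h4 := norm_sub_le (∑ t ∈ Finset.Ico p.1 p.2, Φ t c)
      (∑ t ∈ Finset.Ico p.1 p.2, Φ t c - ∑ n ∈ Finset.Ico p.1 p.2, v n)
    rw [sub_sub_cancel] at h4
    linarith
  have hne : ((fun c => ‖Φ 0 c‖) '' A).Nonempty :=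
    ⟨_, Finsupp.single 0 1, by simp [hA], rfl⟩
  have hbd : BddBelow ((fun c => ‖Φ 0 c‖) '' A) := ⟨0, by rintro _ ⟨c, -, rfl⟩; positivity⟩
  set ρ := sInf ((fun c => ‖Φ 0 c‖) '' A) with hρ
  have hρ0 : 0 ≤ ρ := le_csInf hne (by rintro _ ⟨c, -, rfl⟩; positivity)
  -- The mean of Φ t c over an interval has norm at most ‖Φ 0 c‖ and differs from the mean of v by
  -- boundary terms of order 1/length. So a nearly minimal c bounds all long averages.
  have upper : ∀ ε > 0, ∀ᶠ p in longIntervals, ‖u p‖ ≤ ρ + ε := by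
    intro ε hε
    obtain ⟨_, ⟨c, hc, rfl⟩, hcε⟩ := exists_lt_of_csInf_lt hne (lt_add_of_pos_right ρ (half_pos hε))
    obtain ⟨C, hC⟩ := hAv c hc
    have h1 : Tendsto (fun p : ℤ × ℤ => ((p.2 - p.1 : ℤ) : ℝ)) longIntervals atTop :=
      tendsto_intCast_atTop_atTop.comp tendsto_length
    have h2 : Tendsto (fun p : ℤ × ℤ => ((p.2 - p.1 : ℤ) : ℝ)⁻¹ * C) longIntervals (𝓝 0) := by
      simpa using h1.inv_tendsto_atTop.mul_const C
    filter_upwards [h2.eventually_lt_const (half_pos hε), h1.eventually_gt_atTop 0] with p hp hp0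
    have hp1 : p.1 ≤ p.2 := by
      have : (0 : ℤ) < p.2 - p.1 := by exact_mod_cast hp0
      omega
    rw [hu]
    simp only
    rw [norm_smul, norm_inv, Real.norm_of_nonneg hp0.le]
    calc _ ≤ ((p.2 - p.1 : ℤ) : ℝ)⁻¹ * ((p.2 - p.1 : ℤ) * ‖Φ 0 c‖ + C) :=
          mul_le_mul_of_nonneg_left (hC p hp1) (by positivity)
      _ = ‖Φ 0 c‖ + ((p.2 - p.1 : ℤ) : ℝ)⁻¹ * C := by field_simp
      _ ≤ _ := by simp only at hcε; linarith
  -- Averages and their midpoints are again combinations with coefficient sum 1, so the minimum ρ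
  -- bounds the midpoint from below. Together with the upper bound, the parallelogram law shows that
  -- long averages are close to each other.
  have lower : ∀ p q : ℤ × ℤ, p.1 < p.2 → q.1 < q.2 → 2 * ρ ≤ ‖u p + u q‖ := by
    intro p q hp hq
    have key : ∀ p : ℤ × ℤ, p.1 < p.2 → ∃ c ∈ A, Φ 0 c = u p := by
      intro p hp
      have h0 : ((p.2 - p.1 : ℤ) : ℝ) ≠ 0 := by
        have : p.2 - p.1 ≠ 0 := by omega
        exact_mod_cast this
      refine ⟨((p.2 - p.1 : ℤ) : ℝ)⁻¹ • ∑ n ∈ Finset.Ico p.1 p.2, Finsupp.single n 1, ?_, ?_⟩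
      · simp only [hA, Set.mem_ofPred_eq]
        have : ∀ c : ℤ →₀ ℝ, c.sum (fun _ x => x) = Finsupp.linearCombination ℝ (fun _ => (1 : ℝ)) c
            := fun c => by simp [Finsupp.linearCombination_apply]
        rw [this, map_smul, map_sum]
        simp only [Finsupp.linearCombination_single, Finset.sum_const, Int.card_Ico, smul_eq_mul,
          nsmul_eq_mul, mul_one]
        have : (((p.2 - p.1).toNat : ℤ) : ℝ) = ((p.2 - p.1 : ℤ) : ℝ) := by
          rw [Int.toNat_of_nonneg (by omega)]
        rw [Int.cast_natCast] at this
        rw [this, inv_mul_cancel₀ h0]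
      · simp [hΦ, hu]
    obtain ⟨c, hc, hcu⟩ := key p hp
    obtain ⟨d, hd, hdu⟩ := key q hq
    have hmid : (2 : ℝ)⁻¹ • (c + d) ∈ A := by
      have : ∀ c : ℤ →₀ ℝ, c.sum (fun _ x => x) = Finsupp.linearCombination ℝ (fun _ => (1 : ℝ)) c
            := fun c => by simp [Finsupp.linearCombination_apply]
      simp only [hA, Set.mem_ofPred_eq, this, map_smul, map_add] at hc hd ⊢
      rw [hc, hd]; norm_num
    have := csInf_le hbd ⟨_, hmid, rfl⟩
    simp only [map_smul, map_add, hcu, hdu, norm_smul] at this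
    rw [← hρ] at this
    norm_num at this
    linarith
  -- E need not be complete, so the limit is taken in ℝ after pairing with y.
  have hcauchy : Cauchy (map (intervalAvg fun n => inner ℝ (v n) y) longIntervals) := by
    rw [Metric.cauchy_iff]
    refine ⟨inferInstance, fun ε hε => ?_⟩
    have huy : ∀ p, intervalAvg (fun n => inner ℝ (v n) y) p = inner ℝ (u p) y := by
      intro p
      simp [intervalAvg, hu, inner_smul_left, sum_inner]
    -- The parallelogram law gives ‖u p - u q‖² ≤ 4(ρ + η)² - 4ρ² = 8ρη + 4η².
    obtain ⟨η, hη, hηε⟩ : ∃ η > 0, √(8 * ρ * η + 4 * η ^ 2) * ‖y‖ < ε := by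
      have : Tendsto (fun η : ℝ => √(8 * ρ * η + 4 * η ^ 2) * ‖y‖) (𝓝[>] 0) (𝓝 0) := by
        have : Tendsto (fun η : ℝ => √(8 * ρ * η + 4 * η ^ 2) * ‖y‖) (𝓝 0)
            (𝓝 (√(8 * ρ * 0 + 4 * 0 ^ 2) * ‖y‖)) := by
          apply Continuous.tendsto; fun_prop
        simp only [mul_zero, ne_eq, OfNat.ofNat_ne_zero, not_false_eq_true, zero_pow, add_zero,
          Real.sqrt_zero, zero_mul] at this
        exact this.mono_left nhdsWithin_le_nhds
      obtain ⟨η, h1, h2⟩ := ((this.eventually_lt_const hε).and self_mem_nhdsWithin).exists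
      exact ⟨η, h2, h1⟩
    have hlt : ∀ᶠ p : ℤ × ℤ in longIntervals, p.1 < p.2 := by
      filter_upwards [tendsto_length.eventually_gt_atTop 0] with p hp
      omega
    refine ⟨_, image_mem_map ((upper η hη).and hlt), ?_⟩
    rintro _ ⟨p, ⟨hp, hp'⟩, rfl⟩ _ ⟨q, ⟨hq, hq'⟩, rfl⟩
    rw [huy, huy, Real.dist_eq, ← inner_sub_left]
    refine ((abs_real_inner_le_norm _ _).trans ?_).trans_lt hηε
    refine mul_le_mul_of_nonneg_right (Real.le_sqrt_of_sq_le ?_) (norm_nonneg _)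
    have h1 := parallelogram_law_with_norm ℝ (u p) (u q)
    have h2 := lower p q hp' hq'
    have h3 : (2 * ρ) ^ 2 ≤ ‖u p + u q‖ ^ 2 := pow_le_pow_left₀ (by positivity) h2 2
    have h4 : ‖u p‖ ^ 2 ≤ (ρ + η) ^ 2 := pow_le_pow_left₀ (norm_nonneg _) hp 2
    have h5 : ‖u q‖ ^ 2 ≤ (ρ + η) ^ 2 := pow_le_pow_left₀ (norm_nonneg _) hq 2
    nlinarith
  exact cauchy_map_iff_exists_tendsto.1 hcauchy

/-- The uniform averages of a real positive definite sequence converge. -/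
theorem exists_tendsto_intervalAvg_of_posDef (a : ℤ → ℝ) (hsymm : ∀ n, a (-n) = a n)
    (hpos : ∀ c : ℤ →₀ ℝ, 0 ≤ c.sum fun i x => c.sum fun j y => x * y * a (i - j)) :
    ∃ l, Tendsto (intervalAvg a) longIntervals (𝓝 l) := by
  -- The GNS construction: a defines a semi-inner product for which the unit vectors are a
  -- stationary sequence, and a(n) is the product of the n-th one with the 0-th.
  let core : PreInnerProductSpace.Core ℝ (ℤ →₀ ℝ) :=
    { inner := fun c d => c.sum fun i x => d.sum fun j y => x * y * a (i - j)
      conj_inner_symm := by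
        intro c d
        simp only [conj_trivial]
        rw [Finsupp.sum_comm]
        refine Finsupp.sum_congr fun i _ => Finsupp.sum_congr fun j _ => ?_
        rw [← hsymm, neg_sub]; ring
      re_inner_nonneg := fun c => by simpa using hpos c
      add_left := by
        intro c d e
        refine Finsupp.sum_add_index' (fun i => by simp) fun i x y => ?_
        simp only [add_mul, Finsupp.sum_add]
      smul_left := by
        intro c d r
        rw [Finsupp.sum_smul_index (fun i => by simp)]
        simp only [conj_trivial, Finsupp.sum, Finset.mul_sum, mul_assoc] }
  let : SeminormedAddCommGroup (ℤ →₀ ℝ) :=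
    @InnerProductSpace.Core.toSeminormedAddCommGroup ℝ _ _ _ _ core
  let : InnerProductSpace ℝ (ℤ →₀ ℝ) := InnerProductSpace.ofCore core
  have hin : ∀ i j, inner ℝ (Finsupp.single i (1 : ℝ)) (Finsupp.single j (1 : ℝ)) = a (i - j) := by
    intro i j
    change ((Finsupp.single i (1 : ℝ)).sum fun i x =>
      (Finsupp.single j (1 : ℝ)).sum fun j y => x * y * a (i - j)) = _
    simp
  obtain ⟨l, hl⟩ := exists_tendsto_intervalAvg_inner
    (fun n => (Finsupp.single n 1 : ℤ →₀ ℝ)) (fun i j t => by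
      rw [hin, hin, add_sub_add_right_eq_sub]) (Finsupp.single 0 1)
  refine ⟨l, ?_⟩
  simpa [hin] using hl

/-! ### Bounded measurable functions and powers of a transformation -/

section Basic

variable {X : Type*} [MeasurableSpace X]

/-- `f` is measurable and bounded by `R` everywhere. -/
def BddMeas (R : ℝ) (f : X → ℂ) : Prop := Measurable f ∧ ∀ x, ‖f x‖ ≤ R

theorem BddMeas.mul {R R' : ℝ} {f g : X → ℂ} (hf : BddMeas R f) (hg : BddMeas R' g) :
    BddMeas (R * R') fun x => f x * g x :=
  ⟨hf.1.mul hg.1, fun x => by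
    rw [norm_mul]
    exact mul_le_mul (hf.2 x) (hg.2 x) (norm_nonneg _) ((norm_nonneg _).trans (hf.2 x))⟩

theorem BddMeas.conj {R : ℝ} {f : X → ℂ} (hf : BddMeas R f) : BddMeas R fun x => conj (f x) :=
  ⟨Complex.continuous_conj.measurable.comp hf.1, fun x => by rw [RCLike.norm_conj]; exact hf.2 x⟩

theorem BddMeas.comp {R : ℝ} {f : X → ℂ} (hf : BddMeas R f) {τ : X → X} (hτ : Measurable τ) :
    BddMeas R fun x => f (τ x) :=
  ⟨hf.1.comp hτ, fun _ => hf.2 _⟩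

theorem BddMeas.mono {R R' : ℝ} {f : X → ℂ} (hf : BddMeas R f) (h : R ≤ R') : BddMeas R' f :=
  ⟨hf.1, fun x => (hf.2 x).trans h⟩

theorem BddMeas.prod {ι : Type*} (s : Finset ι) {R : ℝ} {f : ι → X → ℂ}
    (hf : ∀ i, BddMeas R (f i)) : BddMeas (R ^ s.card) fun x => ∏ i ∈ s, f i x := by
  refine ⟨Finset.measurable_prod _ fun i _ => (hf i).1, fun x => ?_⟩
  rw [norm_prod, ← Finset.prod_const]
  exact Finset.prod_le_prod (fun i _ => norm_nonneg _) fun i _ => (hf i).2 x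

theorem BddMeas.memLp {R : ℝ} {f : X → ℂ} (hf : BddMeas R f) (μ : Measure X) [IsFiniteMeasure μ]
    (p : ℝ≥0∞) : MemLp f p μ :=
  MemLp.of_bound hf.1.aestronglyMeasurable R (Eventually.of_forall hf.2)

theorem BddMeas.integrable {R : ℝ} {f : X → ℂ} (hf : BddMeas R f) (μ : Measure X)
    [IsFiniteMeasure μ] : Integrable f μ :=
  memLp_one_iff_integrable.1 (hf.memLp μ 1)

theorem BddMeas.norm_integral_le {R : ℝ} {f : X → ℂ} (hf : BddMeas R f) (μ : Measure X)
    [IsProbabilityMeasure μ] : ‖∫ x, f x ∂μ‖ ≤ R := by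
  simpa using norm_integral_le_of_norm_le_const (μ := μ) (Eventually.of_forall hf.2)

theorem iter_zero (T : X ≃ᵐ X) (x : X) : iter T 0 x = x := rfl

theorem iter_add (T : X ≃ᵐ X) (m n : ℤ) (x : X) : iter T (m + n) x = iter T m (iter T n x) := by
  simp [iter, zpow_add]

theorem iter_natCast (T : X ≃ᵐ X) (n : ℕ) : iter T n = T^[n] := by
  induction n with
  | zero => rfl
  | succ n ih =>
    funext x
    rw [Nat.cast_succ, iter_add, ih]
    rfl

theorem measurable_iter (T : X ≃ᵐ X) (n : ℤ) : Measurable (iter T n) := by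
  obtain ⟨n, rfl | rfl⟩ := n.eq_nat_or_neg
  · rw [iter_natCast]
    exact T.measurable.iterate n
  · have : iter T (-(n : ℤ)) = T.symm^[n] := by
      induction n with
      | zero => rfl
      | succ n ih =>
        funext x
        rw [Nat.cast_succ, neg_add, iter_add, ih]
        simp [iter]
    rw [this]
    exact T.symm.measurable.iterate n

theorem measurePreserving_iter {μ : Measure X} {T : X ≃ᵐ X} (hT : MeasurePreserving T μ μ) (n : ℤ) :
    MeasurePreserving (iter T n) μ μ := by
  have nat : ∀ n : ℕ, MeasurePreserving (iter T n) μ μ := fun n => by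
    rw [iter_natCast]; exact hT.iterate n
  obtain ⟨n, rfl | rfl⟩ := n.eq_nat_or_neg
  · exact nat n
  · refine ⟨measurable_iter T _, ?_⟩
    conv_lhs => rw [← (nat n).map_eq]
    rw [Measure.map_map (measurable_iter T _) (measurable_iter T _)]
    have : iter T (-(n : ℤ)) ∘ iter T n = id := by
      funext x
      rw [Function.comp_apply, ← iter_add, neg_add_cancel, iter_zero, id]
    rw [this, Measure.map_id]

/-- The multiplicative difference `conj f · Tⁿ f`. -/
def mulDiff (T : X ≃ᵐ X) (n : ℤ) (f : X → ℂ) : X → ℂ := fun x => conj (f x) * f (iter T n x)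

theorem BddMeas.mulDiff {R : ℝ} {f : X → ℂ} (hf : BddMeas R f) (T : X ≃ᵐ X) (n : ℤ) :
    BddMeas (R * R) (mulDiff T n f) :=
  hf.conj.mul (hf.comp (measurable_iter T n))

end Basic

/-! ### The invariant factor -/

section Invariant

variable {X : Type*} [MeasurableSpace X] {μ : Measure X} [IsProbabilityMeasure μ]

omit [IsProbabilityMeasure μ] in
-- Almost invariance is upgraded to strict invariance by restricting a measurable version to the
-- points along whose whole orbit it is constant. This set is strictly T-invariant and has full
-- measure.
theorem aestronglyMeasurable_invariants_iff {T : X ≃ᵐ X} (hT : MeasurePreserving T μ μ)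
    {f : X → ℂ} (hf : AEStronglyMeasurable f μ) :
    AEStronglyMeasurable[MeasurableSpace.invariants T] f μ ↔ f ∘ T =ᵐ[μ] f := by
  constructor
  · rintro ⟨g, hg, hfg⟩
    have h1 : g ∘ T = g :=
      MeasurableSpace.comp_eq_of_measurable_invariants (StronglyMeasurable.measurable hg)
    have h2 : f ∘ T =ᵐ[μ] g ∘ T := hT.quasiMeasurePreserving.ae_eq_comp hfg
    rw [h1] at h2
    exact h2.trans hfg.symm
  · intro h
    obtain ⟨g, hg, hfg⟩ := hf
    have hgT : g ∘ T =ᵐ[μ] g :=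
      ((hT.quasiMeasurePreserving.ae_eq_comp hfg).symm.trans h).trans hfg
    set A : Set X := {x | ∀ n : ℤ, g (iter T (n + 1) x) = g (iter T n x)} with hA
    have hAm : MeasurableSet A := by
      have : A = ⋂ n : ℤ, {x | g (iter T (n + 1) x) = g (iter T n x)} := by ext; simp [hA]
      rw [this]
      exact MeasurableSet.iInter fun n => measurableSet_eq_fun
        (hg.measurable.comp (measurable_iter T _)) (hg.measurable.comp (measurable_iter T _))
    have hA1 : ∀ᵐ x ∂μ, x ∈ A := by
      simp only [hA, Set.mem_ofPred_eq, ae_all_iff]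
      intro n
      filter_upwards [(measurePreserving_iter hT n).quasiMeasurePreserving.ae hgT] with x hx
      rw [add_comm, iter_add]
      exact hx
    have hAT : ∀ x, T x ∈ A ↔ x ∈ A := by
      intro x
      have e : ∀ n : ℤ, iter T n (T x) = iter T (n + 1) x := fun n => by
        rw [iter_add]; rfl
      simp only [hA, Set.mem_ofPred_eq, e]
      exact ⟨fun h n => by simpa using h (n - 1), fun h n => h (n + 1)⟩
    have hind : Measurable[MeasurableSpace.invariants T] (A.indicator g) := by
      rw [MeasurableSpace.measurable_invariants_dom]
      refine ⟨hg.measurable.indicator hAm, fun s _ => ?_⟩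
      have : A.indicator g ∘ T = A.indicator g := by
        funext x
        by_cases hx : x ∈ A
        · rw [Function.comp_apply, Set.indicator_of_mem ((hAT x).2 hx), Set.indicator_of_mem hx]
          simpa [iter] using hx 0
        · rw [Function.comp_apply, Set.indicator_of_notMem (fun h => hx ((hAT x).1 h)),
            Set.indicator_of_notMem hx]
      rw [this]
    refine ⟨A.indicator g, hind.stronglyMeasurable, hfg.trans ?_⟩
    filter_upwards [hA1] with x hx
    rw [Set.indicator_of_mem hx]

/-- Von Neumann's mean ergodic theorem: the fixed vectors of the Koopman operator are the functions
measurable for the invariant sets, so the limit is the inner product of f with its conditional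
expectation, which is the squared norm of the latter. -/
theorem tendsto_avg_integral_mulDiff {T : X ≃ᵐ X} (hT : MeasurePreserving T μ μ) {R : ℝ}
    {f : X → ℂ} (hf : BddMeas R f) :
    Tendsto (fun N : ℕ => (N : ℝ)⁻¹ * ∑ n ∈ Finset.range N, (∫ x, mulDiff T n f x ∂μ).re) atTop
      (𝓝 ((eLpNorm (μ[f | MeasurableSpace.invariants T]) 2 μ).toReal ^ 2)) := by
  have hm := MeasurableSpace.invariants_le (T : X → X)
  have hf2 : MemLp f 2 μ := hf.memLp μ 2
  set U : Lp ℂ 2 μ →L[ℂ] Lp ℂ 2 μ :=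
    (Lp.compMeasurePreservingₗᵢ ℂ T hT).toContinuousLinearMap with hU
  have hUap : ∀ g : Lp ℂ 2 μ, U g = Lp.compMeasurePreserving T hT g := fun g => rfl
  have hmem : ∀ g : Lp ℂ 2 μ, g ∈ U.eqLocus (1 : Lp ℂ 2 μ →L[ℂ] Lp ℂ 2 μ) ↔
      g ∈ lpMeas ℂ ℂ (MeasurableSpace.invariants T) 2 μ := by
    intro g
    rw [mem_lpMeas_iff_aestronglyMeasurable,
      aestronglyMeasurable_invariants_iff hT (Lp.aestronglyMeasurable g)]
    have : g ∈ U.eqLocus (1 : Lp ℂ 2 μ →L[ℂ] Lp ℂ 2 μ) ↔ U g = g := Iff.rfl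
    rw [this, hUap, Lp.ext_iff]
    have h := Lp.coeFn_compMeasurePreserving g hT
    exact ⟨fun h' => h.symm.trans h', fun h' => h.trans h'⟩
  set x : Lp ℂ 2 μ := hf2.toLp f with hx
  set v : Lp ℂ 2 μ := (condExpL2 ℂ ℂ hm x : Lp ℂ 2 μ) with hv
  have hvmem : v ∈ lpMeas ℂ ℂ (MeasurableSpace.invariants T) 2 μ := (condExpL2 ℂ ℂ hm x).2
  have : Fact (MeasurableSpace.invariants T ≤ ‹MeasurableSpace X›) := ⟨hm⟩
  have horth : ∀ w ∈ lpMeas ℂ ℂ (MeasurableSpace.invariants T) 2 μ, inner ℂ (x - v) w = 0 :=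
    fun w hw => Submodule.starProjection_inner_eq_zero _ w hw
  have hproj : (U.eqLocus (1 : Lp ℂ 2 μ →L[ℂ] Lp ℂ 2 μ)).starProjection x = v :=
    Submodule.eq_starProjection_of_mem_of_inner_eq_zero ((hmem v).2 hvmem)
      fun w hw => horth w ((hmem w).1 hw)
  have hUn : ∀ n : ℕ, U^[n] x = (hf2.comp_measurePreserving (measurePreserving_iter hT n)).toLp
      (f ∘ iter T n) := by
    intro n
    induction n with
    | zero => rfl
    | succ n ih =>
      rw [Function.iterate_succ_apply', ih, hUap, Lp.toLp_compMeasurePreserving]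
      congr 1
  have hin : ∀ n : ℕ, (∫ y, mulDiff T n f y ∂μ).re = (inner ℂ x (U^[n] x)).re := by
    intro n
    rw [hUn, L2.inner_def]
    congr 1
    refine integral_congr_ae ?_
    filter_upwards [hf2.coeFn_toLp,
      (hf2.comp_measurePreserving (measurePreserving_iter hT n)).coeFn_toLp] with y h1 h2
    rw [h1, h2]
    simp [mulDiff, mul_comm]
  have hlim := U.tendsto_birkhoffAverage_orthogonalProjection
    (LinearIsometry.norm_toContinuousLinearMap_le _) x
  have hlim2 : Tendsto (fun N => (inner ℂ x (birkhoffAverage ℂ U _root_.id N x)).re) atTop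
      (𝓝 (inner ℂ x v).re) := by
    rw [← hproj]
    exact (Complex.continuous_re.tendsto _).comp (tendsto_const_nhds.inner hlim)
  have hval : (inner ℂ x v).re = (eLpNorm (μ[f | MeasurableSpace.invariants T]) 2 μ).toReal ^ 2 := by
    have h1 := horth v hvmem
    rw [inner_sub_left, sub_eq_zero] at h1
    rw [h1]
    have h2 : ‖v‖ = (eLpNorm (μ[f | MeasurableSpace.invariants T]) 2 μ).toReal := by
      rw [Lp.norm_def, eLpNorm_congr_ae (hf2.condExpL2_ae_eq_condExp (𝕜 := ℂ) hm)]
    rw [← h2]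
    exact inner_self_eq_norm_sq (𝕜 := ℂ) v
  rw [← hval]
  refine hlim2.congr fun N => ?_
  simp only [birkhoffAverage, birkhoffSum, inner_smul_right, inner_sum, hin, id]
  rw [← Complex.ofReal_natCast, ← Complex.ofReal_inv, Complex.re_ofReal_mul, Complex.re_sum]

end Invariant

/-! ### Host–Kra seminorms -/

section HostKra

variable {X : Type*} [MeasurableSpace X] {μ : Measure X} [IsProbabilityMeasure μ]

/-- The power `|||f|||_k ^ (2 ^ k)`, with the value `Re ∫ f` for `k = 0`. -/
noncomputable def hostKraPow (μ : Measure X) (T : X ≃ᵐ X) : ℕ → (X → ℂ) → ℝ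
  | 0, f => (∫ x, f x ∂μ).re
  | k + 1, f => hostKraSeminorm μ T (k + 1) f ^ 2 ^ (k + 1)

/-- The formal properties of a functional that make its uniform averages along multiplicative
differences converge. -/
structure IsPosDefFunctional (T : X ≃ᵐ X) (Q : (X → ℂ) → ℝ) : Prop where
  conj_eq : ∀ (R : ℝ) (f : X → ℂ), BddMeas R f → Q (fun x => conj (f x)) = Q f
  comp_eq : ∀ (R : ℝ) (f : X → ℂ) (n : ℤ), BddMeas R f → Q (fun x => f (iter T n x)) = Q f
  nonneg : ∀ (R : ℝ) (F : ℤ → X → ℂ), (∀ i, BddMeas R (F i)) → ∀ (s : Finset ℤ) (c : ℤ → ℝ),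
    0 ≤ ∑ i ∈ s, ∑ j ∈ s, c i * c j * Q fun x => F i x * starRingEnd ℂ (F j x)

/-- By invariance, the value at n = i - j is Q of Tⁱf · conj(Tʲf), so the sequence is positive
definite. -/
theorem IsPosDefFunctional.exists_tendsto {T : X ≃ᵐ X} {Q : (X → ℂ) → ℝ}
    (hQ : IsPosDefFunctional T Q) {R : ℝ} {f : X → ℂ} (hf : BddMeas R f) :
    ∃ l, Tendsto (intervalAvg fun n => Q (mulDiff T n f)) longIntervals (𝓝 l) := by
  have hcomp : ∀ i j : ℤ, Q (mulDiff T (i - j) f) =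
      Q fun x => f (iter T i x) * conj (f (iter T j x)) := by
    intro i j
    rw [← hQ.comp_eq _ _ j (hf.mulDiff T (i - j))]
    congr 1
    funext x
    simp only [mulDiff]
    rw [← iter_add, sub_add_cancel, mul_comm]
  refine exists_tendsto_intervalAvg_of_posDef _ (fun n => ?_) fun c => ?_
  · have h1 := hcomp 0 n
    have h2 := hcomp n 0
    rw [zero_sub] at h1
    rw [sub_zero] at h2
    rw [h1, h2, ← hQ.conj_eq _ _ ((hf.comp (measurable_iter T n)).mul
      (hf.comp (measurable_iter T 0)).conj)]
    congr 1
    funext x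
    simp [mul_comm]
  · have := hQ.nonneg R (fun i x => f (iter T i x)) (fun i => hf.comp (measurable_iter T i))
      c.support c
    simpa only [Finsupp.sum, hcomp] using this

omit [IsProbabilityMeasure μ] in
theorem hostKraPow_succ_nonneg (T : X ≃ᵐ X) (k : ℕ) (f : X → ℂ) :
    0 ≤ hostKraPow μ T (k + 1) f :=
  (Even.pow_nonneg ⟨2 ^ k, by ring⟩ _)

/-- Once the limit exists it has to be identified: for k = 0 along the intervals [0, N), by the mean
ergodic theorem; for larger k by the definition itself, where nonnegativity of the limit lets the
root and the power cancel. -/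
theorem tendsto_hostKraPow_of_isPosDef {T : X ≃ᵐ X} (hT : MeasurePreserving T μ μ) (k : ℕ)
    (hQ : IsPosDefFunctional T (hostKraPow μ T k)) {R : ℝ} {f : X → ℂ} (hf : BddMeas R f) :
    Tendsto (intervalAvg fun n => hostKraPow μ T k (mulDiff T n f)) longIntervals
      (𝓝 (hostKraPow μ T (k + 1) f)) := by
  obtain ⟨l, hl⟩ := hQ.exists_tendsto hf
  suffices hostKraPow μ T (k + 1) f = l by rwa [this]
  match k with
  | 0 =>
    refine tendsto_nhds_unique ?_ (hl.comp tendsto_range_longIntervals)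
    refine (tendsto_avg_integral_mulDiff hT hf).congr fun N => ?_
    have : Finset.Ico (0 : ℤ) N = (Finset.range N).map Nat.castEmbedding := by
      ext n
      simp only [Finset.mem_Ico, Finset.mem_map, Finset.mem_range, Nat.castEmbedding_apply]
      exact ⟨fun h => ⟨n.toNat, by omega, by omega⟩, by rintro ⟨m, h, rfl⟩; omega⟩
    simp only [Function.comp_apply, intervalAvg, this, Finset.sum_map, hostKraPow]
    simp
  | k + 1 =>
    have hl0 : 0 ≤ l := by
      refine ge_of_tendsto hl ?_
      filter_upwards [tendsto_length.eventually_ge_atTop 0] with p hp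
      exact mul_nonneg (inv_nonneg.2 (by exact_mod_cast hp))
        (Finset.sum_nonneg fun n _ => hostKraPow_succ_nonneg T k _)
    have h1 : hostKraSeminorm μ T (k + 2) f = l ^ ((1 : ℝ) / 2 ^ (k + 2)) := by
      rw [hostKraSeminorm]
      congr 1
      exact hl.limUnder_eq
    rw [hostKraPow, h1]
    have h2 : (1 : ℝ) / 2 ^ (k + 2) = ((2 ^ (k + 2) : ℕ) : ℝ)⁻¹ := by push_cast; rw [one_div]
    rw [h2]
    exact Real.rpow_inv_natCast_pow hl0 (by positivity)

/-- Induction on k. For k = 0 positivity is ∫ |∑ cᵢFᵢ|² ≥ 0. The step uses that `mulDiff` is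
multiplicative: the differences of Fᵢ · conj Fⱼ have the same form, so each term of the averages
converging to the next power is nonnegative. -/
theorem isPosDef_hostKraPow {T : X ≃ᵐ X} (hT : MeasurePreserving T μ μ) (k : ℕ) :
    IsPosDefFunctional T (hostKraPow μ T k) := by
  induction k with
  | zero =>
    refine ⟨fun R f _ => ?_, fun R f n hf => ?_, fun R F hF s c => ?_⟩
    · simp only [hostKraPow]
      rw [integral_conj, Complex.conj_re]
    · simp only [hostKraPow]
      have := (measurePreserving_iter hT n).map_eq
      conv_rhs => rw [← this]
      rw [integral_map (measurable_iter T n).aemeasurable hf.1.aestronglyMeasurable]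
    · have h1 : ∑ i ∈ s, ∑ j ∈ s, c i * c j * hostKraPow μ T 0 (fun x => F i x * conj (F j x)) =
          (∫ x, (∑ i ∈ s, c i * F i x) * conj (∑ i ∈ s, c i * F i x) ∂μ).re := by
        have h2 : ∀ x, (∑ i ∈ s, (c i : ℂ) * F i x) * conj (∑ i ∈ s, (c i : ℂ) * F i x) =
            ∑ i ∈ s, ∑ j ∈ s, ((c i * c j : ℝ) : ℂ) * (F i x * conj (F j x)) := by
          intro x
          rw [map_sum, Finset.sum_mul_sum]
          refine Finset.sum_congr rfl fun i _ => Finset.sum_congr rfl fun j _ => ?_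
          rw [map_mul, Complex.conj_ofReal]
          push_cast
          ring
        simp only [h2]
        have hint : ∀ i j, Integrable (fun x => F i x * conj (F j x)) μ := fun i j =>
          ((hF i).mul (hF j).conj).integrable μ
        rw [integral_finsetSum _ fun i _ => integrable_finsetSum _ fun j _ =>
          (hint i j).const_mul _, Complex.re_sum]
        refine Finset.sum_congr rfl fun i _ => ?_
        rw [integral_finsetSum _ fun j _ => (hint i j).const_mul _, Complex.re_sum]
        refine Finset.sum_congr rfl fun j _ => ?_
        rw [integral_const_mul, Complex.re_ofReal_mul]
        rfl
      rw [h1]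
      have h3 : ∀ x, (∑ i ∈ s, (c i : ℂ) * F i x) * conj (∑ i ∈ s, (c i : ℂ) * F i x) =
          ((‖∑ i ∈ s, (c i : ℂ) * F i x‖ ^ 2 : ℝ) : ℂ) := fun x => by
        rw [Complex.mul_conj, Complex.normSq_eq_norm_sq]
      simp only [h3]
      rw [integral_complex_ofReal, Complex.ofReal_re]
      exact integral_nonneg fun x => by positivity
  | succ k ih =>
    have lim := fun {R : ℝ} {f : X → ℂ} (hf : BddMeas R f) =>
      tendsto_hostKraPow_of_isPosDef hT k ih hf
    refine ⟨fun R f hf => ?_, fun R f n hf => ?_, fun R F hF s c => ?_⟩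
    · refine tendsto_nhds_unique (lim hf.conj) ((lim hf).congr fun p => ?_)
      refine congrArg (intervalAvg · p) (funext fun n => ?_)
      rw [← ih.conj_eq _ _ (hf.mulDiff T n)]
      congr 1
      funext x
      simp [mulDiff]
    · refine tendsto_nhds_unique (lim (hf.comp (measurable_iter T n))) ((lim hf).congr fun p => ?_)
      refine congrArg (intervalAvg · p) (funext fun m => ?_)
      rw [← ih.comp_eq _ _ n (hf.mulDiff T m)]
      congr 1
      funext x
      simp only [mulDiff]
      rw [← iter_add, ← iter_add, add_comm]
    · have h1 : Tendsto (fun p => ∑ i ∈ s, ∑ j ∈ s, c i * c j *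
          intervalAvg (fun n => hostKraPow μ T k (mulDiff T n fun x => F i x * conj (F j x))) p)
          longIntervals
          (𝓝 (∑ i ∈ s, ∑ j ∈ s, c i * c j * hostKraPow μ T (k + 1)
            fun x => F i x * conj (F j x))) :=
        tendsto_finsetSum _ fun i _ => tendsto_finsetSum _ fun j _ =>
          (lim ((hF i).mul (hF j).conj)).const_mul _
      refine ge_of_tendsto h1 ?_
      filter_upwards [tendsto_length.eventually_ge_atTop 0] with p hp
      have h2 : ∑ i ∈ s, ∑ j ∈ s, c i * c j *
          intervalAvg (fun n => hostKraPow μ T k (mulDiff T n fun x => F i x * conj (F j x))) p =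
          ((p.2 - p.1 : ℤ) : ℝ)⁻¹ * ∑ n ∈ Finset.Ico p.1 p.2, ∑ i ∈ s, ∑ j ∈ s, c i * c j *
            hostKraPow μ T k fun x => conj (mulDiff T n (F j) x) * conj (conj (mulDiff T n (F i) x))
          := by
        rw [Finset.sum_comm, Finset.mul_sum]
        simp only [intervalAvg, Finset.mul_sum]
        rw [Finset.sum_comm]
        rw [Finset.sum_comm (s := Finset.Ico p.1 p.2)]
        refine Finset.sum_congr rfl fun i _ => ?_
        rw [Finset.sum_comm (s := Finset.Ico p.1 p.2)]
        refine Finset.sum_congr rfl fun j _ => Finset.sum_congr rfl fun n _ => ?_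
        have : (mulDiff T n fun x => F i x * conj (F j x)) =
            fun x => conj (mulDiff T n (F j) x) * conj (conj (mulDiff T n (F i) x)) := by
          funext x
          simp only [mulDiff, map_mul, Complex.conj_conj]
          ring
        rw [this]
        ring
      rw [h2]
      refine mul_nonneg (inv_nonneg.2 (by exact_mod_cast hp)) (Finset.sum_nonneg fun n _ => ?_)
      rw [Finset.sum_comm]
      have := ih.nonneg _ (fun i x => conj (mulDiff T n (F i) x))
        (fun i => ((hF i).mulDiff T n).conj) s c
      exact this.trans_eq (Finset.sum_congr rfl fun i _ => Finset.sum_congr rfl fun j _ => by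
        rw [mul_comm (c i)])

/-- The limit that defines `|||f|||_{k+1}` exists. -/
theorem tendsto_hostKraPow {T : X ≃ᵐ X} (hT : MeasurePreserving T μ μ) (k : ℕ) {R : ℝ}
    {f : X → ℂ} (hf : BddMeas R f) :
    Tendsto (intervalAvg fun n => hostKraPow μ T k (mulDiff T n f)) longIntervals
      (𝓝 (hostKraPow μ T (k + 1) f)) :=
  tendsto_hostKraPow_of_isPosDef hT k (isPosDef_hostKraPow hT k) hf

theorem sq_norm_integral_le_hostKraPow_one {T : X ≃ᵐ X} {R : ℝ} {f : X → ℂ} (hf : BddMeas R f) :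
    ‖∫ x, f x ∂μ‖ ^ 2 ≤ hostKraPow μ T 1 f := by
  have hm := MeasurableSpace.invariants_le (T : X → X)
  have hf2 : MemLp (μ[f | MeasurableSpace.invariants T]) 2 μ := (hf.memLp μ 2).condExp one_le_two
  simp only [hostKraPow, hostKraSeminorm]
  rw [pow_one]
  refine pow_le_pow_left₀ (norm_nonneg _) ?_ 2
  rw [← integral_condExp hm]
  refine (norm_integral_le_integral_norm _).trans ?_
  rw [integral_norm_eq_lintegral_enorm hf2.1, ← eLpNorm_one_eq_lintegral_enorm]
  exact ENNReal.toReal_mono hf2.2.ne (eLpNorm_le_eLpNorm_of_exponent_le (by norm_num) hf2.1)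

/-- Monotonicity of the seminorms: the Cauchy-Schwarz inequality for the averages passes it from one
order to the next. -/
theorem sq_hostKraPow_le {T : X ≃ᵐ X} (hT : MeasurePreserving T μ μ) (k : ℕ) {R : ℝ}
    {f : X → ℂ} (hf : BddMeas R f) :
    hostKraPow μ T k f ^ 2 ≤ hostKraPow μ T (k + 1) f := by
  induction k generalizing R f with
  | zero =>
    refine le_trans ?_ (sq_norm_integral_le_hostKraPow_one hf)
    rw [hostKraPow, ← sq_abs]
    exact pow_le_pow_left₀ (abs_nonneg _) (Complex.abs_re_le_norm _) 2
  | succ k ih =>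
    refine le_of_tendsto_of_tendsto ((tendsto_hostKraPow hT k hf).pow 2)
      (tendsto_hostKraPow hT (k + 1) hf) ?_
    filter_upwards [tendsto_length.eventually_gt_atTop 0] with p hp
    have hp' : (0 : ℝ) < ((p.2 - p.1 : ℤ) : ℝ) := by exact_mod_cast hp
    have hcard : ((Finset.Ico p.1 p.2).card : ℝ) = ((p.2 - p.1 : ℤ) : ℝ) := by
      rw [Int.card_Ico, ← Int.cast_natCast, Int.toNat_of_nonneg hp.le]
    have h1 : (∑ n ∈ Finset.Ico p.1 p.2, hostKraPow μ T k (mulDiff T n f)) ^ 2 ≤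
        ((p.2 - p.1 : ℤ) : ℝ) *
          ∑ n ∈ Finset.Ico p.1 p.2, hostKraPow μ T (k + 1) (mulDiff T n f) := by
      rw [← hcard]
      exact (sq_sum_le_card_mul_sum_sq).trans (mul_le_mul_of_nonneg_left
        (Finset.sum_le_sum fun n _ => ih (hf.mulDiff T n)) (Nat.cast_nonneg _))
    simp only [intervalAvg]
    rw [mul_pow]
    calc _ ≤ (((p.2 - p.1 : ℤ) : ℝ)⁻¹) ^ 2 * (((p.2 - p.1 : ℤ) : ℝ) *
          ∑ n ∈ Finset.Ico p.1 p.2, hostKraPow μ T (k + 1) (mulDiff T n f)) :=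
        mul_le_mul_of_nonneg_left h1 (by positivity)
      _ = _ := by field_simp

theorem hostKraPow_eq_zero_of_le {T : X ≃ᵐ X} (hT : MeasurePreserving T μ μ) {R : ℝ} {f : X → ℂ}
    (hf : BddMeas R f) {k K : ℕ} (h : k ≤ K) (h0 : hostKraPow μ T K f = 0) :
    hostKraPow μ T k f = 0 := by
  induction K, h using Nat.le_induction with
  | base => exact h0
  | succ n hn ih =>
    have := sq_hostKraPow_le hT n hf
    rw [h0] at this
    exact ih (pow_eq_zero_iff two_ne_zero |>.1 (le_antisymm this (sq_nonneg _)))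

omit [IsProbabilityMeasure μ] in
theorem hostKraSeminorm_congr_ae {T : X ≃ᵐ X} (hT : MeasurePreserving T μ μ) (k : ℕ)
    {f g : X → ℂ} (h : f =ᵐ[μ] g) : hostKraSeminorm μ T k f = hostKraSeminorm μ T k g := by
  match k with
  | 0 => rfl
  | 1 =>
    simp only [hostKraSeminorm]
    rw [eLpNorm_congr_ae (condExp_congr_ae h)]
  | k + 2 =>
    have (n : ℤ) : hostKraSeminorm μ T (k + 1) (fun x => conj (f x) * f (iter T n x)) =
        hostKraSeminorm μ T (k + 1) (fun x => conj (g x) * g (iter T n x)) := by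
      refine hostKraSeminorm_congr_ae hT (k + 1) ?_
      filter_upwards [h, (measurePreserving_iter hT n).quasiMeasurePreserving.ae h] with x h1 h2
      rw [h1, h2]
    simp only [hostKraSeminorm, this]

end HostKra

/-! ### Van der Corput's inequality -/

theorem sum_comp_le_sum_of_injOn {α β : Type*} [DecidableEq β] {s : Finset α} {t : Finset β}
    {e : α → β} (he : Set.InjOn e s) (hst : ∀ x ∈ s, e x ∈ t) {b : β → ℝ} (hb : ∀ y, 0 ≤ b y) :
    ∑ x ∈ s, b (e x) ≤ ∑ y ∈ t, b y := by
  rw [← Finset.sum_image (f := b) he]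
  exact Finset.sum_le_sum_of_subset_of_nonneg (Finset.image_subset_iff.2 hst) fun y _ _ => hb y

theorem norm_sum_range_shift_sub_le {E : Type*} [SeminormedAddCommGroup E] {g : ℕ → E} {R : ℝ}
    (hg : ∀ n, ‖g n‖ ≤ R) (N h : ℕ) :
    ‖∑ n ∈ Finset.range N, g (n + h) - ∑ n ∈ Finset.range N, g n‖ ≤ 2 * R * h := by
  have h1 : ∑ n ∈ Finset.range N, g (n + h) - ∑ n ∈ Finset.range N, g n =
      ∑ n ∈ Finset.range h, g (N + n) - ∑ n ∈ Finset.range h, g n := by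
    have e1 := Finset.sum_range_add g N h
    have e2 := Finset.sum_range_add g h N
    rw [add_comm h N] at e2
    have e3 : ∑ n ∈ Finset.range N, g (n + h) = ∑ n ∈ Finset.range N, g (h + n) :=
      Finset.sum_congr rfl fun n _ => by rw [add_comm]
    rw [e3, sub_eq_sub_iff_add_eq_add, add_comm, ← e2, e1, add_comm]
  have h2 : ∀ u : ℕ → ℕ, ‖∑ n ∈ Finset.range h, g (u n)‖ ≤ R * h := fun u =>
    (norm_sum_le_of_le _ fun n _ => hg (u n)).trans (by simp [mul_comm])
  rw [h1]
  exact (norm_sub_le _ _).trans (by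
    have := h2 (N + ·)
    have := h2 id
    simp only [id] at *
    linarith)

/-- **Van der Corput's inequality** in an inner product space. -/
theorem vanDerCorput {E : Type*} [SeminormedAddCommGroup E] [InnerProductSpace ℂ E] {v : ℕ → E}
    {R : ℝ} (hv : ∀ n, ‖v n‖ ≤ R) {H N : ℕ} (hH : 0 < H) (hN : 0 < N) :
    ((N : ℝ)⁻¹ * ‖∑ n ∈ Finset.range N, v n‖) ^ 2 ≤
      4 * ((H : ℝ)⁻¹ * ∑ h ∈ Finset.range H,
        (N : ℝ)⁻¹ * ‖∑ n ∈ Finset.range N, inner ℂ (v n) (v (n + h))‖) +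
      12 * R ^ 2 * H ^ 2 / N := by
  have hR : 0 ≤ R := (norm_nonneg _).trans (hv 0)
  have hH' : (0 : ℝ) < H := by exact_mod_cast hH
  have hN' : (0 : ℝ) < N := by exact_mod_cast hN
  set b : ℕ → ℝ := fun h => ‖∑ n ∈ Finset.range N, inner ℂ (v n) (v (n + h))‖ with hb
  have hb0 : ∀ h, 0 ≤ b h := fun h => norm_nonneg _
  have hinner : ∀ h n, ‖inner ℂ (v n) (v (n + h))‖ ≤ R ^ 2 := fun h n =>
    (norm_inner_le_norm _ _).trans (by
      rw [sq]; exact mul_le_mul (hv _) (hv _) (norm_nonneg _) hR)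
  -- Each vector is replaced by the sum over a window of length H, at the cost of boundary terms.
  -- Expanding ‖u n‖² produces the correlations with lags below H.
  set u : ℕ → E := fun n => ∑ h ∈ Finset.range H, v (n + h) with hu
  have h1 : H * ‖∑ n ∈ Finset.range N, v n‖ ≤ ‖∑ n ∈ Finset.range N, u n‖ + 2 * R * H * H := by
    have e : (H : ℂ) • ∑ n ∈ Finset.range N, v n = ∑ n ∈ Finset.range N, u n -
        ∑ h ∈ Finset.range H, (∑ n ∈ Finset.range N, v (n + h) - ∑ n ∈ Finset.range N, v n) := by
      rw [Finset.sum_sub_distrib, hu, Finset.sum_comm, sub_sub_cancel, Finset.sum_const,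
        Finset.card_range, Nat.cast_smul_eq_nsmul]
    have e2 : H * ‖∑ n ∈ Finset.range N, v n‖ = ‖(H : ℂ) • ∑ n ∈ Finset.range N, v n‖ := by
      rw [norm_smul]; simp
    rw [e2, e]
    refine (norm_sub_le _ _).trans (add_le_add le_rfl ?_)
    have : ∀ h ∈ Finset.range H, ‖∑ n ∈ Finset.range N, v (n + h) - ∑ n ∈ Finset.range N, v n‖ ≤
        2 * R * H := fun h hh => (norm_sum_range_shift_sub_le hv N h).trans
      (mul_le_mul_of_nonneg_left (by exact_mod_cast (Finset.mem_range.1 hh).le) (by positivity))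
    refine (norm_sum_le_of_le _ this).trans ?_
    simp [mul_comm]
  have h2 : ∀ h h', h' ≤ h → h < H → (∑ n ∈ Finset.range N,
      (inner ℂ (v (n + h')) (v (n + h))).re) ≤ b (h - h') + 2 * R ^ 2 * H := by
    intro h h' hle hlt
    have e := norm_sum_range_shift_sub_le (hinner (h - h')) N h'
    have e1 : ∀ n, n + h' + (h - h') = n + h := fun n => by omega
    simp only [e1] at e
    rw [← Complex.re_sum]
    refine (Complex.re_le_norm _).trans ?_
    have e2 := norm_add_le (∑ n ∈ Finset.range N, inner ℂ (v (n + h')) (v (n + h)) -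
      ∑ n ∈ Finset.range N, inner ℂ (v n) (v (n + (h - h'))))
      (∑ n ∈ Finset.range N, inner ℂ (v n) (v (n + (h - h'))))
    rw [sub_add_cancel] at e2
    have e3 : (2 : ℝ) * R ^ 2 * h' ≤ 2 * R ^ 2 * H :=
      mul_le_mul_of_nonneg_left (by exact_mod_cast (hle.trans hlt.le)) (by positivity)
    simp only [hb]
    linarith
  have h3 : ∑ n ∈ Finset.range N, ‖u n‖ ^ 2 ≤
      2 * H * ∑ h ∈ Finset.range H, b h + 2 * R ^ 2 * H * H ^ 2 := by
    have e1 : ∀ n, ‖u n‖ ^ 2 = ∑ h ∈ Finset.range H, ∑ h' ∈ Finset.range H,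
        (inner ℂ (v (n + h')) (v (n + h))).re := by
      intro n
      have := inner_self_eq_norm_sq (𝕜 := ℂ) (u n)
      rw [← this]
      simp only [hu, inner_sum, sum_inner]
      rw [RCLike.re_to_complex, Complex.re_sum]
      simp only [Complex.re_sum]
    simp only [e1]
    rw [Finset.sum_comm]
    have e2 : ∀ h ∈ Finset.range H, ∑ n ∈ Finset.range N, ∑ h' ∈ Finset.range H,
        (inner ℂ (v (n + h')) (v (n + h))).re ≤
        2 * ∑ h ∈ Finset.range H, b h + 2 * R ^ 2 * H * H := by
      intro h hh
      rw [Finset.sum_comm]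
      -- The diagonal h' = h is counted in both terms, which is harmless since b is nonnegative.
      -- Each lag then occurs at most once in either sum, whence the factor 2.
      have e3 : ∀ h' ∈ Finset.range H, ∑ n ∈ Finset.range N,
          (inner ℂ (v (n + h')) (v (n + h))).re ≤
          ((if h' ≤ h then b (h - h') else 0) + if h ≤ h' then b (h' - h) else 0) +
            2 * R ^ 2 * H := by
        intro h' hh'
        rcases le_total h' h with hle | hle
        · refine (h2 h h' hle (Finset.mem_range.1 hh)).trans ?_
          rw [if_pos hle]
          have : 0 ≤ if h ≤ h' then b (h' - h) else 0 := by split_ifs <;> simp [hb0]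
          linarith
        · have := h2 h' h hle (Finset.mem_range.1 hh')
          have e4 : ∀ n, (inner ℂ (v (n + h')) (v (n + h))).re =
              (inner ℂ (v (n + h)) (v (n + h'))).re := fun n => by
            rw [← inner_conj_symm, Complex.conj_re]
          simp only [e4]
          refine this.trans ?_
          rw [if_pos hle]
          have : 0 ≤ if h' ≤ h then b (h - h') else 0 := by split_ifs <;> simp [hb0]
          linarith
      refine (Finset.sum_le_sum e3).trans ?_
      rw [Finset.sum_add_distrib, Finset.sum_add_distrib, Finset.sum_const, Finset.card_range,
        nsmul_eq_mul, ← Finset.sum_filter, ← Finset.sum_filter]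
      have e5 : ∑ h' ∈ Finset.range H with h' ≤ h, b (h - h') ≤ ∑ r ∈ Finset.range H, b r :=
        sum_comp_le_sum_of_injOn (fun x hx y hy hxy => by
          simp only [Finset.coe_filter, Set.mem_ofPred_eq] at hx hy hxy; omega)
          (fun x hx => by simp only [Finset.mem_filter, Finset.mem_range] at hx hh ⊢; omega) hb0
      have e6 : ∑ h' ∈ Finset.range H with h ≤ h', b (h' - h) ≤ ∑ r ∈ Finset.range H, b r :=
        sum_comp_le_sum_of_injOn (fun x hx y hy hxy => by
          simp only [Finset.coe_filter, Set.mem_ofPred_eq] at hx hy hxy; omega)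
          (fun x hx => by simp only [Finset.mem_filter, Finset.mem_range] at hx hh ⊢; omega) hb0
      nlinarith
    refine (Finset.sum_le_sum e2).trans (le_of_eq ?_)
    rw [Finset.sum_const, Finset.card_range, nsmul_eq_mul]
    ring
  have h4 : ‖∑ n ∈ Finset.range N, u n‖ ^ 2 ≤ N * ∑ n ∈ Finset.range N, ‖u n‖ ^ 2 := by
    refine (pow_le_pow_left₀ (norm_nonneg _) (norm_sum_le _ _) 2).trans ?_
    simpa using sq_sum_le_card_mul_sum_sq (s := Finset.range N) (f := fun n => ‖u n‖)
  have h5 : (H * ‖∑ n ∈ Finset.range N, v n‖) ^ 2 ≤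
      2 * (N * (2 * H * ∑ h ∈ Finset.range H, b h + 2 * R ^ 2 * H * H ^ 2)) +
        8 * R ^ 2 * H ^ 4 := by
    have e1 := pow_le_pow_left₀ (by positivity) h1 2
    have e2 := h4.trans (mul_le_mul_of_nonneg_left h3 hN'.le)
    nlinarith [sq_nonneg (‖∑ n ∈ Finset.range N, u n‖ - 2 * R * H * H)]
  rw [← Finset.mul_sum]
  have h6 : ((N : ℝ)⁻¹ * ‖∑ n ∈ Finset.range N, v n‖) ^ 2 =
      (N : ℝ)⁻¹ ^ 2 * (H : ℝ)⁻¹ ^ 2 * (H * ‖∑ n ∈ Finset.range N, v n‖) ^ 2 := by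
    field_simp
  rw [h6]
  refine (mul_le_mul_of_nonneg_left h5 (by positivity)).trans ?_
  have hH1 : (1 : ℝ) ≤ H := by exact_mod_cast hH
  have hN1 : (1 : ℝ) ≤ N := by exact_mod_cast hN
  have h7 : (N : ℝ)⁻¹ ^ 2 * (H : ℝ)⁻¹ ^ 2 * (2 * (N * (2 * H * ∑ h ∈ Finset.range H, b h +
      2 * R ^ 2 * H * H ^ 2)) + 8 * R ^ 2 * H ^ 4) =
      4 * ((H : ℝ)⁻¹ * ((N : ℝ)⁻¹ * ∑ h ∈ Finset.range H, b h)) +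
        (4 * R ^ 2 * H / N + 8 * R ^ 2 * H ^ 2 / N / N) := by
    field_simp
    ring
  rw [h7]
  refine add_le_add le_rfl ?_
  have h8 : 4 * R ^ 2 * H / N ≤ 4 * R ^ 2 * H ^ 2 / N := by
    gcongr
    nlinarith
  have h9 : 8 * R ^ 2 * H ^ 2 / N / N ≤ 8 * R ^ 2 * H ^ 2 / N := div_le_self (by positivity) hN1
  calc _ ≤ 4 * R ^ 2 * H ^ 2 / N + 8 * R ^ 2 * H ^ 2 / N := add_le_add h8 h9
    _ = _ := by ring

/-! ### Van der Corput's inequality for correlations -/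

section

variable {X : Type*} [MeasurableSpace X] {μ : Measure X} [IsProbabilityMeasure μ]

theorem BddMeas.nonneg {R : ℝ} {f : X → ℂ} (hf : BddMeas R f) (μ : Measure X)
    [IsProbabilityMeasure μ] : 0 ≤ R :=
  (norm_nonneg _).trans (hf.norm_integral_le μ)

theorem BddMeas.norm_toLp_le {R : ℝ} {f : X → ℂ} (hf : BddMeas R f) :
    ‖(hf.memLp μ 2).toLp f‖ ≤ R := by
  have := Lp.norm_le_of_ae_bound (f := (hf.memLp μ 2).toLp f) (hf.nonneg μ) (C := R) (by
    filter_upwards [(hf.memLp μ 2).coeFn_toLp] with x hx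
    rw [hx]
    exact hf.2 x)
  have h1 : measureUnivNNReal μ = 1 := by simp [measureUnivNNReal]
  simpa [h1] using this

omit [IsProbabilityMeasure μ] in
theorem inner_toLp {f g : X → ℂ} (hf : MemLp f 2 μ) (hg : MemLp g 2 μ) :
    inner ℂ (hf.toLp f) (hg.toLp g) = ∫ x, conj (f x) * g x ∂μ := by
  rw [L2.inner_def]
  refine integral_congr_ae ?_
  filter_upwards [hf.coeFn_toLp, hg.coeFn_toLp] with x h1 h2
  rw [h1, h2]
  simp [mul_comm]

/-- Van der Corput's inequality for averages of correlations with a bounded function. -/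
theorem sq_avg_norm_integral_le {R C : ℝ} {φ : X → ℂ} {F : ℕ → X → ℂ} (hφ : BddMeas R φ)
    (hF : ∀ n, BddMeas C (F n)) {H N : ℕ} (hH : 0 < H) (hN : 0 < N) :
    ((N : ℝ)⁻¹ * ∑ n ∈ Finset.range N, ‖∫ x, φ x * F n x ∂μ‖) ^ 2 ≤
      R ^ 2 * (4 * ((H : ℝ)⁻¹ * ∑ h ∈ Finset.range H,
        (N : ℝ)⁻¹ * ∑ n ∈ Finset.range N, ‖∫ x, conj (F n x) * F (n + h) x ∂μ‖) +
      12 * C ^ 2 * H ^ 2 / N) := by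
  set z : ℕ → ℂ := fun n => ∫ x, φ x * F n x ∂μ with hz
  -- The phases that make w n · z n = |z n|; for z n = 0 the quotient is 0, so only ‖w n‖ ≤ 1 is
  -- available, and it suffices.
  set w : ℕ → ℂ := fun n => conj (z n) / ‖z n‖ with hw
  have hw1 : ∀ n, ‖w n‖ ≤ 1 := fun n => by
    simp only [hw, norm_div, RCLike.norm_conj, Complex.norm_real, norm_norm]
    exact div_self_le_one _
  have hwz : ∀ n, w n * z n = ‖z n‖ := fun n => by
    by_cases h : z n = 0
    · simp [h]
    · have h' : (‖z n‖ : ℂ) ≠ 0 := by simpa using h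
      simp only [hw]
      rw [div_mul_eq_mul_div, mul_comm, Complex.mul_conj, Complex.normSq_eq_norm_sq]
      push_cast
      field_simp
  set v : ℕ → Lp ℂ 2 μ := fun n => w n • ((hF n).memLp μ 2).toLp (F n) with hv
  have hC := (hF 0).nonneg μ
  have hvC : ∀ n, ‖v n‖ ≤ C := fun n => by
    rw [hv, norm_smul]
    calc _ ≤ 1 * C := mul_le_mul (hw1 n) (hF n).norm_toLp_le (norm_nonneg _) zero_le_one
      _ = C := one_mul C
  have h1 : ((∑ n ∈ Finset.range N, ‖z n‖ : ℝ) : ℂ) =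
      inner ℂ ((hφ.conj.memLp μ 2).toLp _) (∑ n ∈ Finset.range N, v n) := by
    rw [inner_sum]
    push_cast
    refine Finset.sum_congr rfl fun n _ => ?_
    rw [hv, inner_smul_right, inner_toLp]
    simp only [Complex.conj_conj]
    exact (hwz n).symm
  have h2 : ∑ n ∈ Finset.range N, ‖z n‖ ≤ R * ‖∑ n ∈ Finset.range N, v n‖ := by
    have e : ∑ n ∈ Finset.range N, ‖z n‖ = ‖((∑ n ∈ Finset.range N, ‖z n‖ : ℝ) : ℂ)‖ := by
      rw [Complex.norm_real, Real.norm_of_nonneg (Finset.sum_nonneg fun n _ => norm_nonneg _)]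
    rw [e, h1]
    exact (norm_inner_le_norm _ _).trans
      (mul_le_mul_of_nonneg_right hφ.conj.norm_toLp_le (norm_nonneg _))
  have hR := hφ.nonneg μ
  calc ((N : ℝ)⁻¹ * ∑ n ∈ Finset.range N, ‖z n‖) ^ 2
      ≤ ((N : ℝ)⁻¹ * (R * ‖∑ n ∈ Finset.range N, v n‖)) ^ 2 := by gcongr
    _ = R ^ 2 * ((N : ℝ)⁻¹ * ‖∑ n ∈ Finset.range N, v n‖) ^ 2 := by ring
    _ ≤ R ^ 2 * (4 * ((H : ℝ)⁻¹ * ∑ h ∈ Finset.range H,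
        (N : ℝ)⁻¹ * ‖∑ n ∈ Finset.range N, inner ℂ (v n) (v (n + h))‖) +
        12 * C ^ 2 * H ^ 2 / N) :=
      mul_le_mul_of_nonneg_left (vanDerCorput hvC hH hN) (sq_nonneg R)
    _ ≤ _ := by
      gcongr with h _
      refine norm_sum_le_of_le _ fun n _ => ?_
      simp only [hv]
      rw [inner_smul_left, inner_smul_right, inner_toLp, norm_mul, norm_mul, RCLike.norm_conj]
      calc _ ≤ 1 * (1 * ‖∫ x, conj (F n x) * F (n + h) x ∂μ‖) := by
            gcongr
            · exact hw1 n
            · exact hw1 _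
        _ = _ := by ring

end

/-! ### Averages along multiples of one transformation -/

section

variable {X : Type*} [MeasurableSpace X] {μ : Measure X} [IsProbabilityMeasure μ]

omit [IsProbabilityMeasure μ] in
theorem integral_comp_iter {T : X ≃ᵐ X} (hT : MeasurePreserving T μ μ) (n : ℤ) {f : X → ℂ}
    (hf : Measurable f) : ∫ x, f (iter T n x) ∂μ = ∫ x, f x ∂μ := by
  conv_rhs => rw [← (measurePreserving_iter hT n).map_eq]
  rw [integral_map (measurable_iter T n).aemeasurable hf.aestronglyMeasurable]

/-- Averages of nonnegative numbers along multiples of `e ≠ 0` are controlled by averages over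
intervals. -/
theorem avg_multiples_le {a : ℤ → ℝ} (ha : ∀ n, 0 ≤ a n) {e : ℤ} (he : e ≠ 0) {H : ℕ}
    (hH : 0 < H) :
    (H : ℝ)⁻¹ * ∑ h ∈ Finset.range H, a (e * h) ≤
      2 * |(e : ℝ)| * intervalAvg a (-(|e| * H), |e| * H) := by
  have h1 : ∑ h ∈ Finset.range H, a (e * h) ≤
      ∑ n ∈ Finset.Ico (-(|e| * (H : ℤ))) (|e| * H), a n := by
    refine sum_comp_le_sum_of_injOn (e := fun h : ℕ => e * (h : ℤ)) ?_ ?_ ha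
    · intro x _ y _ hxy
      exact_mod_cast mul_left_cancel₀ he hxy
    · intro x hx
      have hx' : (x : ℤ) < H := by exact_mod_cast Finset.mem_range.1 hx
      have h2 : |e * (x : ℤ)| < |e| * H := by
        rw [abs_mul, Nat.abs_cast]
        exact mul_lt_mul_of_pos_left hx' (abs_pos.2 he)
      rw [abs_lt] at h2
      rw [Finset.mem_Ico]
      exact ⟨h2.1.le, h2.2⟩
  have he' : (0 : ℝ) < |(e : ℝ)| := abs_pos.2 (by exact_mod_cast he)
  have hH' : (0 : ℝ) < H := by exact_mod_cast hH
  simp only [intervalAvg]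
  have h3 : ((|e| * (H : ℤ) - -(|e| * (H : ℤ)) : ℤ) : ℝ) = 2 * |(e : ℝ)| * H := by
    push_cast; ring
  rw [h3]
  calc _ ≤ (H : ℝ)⁻¹ * ∑ n ∈ Finset.Ico (-(|e| * (H : ℤ))) (|e| * H), a n := by gcongr
    _ = _ := by field_simp

/-- Induction on the number of other functions. After a translation the last of them is a fixed test
function, which van der Corput's inequality removes; f becomes its multiplicative differences with
shifts e·h, whose seminorms of one order less are small for most h. As the induction hypothesis
meets varying functions, δ must not depend on f, while L₀ may. -/
theorem exists_avg_correlation_le {T : X ≃ᵐ X} (hT : MeasurePreserving T μ μ) (n : ℕ) :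
    ∀ (c₀ : ℤ) (c : Fin n → ℤ), (∀ j, c j ≠ c₀) → ∀ R ε : ℝ, 0 < ε →
    ∃ δ > 0, ∀ f : X → ℂ, BddMeas R f → hostKraPow μ T (n + 1) f ≤ δ →
    ∃ L₀ : ℕ, ∀ L ≥ L₀, ∀ φ : Fin n → X → ℂ, (∀ j, BddMeas R (φ j)) →
      (L : ℝ)⁻¹ * ∑ k ∈ Finset.range L,
        ‖∫ x, f (iter T (c₀ * k) x) * ∏ j, φ j (iter T (c j * k) x) ∂μ‖ ≤ ε := by
  induction n with
  | zero =>
    intro c₀ c _ R ε hε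
    refine ⟨ε ^ 2, by positivity, fun f hf hQ => ⟨0, fun L _ φ _ => ?_⟩⟩
    have h1 : ‖∫ x, f x ∂μ‖ ≤ ε := by
      have := (sq_norm_integral_le_hostKraPow_one hf).trans hQ
      exact (sq_le_sq₀ (norm_nonneg _) hε.le).1 this
    have h2 : ∀ k : ℕ, ‖∫ x, f (iter T (c₀ * k) x) * ∏ j, φ j (iter T (c j * k) x) ∂μ‖ ≤ ε := by
      intro k
      simp only [Finset.univ_eq_empty, Finset.prod_empty, mul_one]
      rwa [integral_comp_iter hT _ hf.1]
    calc _ ≤ (L : ℝ)⁻¹ * ∑ k ∈ Finset.range L, ε := by gcongr with k _; exact h2 k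
      _ = (L : ℝ)⁻¹ * L * ε := by simp [mul_assoc]
      _ ≤ 1 * ε := by gcongr; exact inv_mul_le_one
      _ = ε := one_mul ε
  | succ n ih =>
    intro c₀ c hc R ε hε
    set e : ℤ := c₀ - c (Fin.last n) with he
    have he0 : e ≠ 0 := sub_ne_zero.2 (hc _).symm
    set c' : Fin n → ℤ := fun j => c j.castSucc - c (Fin.last n) with hc'
    have hc'e : ∀ j, c' j ≠ e := fun j h => hc j.castSucc (by simp only [hc', he] at h; omega)
    -- The final bound is R²(4·2ε₁ + ε₁), whence the 9.
    set ε₁ : ℝ := ε ^ 2 / (9 * (R ^ 2 + 1)) with hε₁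
    have hε₁0 : 0 < ε₁ := by positivity
    obtain ⟨δ₁, hδ₁, ih⟩ := ih e c' hc'e (R * R) ε₁ hε₁0
    set C : ℝ := R * R ^ n with hC
    have heR : (0 : ℝ) < |(e : ℝ)| := abs_pos.2 (by exact_mod_cast he0)
    -- Makes C²/δ₁ · 4|e|δ ≤ ε₁. The factor 4|e| is the loss 2|e| in passing from multiples of e to
    -- intervals, times the bound 2δ for a long average.
    set δ : ℝ := δ₁ * ε₁ / (4 * |(e : ℝ)| * (C ^ 2 + 1)) with hδ
    have hδ0 : 0 < δ := by positivity
    refine ⟨δ, hδ0, fun f hf hQ => ?_⟩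
    have hR : 0 ≤ R := hf.nonneg μ
    set a : ℤ → ℝ := fun m => hostKraPow μ T (n + 1) (mulDiff T m f) with ha
    have ha0 : ∀ m, 0 ≤ a m := fun m => hostKraPow_succ_nonneg T n _
    have hlim := tendsto_hostKraPow hT (n + 1) hf
    have h1 : ∀ᶠ p in longIntervals, intervalAvg a p < 2 * δ :=
      hlim.eventually_lt_const (by linarith)
    obtain ⟨P, hP⟩ := eventually_longIntervals.1 h1
    set H : ℕ := P.toNat + 1 with hH
    have hH0 : 0 < H := by omega
    have h2 : (H : ℝ)⁻¹ * ∑ h ∈ Finset.range H, a (e * h) ≤ 4 * |(e : ℝ)| * δ := by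
      refine (avg_multiples_le ha0 he0 hH0).trans ?_
      have : P ≤ |e| * (H : ℤ) - -(|e| * (H : ℤ)) := by
        have e1 : (1 : ℤ) ≤ |e| := Int.one_le_abs he0
        have e2 : (H : ℤ) ≤ |e| * H := le_mul_of_one_le_left (by positivity) e1
        omega
      have := hP (-(|e| * (H : ℤ)), |e| * H) this
      nlinarith
    choose! L₀ hL₀ using fun (h : ℕ) (hh : a (e * h) ≤ δ₁) => ih _ (hf.mulDiff T (e * h)) hh
    obtain ⟨L₁, hL₁⟩ := exists_nat_gt (12 * C ^ 2 * H ^ 2 / ε₁)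
    refine ⟨(∑ h ∈ Finset.range H, L₀ h) + L₁ + 1, fun L hL φ hφ => ?_⟩
    have hL0 : 0 < L := by omega
    have hL0' : (0 : ℝ) < L := by exact_mod_cast hL0
    set F : ℕ → X → ℂ := fun k x => f (iter T (e * k) x) * ∏ j : Fin n,
      φ j.castSucc (iter T (c' j * k) x) with hF
    have hFb : ∀ k, BddMeas C (F k) := fun k => by
      have := BddMeas.prod Finset.univ (f := fun (j : Fin n) x =>
        φ j.castSucc (iter T (c' j * k) x)) (fun j => (hφ j.castSucc).comp (measurable_iter T _))
      rw [Finset.card_univ, Fintype.card_fin] at this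
      exact (hf.comp (measurable_iter T _)).mul this
    have h3 : ∀ k : ℕ, ∫ x, f (iter T (c₀ * k) x) * ∏ j, φ j (iter T (c j * k) x) ∂μ =
        ∫ x, φ (Fin.last n) x * F k x ∂μ := by
      intro k
      rw [← integral_comp_iter hT (c (Fin.last n) * k) ((hφ _).mul (hFb k)).1]
      congr 1
      funext x
      simp only [hF]
      rw [Fin.prod_univ_castSucc, ← iter_add]
      have e1 : e * (k : ℤ) + c (Fin.last n) * k = c₀ * k := by rw [he]; ring
      have e2 : ∀ j : Fin n, c' j * (k : ℤ) + c (Fin.last n) * k = c j.castSucc * k := fun j => by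
        simp only [hc']; ring
      simp only [← iter_add, e1, e2]
      ring
    simp only [h3]
    have h4 := sq_avg_norm_integral_le (μ := μ) (hφ (Fin.last n)) hFb hH0 hL0
    have h5 : ∀ h ∈ Finset.range H, (L : ℝ)⁻¹ * ∑ k ∈ Finset.range L,
        ‖∫ x, conj (F k x) * F (k + h) x ∂μ‖ ≤ ε₁ + C ^ 2 / δ₁ * a (e * h) := by
      intro h hh
      have e0 : 0 ≤ C ^ 2 / δ₁ * a (e * h) := mul_nonneg (by positivity) (ha0 _)
      -- Markov's inequality: where the seminorm of the difference is not small, the trivial bound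
      -- C² is at most C²/δ₁ · a(e·h).
      rcases le_or_gt (a (e * h)) δ₁ with hle | hlt
      · have hLh : L₀ h ≤ L := by
          have := Finset.single_le_sum (f := L₀) (fun i _ => Nat.zero_le _) hh
          omega
        have := hL₀ h hle L hLh (fun j => mulDiff T (c' j * h) (φ j.castSucc))
          (fun j => (hφ j.castSucc).mulDiff T _)
        refine le_trans (le_of_eq ?_) (this.trans (le_add_of_nonneg_right e0))
        congr 1
        refine Finset.sum_congr rfl fun k _ => ?_
        congr 2
        funext x
        simp only [hF, mulDiff, map_mul, map_prod, Finset.prod_mul_distrib, ← iter_add]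
        have e1 : ∀ m : ℤ, m * ((k + h : ℕ) : ℤ) = m * h + m * k := fun m => by push_cast; ring
        simp only [e1]
        ring
      · have e1 : ∀ k, ‖∫ x, conj (F k x) * F (k + h) x ∂μ‖ ≤ C ^ 2 := fun k => by
          rw [sq]
          exact ((hFb k).conj.mul (hFb (k + h))).norm_integral_le μ
        have e2 : C ^ 2 ≤ C ^ 2 / δ₁ * a (e * h) := by
          rw [div_mul_eq_mul_div, le_div_iff₀ hδ₁]
          exact mul_le_mul_of_nonneg_left hlt.le (sq_nonneg C)
        calc _ ≤ (L : ℝ)⁻¹ * ∑ k ∈ Finset.range L, C ^ 2 := by gcongr with k _; exact e1 k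
          _ = C ^ 2 := by simp; field_simp
          _ ≤ _ := by linarith
    have h6 : (H : ℝ)⁻¹ * ∑ h ∈ Finset.range H, (L : ℝ)⁻¹ * ∑ k ∈ Finset.range L,
        ‖∫ x, conj (F k x) * F (k + h) x ∂μ‖ ≤ 2 * ε₁ := by
      have hH' : (0 : ℝ) < H := by exact_mod_cast hH0
      calc _ ≤ (H : ℝ)⁻¹ * ∑ h ∈ Finset.range H, (ε₁ + C ^ 2 / δ₁ * a (e * h)) := by
            gcongr with h hh; exact h5 h hh
        _ = ε₁ + C ^ 2 / δ₁ * ((H : ℝ)⁻¹ * ∑ h ∈ Finset.range H, a (e * h)) := by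
            rw [Finset.sum_add_distrib, ← Finset.mul_sum, Finset.sum_const, Finset.card_range,
              nsmul_eq_mul]
            field_simp
        _ ≤ ε₁ + C ^ 2 / δ₁ * (4 * |(e : ℝ)| * δ) := by gcongr
        _ = ε₁ + C ^ 2 / (C ^ 2 + 1) * ε₁ := by rw [hδ]; field_simp
        _ ≤ ε₁ + 1 * ε₁ := by
            gcongr
            rw [div_le_one (by positivity)]
            linarith
        _ = 2 * ε₁ := by ring
    have h7 : 12 * C ^ 2 * H ^ 2 / L ≤ ε₁ := by
      rw [div_le_iff₀ hL0']
      rw [div_lt_iff₀ hε₁0] at hL₁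
      have : (L₁ : ℝ) ≤ L := by exact_mod_cast (by omega : L₁ ≤ L)
      nlinarith
    have h8 : ((L : ℝ)⁻¹ * ∑ k ∈ Finset.range L, ‖∫ x, φ (Fin.last n) x * F k x ∂μ‖) ^ 2 ≤
        ε ^ 2 := by
      refine h4.trans ?_
      calc _ ≤ R ^ 2 * (4 * (2 * ε₁) + ε₁) := by gcongr
        _ = R ^ 2 / (R ^ 2 + 1) * ε ^ 2 := by rw [hε₁]; field_simp; ring
        _ ≤ 1 * ε ^ 2 := by
            gcongr
            rw [div_le_one (by positivity)]
            linarith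
        _ = ε ^ 2 := one_mul _
    exact (sq_le_sq₀ (mul_nonneg (by positivity) (Finset.sum_nonneg fun _ _ => norm_nonneg _))
      hε.le).1 h8

end

/-! ### Difference operators on real sequences -/

open Polynomial in
/-- The shift on real sequences. -/
def seqShift : Module.End ℤ (ℕ → ℝ) where
  toFun a n := a (n + 1)
  map_add' _ _ := rfl
  map_smul' _ _ := rfl

open Polynomial in
/-- The action of an integer polynomial in the shift on a real sequence. -/
noncomputable def polyShift (q : ℤ[X]) (a : ℕ → ℝ) : ℕ → ℝ := aeval seqShift q a

/-- The iterated difference `Δʳ a`. -/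
noncomputable def diffSeq (r : ℕ) (a : ℕ → ℝ) : ℕ → ℝ := polyShift ((Polynomial.X - 1) ^ r) a

section

open Polynomial

theorem polyShift_mul (p q : ℤ[X]) (a : ℕ → ℝ) :
    polyShift (p * q) a = polyShift p (polyShift q a) := by
  simp [polyShift]

theorem polyShift_add (p q : ℤ[X]) (a : ℕ → ℝ) :
    polyShift (p + q) a = polyShift p a + polyShift q a := by
  simp [polyShift]

theorem polyShift_sub (p q : ℤ[X]) (a : ℕ → ℝ) :
    polyShift (p - q) a = polyShift p a - polyShift q a := by
  simp [polyShift]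

theorem polyShift_one (a : ℕ → ℝ) : polyShift 1 a = a := by
  simp [polyShift]

theorem polyShift_zero (a : ℕ → ℝ) : polyShift 0 a = 0 := by
  simp [polyShift]

theorem polyShift_X_pow (k : ℕ) (a : ℕ → ℝ) : polyShift (X ^ k) a = fun n => a (n + k) := by
  induction k with
  | zero => simp [polyShift_one]
  | succ k ih =>
    rw [pow_succ', polyShift_mul, ih]
    funext n
    simp [polyShift, seqShift, add_assoc, add_comm 1]

theorem polyShift_C (z : ℤ) (a : ℕ → ℝ) : polyShift (C z) a = fun n => (z : ℝ) * a n := by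
  funext n
  simp [polyShift]

theorem polyShift_X_sub_one (a : ℕ → ℝ) : polyShift (X - 1) a = fun n => a (n + 1) - a n := by
  funext n
  have := congrFun (polyShift_X_pow 1 a) n
  rw [pow_one] at this
  simp [polyShift_sub, polyShift_one, this]

theorem diffSeq_zero (a : ℕ → ℝ) : diffSeq 0 a = a := by simp [diffSeq, polyShift_one]

theorem diffSeq_succ (r : ℕ) (a : ℕ → ℝ) (n : ℕ) :
    diffSeq (r + 1) a n = diffSeq r a (n + 1) - diffSeq r a n := by
  rw [diffSeq, pow_succ', polyShift_mul, polyShift_X_sub_one]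
  rfl

theorem diffSeq_add (r s : ℕ) (a : ℕ → ℝ) : diffSeq (r + s) a = diffSeq r (diffSeq s a) := by
  rw [diffSeq, pow_add, polyShift_mul]
  rfl

theorem polyShift_pow_mul (r : ℕ) (u : ℤ[X]) (a : ℕ → ℝ) :
    polyShift ((X - 1) ^ r * u) a = polyShift u (diffSeq r a) := by
  rw [mul_comm, polyShift_mul]
  rfl

theorem tendsto_add_nat (k : ℕ) : Tendsto (fun n : ℕ => n + k) atTop atTop :=
  tendsto_add_atTop_nat k

theorem polyShift_induction {P : (ℕ → ℝ) → Prop} {b : ℕ → ℝ} (hadd : ∀ a a', P a → P a' → P (a + a'))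
    (hmul : ∀ (z : ℤ) a, P a → P fun n => (z : ℝ) * a n) (hb : ∀ k : ℕ, P fun n => b (n + k))
    (q : ℤ[X]) : P (polyShift q b) := by
  induction q using Polynomial.induction_on' with
  | add p q hp hq =>
    rw [polyShift_add]
    exact hadd _ _ hp hq
  | monomial k z =>
    rw [← C_mul_X_pow_eq_monomial, polyShift_mul, polyShift_C, polyShift_X_pow]
    exact hmul _ _ (hb k)

theorem isBigO_shift_of_isLittleO_diff {b : ℕ → ℝ}
    (hb : (fun n => b (n + 1) - b n) =o[atTop] b) (k : ℕ) :
    (fun n => b (n + k)) =O[atTop] b := by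
  induction k with
  | zero => exact isBigO_refl _ _
  | succ k ih =>
    have h1 : (fun n => b (n + 1)) =O[atTop] b := by
      simpa using hb.isBigO.add (isBigO_refl b atTop)
    have h2 := ih.comp_tendsto (tendsto_add_nat 1)
    refine IsBigO.trans ?_ h1
    simpa [Function.comp_def, add_assoc, add_comm 1] using h2

theorem polyShift_diff_isLittleO {b : ℕ → ℝ} (hb : (fun n => b (n + 1) - b n) =o[atTop] b)
    (q : ℤ[X]) : polyShift q (fun n => b (n + 1) - b n) =o[atTop] b := by
  refine polyShift_induction (P := fun a => a =o[atTop] b) (fun a a' h h' => h.add h')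
    (fun z a h => h.const_mul_left _) (fun k => ?_) q
  exact (hb.comp_tendsto (tendsto_add_nat k)).trans_isBigO (isBigO_shift_of_isLittleO_diff hb k)

theorem isLittleO_of_nat_mul_isBigO {b c : ℕ → ℝ} (h : (fun n : ℕ => (n : ℝ) * c n) =O[atTop] b) :
    c =o[atTop] b := by
  have h1 : (fun n : ℕ => (n : ℝ)⁻¹) =o[atTop] fun _ => (1 : ℝ) := by
    rw [isLittleO_one_iff]
    exact tendsto_inv_atTop_nhds_zero_nat
  refine (h1.mul_isBigO h).congr' ?_ (by simp)
  filter_upwards [eventually_gt_atTop 0] with n hn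
  field_simp

theorem isLittleO_of_nat_mul_isLittleO {b c : ℕ → ℝ}
    (h : (fun n : ℕ => (n : ℝ) * c n) =o[atTop] fun n : ℕ => (n : ℝ) * b n) : c =o[atTop] b := by
  refine ((isBigO_refl (fun n : ℕ => (n : ℝ)⁻¹) atTop).mul_isLittleO h).congr' ?_ ?_ <;>
  · filter_upwards [eventually_gt_atTop 0] with n hn
    field_simp

/-- Shifts preserve the order of magnitude of b, and the factor n survives a shift by k because n ≤
n + k. -/
theorem nat_mul_polyShift_diff_isBigO {b : ℕ → ℝ}
    (hb : (fun n : ℕ => (n : ℝ) * (b (n + 1) - b n)) =O[atTop] b) (q : ℤ[X]) :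
    (fun n : ℕ => (n : ℝ) * polyShift q (fun n => b (n + 1) - b n) n) =O[atTop] b := by
  refine polyShift_induction (P := fun a => (fun n : ℕ => (n : ℝ) * a n) =O[atTop] b)
    (fun a a' h h' => ?_) (fun z a h => ?_) (fun k => ?_) q
  · simpa [mul_add] using h.add h'
  · simpa [mul_left_comm] using h.const_mul_left (z : ℝ)
  · have h1 := (hb.comp_tendsto (tendsto_add_nat k)).trans
      (isBigO_shift_of_isLittleO_diff (isLittleO_of_nat_mul_isBigO hb) k)
    refine IsBigO.trans (isBigO_of_le _ fun n => ?_) h1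
    simp only [Function.comp_apply, norm_mul, RCLike.norm_natCast]
    gcongr
    simp

/-! ### Order of vanishing at `1` -/

theorem X_sub_one_dvd_iff (u : ℤ[X]) : X - 1 ∣ u ↔ u.eval 1 = 0 := by
  have := dvd_iff_isRoot (p := u) (a := 1)
  rwa [C_1] at this

/-- Either the order at 1 is at least N, which includes q = 0, or it is attained with a cofactor
that does not vanish at 1. -/
theorem X_sub_one_pow_dvd_or (q : ℤ[X]) (N : ℕ) :
    (X - 1) ^ N ∣ q ∨ ∃ r < N, ∃ u : ℤ[X], q = (X - 1) ^ r * u ∧ u.eval 1 ≠ 0 := by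
  induction N with
  | zero => left; simp
  | succ N ih =>
    rcases ih with ⟨u, hu⟩ | ⟨r, hr, u, hu⟩
    · by_cases h : u.eval 1 = 0
      · left
        rw [hu, pow_succ]
        exact mul_dvd_mul_left _ ((X_sub_one_dvd_iff u).2 h)
      · exact Or.inr ⟨N, by omega, u, hu, h⟩
    · exact Or.inr ⟨r, by omega, u, hu⟩

theorem X_sub_one_pow_dvd_mul_iff {u : ℤ[X]} (hu : u.eval 1 ≠ 0) (r s : ℕ) :
    (X - 1) ^ s ∣ (X - 1) ^ r * u ↔ s ≤ r := by
  constructor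
  · intro h
    by_contra! hlt
    have h1 : (X - 1 : ℤ[X]) ^ (r + 1) ∣ (X - 1) ^ r * u := (pow_dvd_pow _ hlt).trans h
    rw [pow_succ] at h1
    have h0 : (X - 1 : ℤ[X]) ≠ 0 := by
      have := X_sub_C_ne_zero (1 : ℤ)
      rwa [C_1] at this
    exact hu ((X_sub_one_dvd_iff u).1 ((mul_dvd_mul_iff_left (pow_ne_zero r h0)).1 h1))
  · intro h
    exact (pow_dvd_pow _ h).mul_right _

theorem X_sub_one_dvd_X_pow_sub_one (h : ℕ) : (X - 1 : ℤ[X]) ∣ X ^ h - 1 := by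
  simpa using sub_dvd_pow_sub_pow (X : ℤ[X]) 1 h

/-! ### Tempered sequences -/

/-- The discrete counterpart of a function of class `𝓣_δ`. -/
structure IsTemperedSeq (δ : ℕ) (a : ℕ → ℝ) : Prop where
  diff_isBigO : ∀ r ≤ δ, (fun n : ℕ => (n : ℝ) * diffSeq (r + 1) a n) =O[atTop] diffSeq r a
  isBigO_diff : ∀ r ≤ δ, diffSeq r a =O[atTop] fun n : ℕ => (n : ℝ) * diffSeq (r + 1) a n
  tendsto_abs : ∀ r ≤ δ, Tendsto (fun n => |diffSeq r a n|) atTop atTop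
  tendsto_zero : Tendsto (diffSeq (δ + 1) a) atTop (𝓝 0)
  monotone : (∀ᶠ n in atTop, 0 < diffSeq (δ + 1) a n ∧
      diffSeq (δ + 1) a (n + 1) ≤ diffSeq (δ + 1) a n) ∨
    ∀ᶠ n in atTop, diffSeq (δ + 1) a n < 0 ∧ diffSeq (δ + 1) a n ≤ diffSeq (δ + 1) a (n + 1)

namespace IsTemperedSeq

variable {δ : ℕ} {a : ℕ → ℝ}

theorem iterDiff (ha : IsTemperedSeq δ a) {r : ℕ} (hr : r ≤ δ) :
    IsTemperedSeq (δ - r) (diffSeq r a) := by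
  have e : δ - r + 1 + r = δ + 1 := by omega
  refine ⟨fun s hs => ?_, fun s hs => ?_, fun s hs => ?_, ?_, ?_⟩
  · simpa only [← diffSeq_add, show s + 1 + r = s + r + 1 by ring] using
      ha.diff_isBigO (s + r) (by omega)
  · simpa only [← diffSeq_add, show s + 1 + r = s + r + 1 by ring] using
      ha.isBigO_diff (s + r) (by omega)
  · simpa only [← diffSeq_add] using ha.tendsto_abs (s + r) (by omega)
  · simpa only [← diffSeq_add, e] using ha.tendsto_zero
  · simpa only [← diffSeq_add, e] using ha.monotone

theorem diff_isLittleO (ha : IsTemperedSeq δ a) {r : ℕ} (hr : r ≤ δ) :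
    diffSeq (r + 1) a =o[atTop] diffSeq r a :=
  isLittleO_of_nat_mul_isBigO (ha.diff_isBigO r hr)

theorem diff_isLittleO_of_lt (ha : IsTemperedSeq δ a) {r s : ℕ} (hrs : r < s) (hs : s ≤ δ) :
    diffSeq s a =o[atTop] diffSeq r a := by
  induction s, hrs using Nat.le_induction with
  | base => exact ha.diff_isLittleO (by omega)
  | succ s h ih => exact (ha.diff_isLittleO (by omega)).trans (ih (by omega))

theorem eventually_ne_zero (ha : IsTemperedSeq δ a) {r : ℕ} (hr : r ≤ δ) :
    ∀ᶠ n in atTop, diffSeq r a n ≠ 0 := by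
  filter_upwards [(ha.tendsto_abs r hr).eventually_gt_atTop 0] with n hn
  exact abs_pos.1 hn

/-- The leading term of a polynomial in the shift. -/
theorem polyShift_sub_leading (ha : IsTemperedSeq δ a) {r : ℕ} (hr : r ≤ δ) (u : ℤ[X]) :
    (fun n => polyShift ((X - 1) ^ r * u) a n - (u.eval 1 : ℤ) * diffSeq r a n)
      =o[atTop] diffSeq r a := by
  obtain ⟨v, hv⟩ : X - 1 ∣ u - C (u.eval 1) := by
    have := X_sub_C_dvd_sub_C_eval (p := u) (a := 1)
    rwa [C_1] at this
  have hb := ha.diff_isLittleO hr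
  have hfun : diffSeq (r + 1) a =
      fun n => diffSeq r a (n + 1) - diffSeq r a n :=
    funext fun n => diffSeq_succ r a n
  rw [hfun] at hb
  refine (polyShift_diff_isLittleO hb v).congr' (Eventually.of_forall fun n => ?_) EventuallyEq.rfl
  have hu : u = v * (X - 1) + C (u.eval 1) := by rw [mul_comm, ← hv, sub_add_cancel]
  conv_rhs => rw [polyShift_pow_mul, hu, polyShift_add, polyShift_C, polyShift_mul,
    polyShift_X_sub_one, ← hu]
  simp

theorem polyShift_isBigO (ha : IsTemperedSeq δ a) {r : ℕ} (hr : r ≤ δ) {q : ℤ[X]}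
    (hq : (X - 1) ^ r ∣ q) : polyShift q a =O[atTop] diffSeq r a := by
  obtain ⟨u, rfl⟩ := hq
  have h1 := (ha.polyShift_sub_leading hr u).isBigO.add
    ((isBigO_refl (diffSeq r a) atTop).const_mul_left ((u.eval 1 : ℤ) : ℝ))
  simpa using h1

theorem isBigO_polyShift (ha : IsTemperedSeq δ a) {r : ℕ} (hr : r ≤ δ) {u : ℤ[X]}
    (hu : u.eval 1 ≠ 0) :
    diffSeq r a =O[atTop] polyShift ((X - 1) ^ r * u) a := by
  have h1 := ha.polyShift_sub_leading hr u
  have hu' : ((u.eval 1 : ℤ) : ℝ) ≠ 0 := by exact_mod_cast hu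
  have h2 : diffSeq r a =O[atTop]
      fun n => ((u.eval 1 : ℤ) : ℝ) * diffSeq r a n :=
    isBigO_self_const_mul hu' _ _
  have h3 : IsEquivalent atTop (polyShift ((X - 1) ^ r * u) a)
      fun n => ((u.eval 1 : ℤ) : ℝ) * diffSeq r a n :=
    h1.trans_isBigO h2
  exact h2.trans h3.isBigO_symm

theorem tendsto_polyShift_zero (ha : IsTemperedSeq δ a) {q : ℤ[X]} (hq : (X - 1) ^ (δ + 1) ∣ q) :
    Tendsto (polyShift q a) atTop (𝓝 0) := by
  obtain ⟨u, rfl⟩ := hq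
  rw [polyShift_pow_mul]
  refine polyShift_induction (P := fun a => Tendsto a atTop (𝓝 0)) (fun a a' h h' => ?_)
    (fun z a h => ?_) (fun k => ha.tendsto_zero.comp (tendsto_add_nat k)) u
  · rw [← add_zero (0 : ℝ)]
    exact h.add h'
  · simpa using h.const_mul (z : ℝ)

theorem not_isBigO_of_lt (ha : IsTemperedSeq δ a) {r s : ℕ} (hrs : r < s) (hs : s ≤ δ) :
    ¬ diffSeq r a =O[atTop] diffSeq s a := fun h =>
  isLittleO_irrefl (ha.eventually_ne_zero (by omega : r ≤ δ)).frequently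
    (h.trans_isLittleO (ha.diff_isLittleO_of_lt hrs hs))

/-- Growth detects the order: an exact order r < s would make the sequence at least as large as Δʳa,
which is not O(Δˢa). -/
theorem dvd_of_polyShift_isBigO (ha : IsTemperedSeq δ a) {s : ℕ} (hs : s ≤ δ) {q : ℤ[X]}
    (hq : polyShift q a =O[atTop] diffSeq s a) : (X - 1) ^ s ∣ q := by
  rcases X_sub_one_pow_dvd_or q s with h | ⟨r, hr, u, rfl, hu⟩
  · exact h
  · exact absurd ((ha.isBigO_polyShift (by omega) hu).trans hq) (ha.not_isBigO_of_lt hr hs)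

/-- Passing to differences preserves domination, for polynomials that do not annihilate the
sequence. -/
theorem polyShift_diff_isLittleO_of_not_dvd (ha : IsTemperedSeq δ a) {δ' : ℕ} {b : ℕ → ℝ}
    (hb : IsTemperedSeq δ' b) {t : ℕ} (ht : t ≤ δ') {q w : ℤ[X]}
    (hq : ¬ (X - 1) ^ (δ + 1) ∣ q) (hw : X - 1 ∣ w)
    (h : polyShift q a =o[atTop] diffSeq t b) :
    polyShift (w * q) a =o[atTop] diffSeq (t + 1) b := by
  obtain ⟨r, hr, u, rfl, hu⟩ := (X_sub_one_pow_dvd_or q (δ + 1)).resolve_left hq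
  obtain ⟨v, rfl⟩ := hw
  have hr' : r ≤ δ := by omega
  -- Δʳa is o(n Δᵗ⁺¹b), since Δᵗb is O(n Δᵗ⁺¹b). The extra difference on the left gains a factor
  -- 1/n, so n cancels.
  have h1 := ((ha.isBigO_polyShift hr' hu).trans_isLittleO h).trans_isBigO (hb.isBigO_diff t ht)
  have hfun : diffSeq (r + 1) a =
      fun n => diffSeq r a (n + 1) - diffSeq r a n :=
    funext fun n => diffSeq_succ r a n
  have h2 := ha.diff_isBigO r hr'
  simp only [hfun] at h2
  have h3 := (nat_mul_polyShift_diff_isBigO h2 (v * u)).trans_isLittleO h1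
  have e : (X - 1) * v * ((X - 1) ^ r * u) = (X - 1) ^ (r + 1) * (v * u) := by ring
  rw [e, polyShift_pow_mul, hfun]
  exact isLittleO_of_nat_mul_isLittleO h3

theorem isLittleO_of_tendsto_zero (ha : IsTemperedSeq δ a) {r : ℕ} (hr : r ≤ δ) {c : ℕ → ℝ}
    (hc : Tendsto c atTop (𝓝 0)) : c =o[atTop] diffSeq r a := by
  refine ((isLittleO_one_iff ℝ).2 hc).trans (isLittleO_const_left.2 (Or.inr ?_))
  exact ha.tendsto_abs r hr

/-- For t < δ' annihilating polynomials need not be excluded: their sequences tend to zero, while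
Δᵗ⁺¹b is still unbounded. -/
theorem polyShift_diff_isLittleO (ha : IsTemperedSeq δ a) {δ' : ℕ} {b : ℕ → ℝ}
    (hb : IsTemperedSeq δ' b) {t : ℕ} (ht : t < δ') {q w : ℤ[X]} (hw : X - 1 ∣ w)
    (h : polyShift q a =o[atTop] diffSeq t b) :
    polyShift (w * q) a =o[atTop] diffSeq (t + 1) b := by
  by_cases hq : (X - 1) ^ (δ + 1) ∣ q
  · exact hb.isLittleO_of_tendsto_zero ht (ha.tendsto_polyShift_zero (hq.mul_left w))
  · exact ha.polyShift_diff_isLittleO_of_not_dvd hb ht.le hq hw h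

end IsTemperedSeq

end

/-! ### Level sets of slowly growing sequences -/

theorem sub_le_of_forall_diff_le {γ : ℕ → ℝ} {c : ℝ} {m n : ℕ} (hmn : m ≤ n)
    (h : ∀ k, m ≤ k → k < n → γ (k + 1) - γ k ≤ c) : γ n - γ m ≤ (n - m : ℕ) * c := by
  induction n, hmn using Nat.le_induction with
  | base => simp
  | succ n hmn ih =>
    have h1 := ih fun k hk hk' => h k hk (by omega)
    have h2 := h n hmn (by omega)
    rw [Nat.succ_sub hmn, Nat.cast_succ]
    linarith

theorem le_sub_of_forall_le_diff {γ : ℕ → ℝ} {c : ℝ} {m n : ℕ} (hmn : m ≤ n)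
    (h : ∀ k, m ≤ k → k < n → c ≤ γ (k + 1) - γ k) : (n - m : ℕ) * c ≤ γ n - γ m := by
  have := sub_le_of_forall_diff_le (γ := fun n => - γ n) (c := -c) hmn
    fun k hk hk' => by linarith [h k hk hk']
  linarith

theorem abs_sub_le_of_forall_abs_diff_le {u γ : ℕ → ℝ} {c : ℝ} {m n : ℕ} (hmn : m ≤ n)
    (h : ∀ k, m ≤ k → k < n → |u (k + 1) - u k| ≤ c * (γ (k + 1) - γ k)) :
    |u n - u m| ≤ c * (γ n - γ m) := by
  induction n, hmn using Nat.le_induction with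
  | base => simp
  | succ n hmn ih =>
    have h1 := ih fun k hk hk' => h k hk (by omega)
    have h2 := h n hmn (by omega)
    have h3 := abs_add_le (u (n + 1) - u n) (u n - u m)
    rw [sub_add_sub_cancel] at h3
    linarith

/-- A sequence with positive decreasing increments that are `o(1)` but not `O(1/n)`. -/
structure IsSlowlyGrowing (γ : ℕ → ℝ) : Prop where
  concave : ∀ᶠ n in atTop, 0 < γ (n + 1) - γ n ∧ γ (n + 2) - γ (n + 1) ≤ γ (n + 1) - γ n
  tendsto_zero : Tendsto (fun n => γ (n + 1) - γ n) atTop (𝓝 0)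
  tendsto_atTop : Tendsto (fun n : ℕ => n * (γ (n + 1) - γ n)) atTop atTop

/-- The half-line on which `γ` is slowly growing is cut by `b` into blocks on which `γ` increases by
about `L`, each block being at least a third as long as the multiplicity of any value of `⌊γ⌋` on
the previous block. -/
theorem IsSlowlyGrowing.exists_blocks {γ : ℕ → ℝ} (hγ : IsSlowlyGrowing γ) (n₁ : ℕ) {L : ℕ}
    (hL : 2 ≤ L) : ∃ (b : ℕ → ℕ) (t₀ : ℕ),
      (∀ t, t₀ ≤ t → n₁ ≤ b t ∧ b t ≤ b (t + 1) ∧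
        (∀ n, b t ≤ n → n < b (t + 1) → t * (L : ℝ) ≤ γ n ∧ γ n < (t + 1) * (L : ℝ)) ∧
        ∀ k : ℤ, ((Finset.Ico (b t) (b (t + 1))).filter fun n => ⌊γ n⌋ = k).card * (L : ℝ) ≤
          3 * (b (t + 2) - b (t + 1))) ∧
      ∃ N₀ : ℕ, ∀ N ≥ N₀, ∃ t ≥ t₀, N ≤ b t ∧ b (t + 1) ≤ 2 * N := by
  have hsmall : ∀ᶠ n in atTop, γ (n + 1) - γ n ≤ 1 / 2 :=
    hγ.tendsto_zero.eventually_le_const (by norm_num)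
  have hlarge : ∀ᶠ n : ℕ in atTop, 4 * (L : ℝ) ≤ n * (γ (n + 1) - γ n) :=
    hγ.tendsto_atTop.eventually_ge_atTop _
  obtain ⟨n₀, hn₀⟩ := eventually_atTop.1 ((hγ.concave.and hsmall).and
    (hlarge.and (eventually_ge_atTop (max n₁ 1))))
  have hpos : ∀ n, n₀ ≤ n → 0 < γ (n + 1) - γ n := fun n hn => (hn₀ n hn).1.1.1
  have hmono : ∀ m n, n₀ ≤ m → m ≤ n → γ m ≤ γ n := by
    intro m n hm hmn
    have := le_sub_of_forall_le_diff (γ := γ) (c := 0) hmn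
      fun k hk _ => (hpos k (hm.trans hk)).le
    linarith
  have hanti : ∀ m n, n₀ ≤ m → m ≤ n → γ (n + 1) - γ n ≤ γ (m + 1) - γ m := by
    intro m n hm hmn
    induction n, hmn using Nat.le_induction with
    | base => exact le_rfl
    | succ n hmn ih => exact (hn₀ n (hm.trans hmn)).1.1.2.trans ih
  -- Each of the n increments between n and 2n is at least the one at 2n, which is at least 4L/(2n).
  have hgrow : ∀ n, n₀ ≤ n → γ n + 2 * L ≤ γ (2 * n) := by
    intro n hn
    have h1 := le_sub_of_forall_le_diff (γ := γ) (c := γ (2 * n + 1) - γ (2 * n)) (by omega : n ≤ 2 * n)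
      fun k hk hk' => hanti k (2 * n) (hn.trans hk) hk'.le
    have h2 := (hn₀ (2 * n) (by omega)).2.1
    have h3 : 2 * n - n = n := by omega
    rw [h3] at h1
    push_cast at h2
    linarith
  have htop : ∀ x : ℝ, ∃ n, n₀ ≤ n ∧ x ≤ γ n := by
    intro x
    have h1 : ∀ k : ℕ, ∃ n, n₀ ≤ n ∧ γ n₀ + k ≤ γ n := by
      intro k
      induction k with
      | zero => exact ⟨n₀, le_rfl, by simp⟩
      | succ k ih =>
        obtain ⟨n, hn, hk⟩ := ih
        refine ⟨2 * n, by omega, ?_⟩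
        have := hgrow n hn
        have hL' : (2 : ℝ) ≤ L := by exact_mod_cast hL
        push_cast
        linarith
    obtain ⟨k, hk⟩ := exists_nat_ge (x - γ n₀)
    obtain ⟨n, hn, h⟩ := h1 k
    exact ⟨n, hn, by linarith⟩
  have hex : ∀ t : ℕ, ∃ n, n₀ ≤ n ∧ t * (L : ℝ) ≤ γ n := fun t => htop _
  -- The first time after n₀ at which γ reaches t·L.
  set b : ℕ → ℕ := fun t => sInf {n | n₀ ≤ n ∧ t * (L : ℝ) ≤ γ n} with hb
  have hb1 : ∀ t : ℕ, n₀ ≤ b t ∧ t * (L : ℝ) ≤ γ (b t) := fun t => Nat.sInf_mem (hex t)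
  have hb2 : ∀ t n : ℕ, n₀ ≤ n → t * (L : ℝ) ≤ γ n → b t ≤ n := fun t n h h' => Nat.sInf_le ⟨h, h'⟩
  have hb3 : ∀ t n : ℕ, n₀ ≤ n → n < b t → γ n < t * (L : ℝ) := fun t n h h' => by
    by_contra! hle
    exact absurd (hb2 t n h hle) (by omega)
  have hL' : (2 : ℝ) ≤ L := by exact_mod_cast hL
  have hbm : ∀ t, b t ≤ b (t + 1) := fun t => hb2 t _ (hb1 _).1
    (le_trans (by push_cast; nlinarith) (hb1 (t + 1)).2)
  obtain ⟨t₀, ht₀⟩ := exists_nat_ge (γ n₀)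
  have hbt : ∀ t, t₀ ≤ t → n₀ < b (t + 1) := fun t ht => by
    by_contra! hle
    have h1 := (hb1 (t + 1)).2.trans (hmono _ _ (hb1 _).1 hle)
    have h2 : (t₀ : ℝ) ≤ t := by exact_mod_cast ht
    push_cast at h1
    nlinarith
  refine ⟨b, t₀, fun t ht => ⟨(le_max_left _ _).trans ((hn₀ _ le_rfl).2.2.trans (hb1 t).1), hbm t, fun n hn hn' =>
    ⟨(hb1 t).2.trans (hmono _ _ (hb1 t).1 hn), ?_⟩, fun k => ?_⟩, ?_⟩
  · have := hb3 (t + 1) n ((hb1 t).1.trans hn) hn'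
    push_cast at this
    exact this
  -- The increment g at the common endpoint bounds the increments of this block from below and those
  -- of the next block from above. So a value of ⌊γ⌋ occurs at most 1 + 1/g times, while the next
  -- block has length at least (L - 1)/g. With g ≤ 1/2 and L ≥ 2 one has L(1 + g) ≤ 3(L - 1).
  · set g : ℝ := γ (b (t + 1) + 1) - γ (b (t + 1)) with hg
    have hg0 : 0 < g := hpos _ (hb1 _).1
    have hg1 : g ≤ 1 / 2 := (hn₀ _ (hb1 (t + 1)).1).1.2
    have hcard : (((Finset.Ico (b t) (b (t + 1))).filter fun n => ⌊γ n⌋ = k).card : ℝ) * g ≤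
        1 + g := by
      set s := (Finset.Ico (b t) (b (t + 1))).filter fun n => ⌊γ n⌋ = k with hs
      rcases s.eq_empty_or_nonempty with h0 | h0
      · rw [h0]; simp; linarith
      · have hmin := s.min'_mem h0
        have hmax := s.max'_mem h0
        have hle := s.min'_le_max' h0
        set p := s.min' h0 with hp
        set q := s.max' h0 with hq
        have hsub : s ⊆ Finset.Icc p q := fun x hx =>
          Finset.mem_Icc.2 ⟨s.min'_le x hx, s.le_max' x hx⟩
        have hc := Finset.card_le_card hsub
        rw [Nat.card_Icc] at hc
        have hc' : (s.card : ℝ) ≤ (q - p : ℕ) + 1 := by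
          have : s.card ≤ (q - p) + 1 := by omega
          exact_mod_cast this
        simp only [hs, Finset.mem_filter, Finset.mem_Ico] at hmin hmax
        have h1 : γ q - γ p < 1 := by
          have e1 := Int.lt_floor_add_one (γ q)
          have e2 := Int.floor_le (γ p)
          rw [hmax.2] at e1
          rw [hmin.2] at e2
          linarith
        have h2 := le_sub_of_forall_le_diff (γ := γ) (c := g) hle
          fun k hk hk' => hanti k (b (t + 1)) ((hb1 t).1.trans (hmin.1.1.trans hk)) (by omega)
        nlinarith
    have hlen : (L : ℝ) - 1 ≤ ((b (t + 2) : ℝ) - b (t + 1)) * g := by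
      have h1 := sub_le_of_forall_diff_le (γ := γ) (c := g) (hbm (t + 1))
        fun k hk _ => hanti (b (t + 1)) k (hb1 _).1 hk
      have h2 := (hb1 (t + 2)).2
      have h3 := hb3 (t + 1) (b (t + 1) - 1) (by have := hbt t ht; omega) (by have := hbt t ht; omega)
      have h4 := (hn₀ (b (t + 1) - 1) (by have := hbt t ht; omega)).1.2
      have h5 : b (t + 1) - 1 + 1 = b (t + 1) := by have := hbt t ht; omega
      rw [h5] at h4
      rw [Nat.cast_sub (hbm (t + 1))] at h1
      push_cast at h2 h3
      linarith
    have hlen0 : (0 : ℝ) ≤ (b (t + 2) : ℝ) - b (t + 1) := by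
      have : (b (t + 1) : ℝ) ≤ b (t + 2) := by exact_mod_cast hbm (t + 1)
      linarith
    refine le_of_mul_le_mul_right ?_ hg0
    nlinarith
  · refine ⟨n₀ + b (t₀ + 1), fun N hN => ?_⟩
    have hN0 : n₀ ≤ N := by omega
    have hγN : (t₀ + 1 : ℝ) * L ≤ γ N := by
      have h1 := (hb1 (t₀ + 1)).2
      push_cast at h1
      exact h1.trans (hmono _ _ (hb1 _).1 (by omega))
    have hLpos : (0 : ℝ) < L := by linarith
    -- Then γ(N) < tL and (t + 1)L ≤ γ(N) + 2L ≤ γ(2N), so block t lies between N and 2N.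
    set t : ℕ := ⌊γ N / L⌋₊ + 1 with ht
    have hdiv : (t₀ + 1 : ℝ) ≤ γ N / L := by rwa [le_div_iff₀ hLpos]
    have h1 : γ N / L < t := by rw [ht]; push_cast; exact Nat.lt_floor_add_one _
    have h2 : (t : ℝ) ≤ γ N / L + 1 := by
      rw [ht]; push_cast
      have := Nat.floor_le (a := γ N / L) (by have : (0:ℝ) ≤ t₀ := Nat.cast_nonneg _; linarith)
      linarith
    rw [div_lt_iff₀ hLpos] at h1
    refine ⟨t, ?_, ?_, hb2 _ _ (by omega) ?_⟩
    · have : (t₀ : ℝ) ≤ t := by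
        have : γ N / L < t := by rw [ht]; push_cast; exact Nat.lt_floor_add_one _
        linarith
      exact_mod_cast this
    · by_contra! hlt
      have := (hb1 t).2.trans (hmono _ _ (hb1 t).1 hlt.le)
      linarith
    · have h3 := hgrow N hN0
      have h4 : (t : ℝ) * L ≤ γ N + L := by
        have := mul_le_mul_of_nonneg_right h2 hLpos.le
        rwa [add_mul, div_mul_cancel₀ _ hLpos.ne', one_mul] at this
      push_cast
      linarith

/-- Averages are small once the sums over blocks are small compared with the next block. -/
theorem avg_le_of_block_sums_le {b : ℕ → ℕ} {t₀ : ℕ} {y : ℕ → ℝ} {K η : ℝ} (hη : 0 ≤ η)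
    (hy0 : ∀ n, 0 ≤ y n) (hyK : ∀ n, y n ≤ K) (hb : ∀ t, t₀ ≤ t → b t ≤ b (t + 1))
    (hsum : ∀ t, t₀ ≤ t → ∑ n ∈ Finset.Ico (b t) (b (t + 1)), y n ≤ η * (b (t + 2) - b (t + 1)))
    {N t : ℕ} (ht : t₀ ≤ t) (hN : N ≤ b t) (hN' : b (t + 1) ≤ 2 * N) (hN0 : 0 < N) :
    (N : ℝ)⁻¹ * ∑ n ∈ Finset.range N, y n ≤ K * b t₀ / N + 2 * η := by
  -- The bounds by lengths of next blocks telescope.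
  have key : ∀ T, t₀ ≤ T → ∑ n ∈ Finset.Ico (b t₀) (b T), y n ≤ η * b (T + 1) ∧ b t₀ ≤ b T := by
    intro T hT
    induction T, hT using Nat.le_induction with
    | base => simpa using by positivity
    | succ T hT ih =>
      refine ⟨?_, ih.2.trans (hb T hT)⟩
      rw [← Finset.sum_Ico_consecutive y ih.2 (hb T hT)]
      have := hsum T hT
      linarith [ih.1]
  have h1 : ∑ n ∈ Finset.range N, y n ≤ K * b t₀ + η * b (t + 1) := by
    calc ∑ n ∈ Finset.range N, y n ≤ ∑ n ∈ Finset.range (b t), y n :=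
          Finset.sum_le_sum_of_subset_of_nonneg (by simpa using hN) fun n _ _ => hy0 n
      _ = ∑ n ∈ Finset.range (b t₀), y n + ∑ n ∈ Finset.Ico (b t₀) (b t), y n :=
          (Finset.sum_range_add_sum_Ico _ (key t ht).2).symm
      _ ≤ _ := by
          refine add_le_add ?_ (key t ht).1
          refine (Finset.sum_le_card_nsmul _ _ K fun n _ => hyK n).trans ?_
          simp [mul_comm]
  have hN0' : (0 : ℝ) < N := by exact_mod_cast hN0
  have h2 : (b (t + 1) : ℝ) ≤ 2 * N := by exact_mod_cast hN'
  calc _ ≤ (N : ℝ)⁻¹ * (K * b t₀ + η * (2 * N)) := by gcongr; exact h1.trans (by gcongr)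
    _ = _ := by field_simp

/-! ### Correlations along tuples of iterates -/

section

variable {X : Type*} [MeasurableSpace X] {μ : Measure X} {ℓ : ℕ}

/-- A measure preserving action of `ℤ^ℓ`. -/
structure IsMPAction (μ : Measure X) (τ : (Fin ℓ → ℤ) → X → X) : Prop where
  zero : ∀ x, τ 0 x = x
  add : ∀ a b x, τ (a + b) x = τ a (τ b x)
  measurePreserving : ∀ a, MeasurePreserving (τ a) μ μ

/-- The correlations of a bounded function with `∏ⱼ fⱼ ∘ τ (aⱼ n)` tend to zero in mean, uniformly
over all functions with a given bound. -/
def SmallCorrelations (μ : Measure X) (τ : (Fin ℓ → ℤ) → X → X) {ι : Type*} [Fintype ι]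
    (f : ι → X → ℂ) (a : ι → ℕ → Fin ℓ → ℤ) : Prop :=
  ∀ R ε : ℝ, 0 < ε → ∃ N₀ : ℕ, ∀ N ≥ N₀, ∀ φ : X → ℂ, BddMeas R φ →
    (N : ℝ)⁻¹ * ∑ n ∈ Finset.range N, ‖∫ x, φ x * ∏ j, f j (τ (a j n) x) ∂μ‖ ≤ ε

theorem IsMPAction.measurable {τ : (Fin ℓ → ℤ) → X → X} (hτ : IsMPAction μ τ) (a : Fin ℓ → ℤ) :
    Measurable (τ a) := (hτ.measurePreserving a).measurable

theorem IsMPAction.integral_comp {τ : (Fin ℓ → ℤ) → X → X} (hτ : IsMPAction μ τ) (a : Fin ℓ → ℤ)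
    {f : X → ℂ} (hf : Measurable f) : ∫ x, f (τ a x) ∂μ = ∫ x, f x ∂μ := by
  conv_rhs => rw [← (hτ.measurePreserving a).map_eq]
  rw [integral_map (hτ.measurable a).aemeasurable hf.aestronglyMeasurable]

theorem BddMeas.mul_prod {τ : (Fin ℓ → ℤ) → X → X} (hτ : IsMPAction μ τ) {ι : Type*} [Fintype ι]
    {f : ι → X → ℂ} {C R : ℝ} {φ : X → ℂ} (hφ : BddMeas R φ) (hf : ∀ j, BddMeas C (f j))
    (v : ι → Fin ℓ → ℤ) :
    BddMeas (R * C ^ Fintype.card ι) fun x => φ x * ∏ j, f j (τ (v j) x) :=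
  hφ.mul (BddMeas.prod Finset.univ fun j => (hf j).comp (hτ.measurable _))

variable [IsProbabilityMeasure μ]

theorem exists_avg_correlation_le_of_fintype {T : X ≃ᵐ X} (hT : MeasurePreserving T μ μ)
    {κ : Type*} [Fintype κ] {c₀ : ℤ} {c : κ → ℤ} (hc : ∀ j, c j ≠ c₀) (R : ℝ) {ε : ℝ} (hε : 0 < ε)
    {f : X → ℂ} (hf : BddMeas R f) (hQ : hostKraPow μ T (Fintype.card κ + 1) f = 0) :
    ∃ L₀ : ℕ, ∀ L ≥ L₀, ∀ φ : κ → X → ℂ, (∀ j, BddMeas R (φ j)) →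
      (L : ℝ)⁻¹ * ∑ k ∈ Finset.range L,
        ‖∫ x, f (iter T (c₀ * k) x) * ∏ j, φ j (iter T (c j * k) x) ∂μ‖ ≤ ε := by
  set e := (Fintype.equivFin κ).symm
  obtain ⟨δ, hδ, h⟩ := exists_avg_correlation_le hT (Fintype.card κ) c₀ (c ∘ e)
    (fun j => hc _) R ε hε
  obtain ⟨L₀, hL₀⟩ := h f hf (hQ.le.trans hδ.le)
  refine ⟨L₀, fun L hL φ hφ => ?_⟩
  have := hL₀ L hL (φ ∘ e) fun j => hφ _
  have h1 : ∀ (k : ℕ) (x : X), ∏ j, (φ ∘ e) j (iter T ((c ∘ e) j * k) x) =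
      ∏ j, φ j (iter T (c j * k) x) := fun k x => e.prod_comp fun j => φ j (iter T (c j * k) x)
  simpa only [h1] using this

/-- Correlations along multiples of one slowly growing sequence in the first direction, and
much slower sequences in the other directions. -/
theorem smallCorrelations_of_isSlowlyGrowing [NeZero ℓ] {τ : (Fin ℓ → ℤ) → X → X}
    (hτ : IsMPAction μ τ) {T : X ≃ᵐ X} (hT : MeasurePreserving T μ μ)
    (hTτ : ∀ n x, iter T n x = τ (Pi.single 0 n) x) {ι : Type*} [Fintype ι]
    {o : ι} {f : ι → X → ℂ} {C : ℝ} (hf : ∀ j, BddMeas C (f j)) {γ : ℕ → ℝ}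
    (hγ : IsSlowlyGrowing γ) {c : ι → ℤ} (hc0 : c o ≠ 0) (hc : ∀ j, j ≠ o → c j ≠ c o)
    {a : ι → ℕ → Fin ℓ → ℤ} (h0 : ∀ j, ∃ B : ℝ, ∀ n, |(a j n 0 : ℝ) - c j * γ n| ≤ B)
    (hrow : ∀ j i, i ≠ 0 → ∃ (u : ℕ → ℝ) (B : ℝ), (∀ n, |(a j n i : ℝ) - u n| ≤ B) ∧
      (fun n => u (n + 1) - u n) =o[atTop] fun n => γ (n + 1) - γ n)
    (hQ : hostKraPow μ T (Fintype.card ι + 1) (f o) = 0) : SmallCorrelations μ τ f a := by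
  classical
  intro R ε hε
  rcases le_or_gt 0 R with hR | hR
  swap
  · exact ⟨0, fun N _ φ hφ => absurd (hφ.nonneg μ) (not_le.2 hR)⟩
  have hC : 0 ≤ C := (hf o).nonneg μ
  choose B hB using h0
  choose! u D hD hu using hrow
  -- B₂ bounds the deviation of the iterates from their model on a block. In row 0 it allows |B j|
  -- for the approximation and |c j| for the fractional part of γ; in the other rows 2|D j i| for
  -- the approximation at two times and 1 for the variation of u.
  obtain ⟨B₂, hB₂⟩ := exists_nat_ge (∑ j, (|B j| + |(c j : ℝ)|) + ∑ j, ∑ i, 2 * |D j i| + 1)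
  have hB0 : ∀ j, |B j| + |(c j : ℝ)| ≤ B₂ := fun j => by
    have h1 := Finset.single_le_sum (f := fun j => |B j| + |(c j : ℝ)|)
      (fun i _ => by positivity) (Finset.mem_univ j)
    have h2 : 0 ≤ ∑ j, ∑ i, 2 * |D j i| := by positivity
    linarith
  have hD0 : ∀ j i, 2 * |D j i| + 1 ≤ B₂ := fun j i => by
    have h1 := Finset.single_le_sum (f := fun j => ∑ i, 2 * |D j i|)
      (fun i _ => by positivity) (Finset.mem_univ j)
    have h2 := Finset.single_le_sum (f := fun i => 2 * |D j i|)
      (fun i _ => by positivity) (Finset.mem_univ i)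
    have h3 : 0 ≤ ∑ j, (|B j| + |(c j : ℝ)|) := by positivity
    linarith
  set box : Finset (ι → Fin ℓ → ℤ) :=
    Fintype.piFinset fun _ => Fintype.piFinset fun _ => Finset.Icc (-(B₂ : ℤ)) B₂ with hbox
  -- The block estimate ends with 2η = 6·box.card·ε₁, which has to stay below ε/2.
  set ε₁ : ℝ := ε / (12 * (box.card + 1)) with hε₁
  have hε₁0 : 0 < ε₁ := by positivity
  -- The place of o among the other functions is given to the test function, with exponent 0. This
  -- is why card ι other functions occur, and the seminorm of order card ι + 1.
  set c' : ι → ℤ := Function.update c o 0 with hc'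
  have hc'o : ∀ j, c' j ≠ c o := fun j => by
    by_cases h : j = o
    · subst h; simpa [hc'] using hc0.symm
    · simpa [hc', h] using hc j h
  set R' := max R C with hR'
  obtain ⟨L₀, hL₀⟩ := exists_avg_correlation_le_of_fintype hT hc'o R' hε₁0
    ((hf o).mono (le_max_right R C)) hQ
  set L := max L₀ 2 with hL
  have hL2 : 2 ≤ L := le_max_right _ _
  have hLpos : (0 : ℝ) < L := by
    have : 0 < L := by omega
    exact_mod_cast this
  have hev : ∀ᶠ n in atTop, ∀ j i, i ≠ 0 →
      |u j i (n + 1) - u j i n| ≤ (L : ℝ)⁻¹ * (γ (n + 1) - γ n) := by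
    simp only [eventually_all]
    intro j i hi
    filter_upwards [(hu j i hi).bound (inv_pos.2 hLpos), hγ.concave] with n h1 h2
    rwa [Real.norm_eq_abs, Real.norm_of_nonneg h2.1.le] at h1
  obtain ⟨n₁, hn₁⟩ := eventually_atTop.1 hev
  obtain ⟨b, t₀, hblock, N₀, hN₀⟩ := hγ.exists_blocks n₁ hL2
  set K : ℝ := R * C ^ Fintype.card ι with hK
  have hK0 : 0 ≤ K := by positivity
  set η : ℝ := 3 * box.card * ε₁ with hη
  obtain ⟨N₁, hN₁⟩ := exists_nat_gt (2 * (K * b t₀) / ε)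
  refine ⟨max N₀ (max N₁ 1), fun N hN φ hφ => ?_⟩
  have hNN₀ : N₀ ≤ N := (le_max_left _ _).trans hN
  have hNN₁ : N₁ ≤ N := (le_max_left _ _).trans ((le_max_right _ _).trans hN)
  have hN0 : 0 < N := (le_max_right N₁ 1).trans ((le_max_right _ _).trans hN)
  set y : ℕ → ℝ := fun n => ‖∫ x, φ x * ∏ j, f j (τ (a j n) x) ∂μ‖ with hy
  have hsum : ∀ t, t₀ ≤ t → ∑ n ∈ Finset.Ico (b t) (b (t + 1)), y n ≤
      η * (b (t + 2) - b (t + 1)) := by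
    intro t ht
    obtain ⟨hbt, hbm, hrange, hcard⟩ := hblock t ht
    -- The model on block t: row 0 starts at c j · tL and advances with ⌊γ⌋, the other rows are
    -- frozen at the left end of the block.
    set s : ι → Fin ℓ → ℤ := fun j i => if i = 0 then c j * (t * L) else a j (b t) i with hs
    set Y : (ι → Fin ℓ → ℤ) → ℕ → ℝ := fun β k =>
      ‖∫ x, φ x * ∏ j, f j (τ (Pi.single 0 (c j * k) + (s j + β j)) x) ∂μ‖ with hY
    have hlin : ∀ β, ∑ k ∈ Finset.range L, Y β k ≤ L * ε₁ := by
      intro β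
      set v : Fin ℓ → ℤ := s o + β o with hv
      -- Translation by -v turns the factor of o into a pure power of T; the remaining constant
      -- shifts are absorbed into the other functions.
      set ψ : ι → X → ℂ := Function.update (fun j x => f j (τ (s j + β j - v) x)) o
        (fun x => φ (τ (-v) x)) with hψ
      have hψb : ∀ j, BddMeas R' (ψ j) := fun j => by
        by_cases h : j = o
        · subst h
          simp only [hψ, Function.update_self]
          exact (hφ.comp (hτ.measurable _)).mono (le_max_left _ _)
        · simp only [hψ, Function.update_of_ne h]
          exact ((hf j).comp (hτ.measurable _)).mono (le_max_right _ _)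
      have h1 := hL₀ L (le_max_left _ _) ψ hψb
      rw [inv_mul_le_iff₀ hLpos] at h1
      refine le_trans (le_of_eq (Finset.sum_congr rfl fun k _ => ?_)) h1
      simp only [hY]
      rw [← hτ.integral_comp (-v) (hφ.mul_prod hτ hf _).1]
      congr 2
      funext x
      have e1 : ∀ j, f j (τ (Pi.single 0 (c j * k) + (s j + β j)) (τ (-v) x)) =
          f j (τ (s j + β j - v) (iter T (c j * k) x)) := fun j => by
        rw [hTτ, ← hτ.add, ← hτ.add]
        congr 2
        abel
      simp only [e1]
      have e2 : ∏ j, ψ j (iter T (c' j * k) x) = ∏ j, Function.update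
          (fun j => f j (τ (s j + β j - v) (iter T (c j * k) x))) o (φ (τ (-v) x)) j := by
        refine Finset.prod_congr rfl fun j _ => ?_
        by_cases h : j = o
        · subst h
          simp [hψ, hc', iter_zero]
        · simp [hψ, hc', h]
      rw [e2, Finset.prod_update_of_mem (Finset.mem_univ o),
        ← Finset.prod_mul_prod_compl {o} fun j => f j (τ (s j + β j - v) (iter T (c j * k) x)),
        Finset.prod_singleton, hv, sub_self, hτ.zero, Finset.compl_eq_univ_sdiff]
      ring
    set k' : ℕ → ℕ := fun n => (⌊γ n⌋ - t * L).toNat with hk'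
    have hk'eq : ∀ n ∈ Finset.Ico (b t) (b (t + 1)), ((k' n : ℕ) : ℤ) = ⌊γ n⌋ - t * L ∧ k' n < L := by
      intro n hn
      rw [Finset.mem_Ico] at hn
      obtain ⟨h1, h2⟩ := hrange n hn.1 hn.2
      have h3 : ((t * L : ℕ) : ℤ) ≤ ⌊γ n⌋ := Int.le_floor.2 (by push_cast; exact h1)
      have h4 : ⌊γ n⌋ < (((t + 1) * L : ℕ) : ℤ) := Int.floor_lt.2 (by push_cast; exact h2)
      have h5 : (t + 1) * L = t * L + L := by ring
      rw [h5] at h4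
      push_cast at h3 h4
      simp only [hk']
      omega
    have hyY : ∀ n ∈ Finset.Ico (b t) (b (t + 1)), y n ≤ ∑ β ∈ box, Y β (k' n) := by
      intro n hn
      obtain ⟨hkn, -⟩ := hk'eq n hn
      rw [Finset.mem_Ico] at hn
      set β : ι → Fin ℓ → ℤ := fun j => a j n - Pi.single 0 (c j * (k' n : ℤ)) - s j with hβ
      have hβbox : β ∈ box := by
        simp only [hbox, Fintype.mem_piFinset, Finset.mem_Icc, ← abs_le]
        intro j i
        have : |((β j i : ℤ) : ℝ)| ≤ B₂ := by
          by_cases hi : i = 0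
          · subst hi
            have e : ((β j 0 : ℤ) : ℝ) = (a j n 0 - c j * γ n) + c j * (γ n - ⌊γ n⌋) := by
              simp only [hβ, Pi.sub_apply, Pi.single_eq_same, hs, if_true, hkn]
              push_cast
              ring
            rw [e]
            refine (abs_add_le _ _).trans (le_trans (add_le_add ((hB j n).trans (le_abs_self _)) ?_)
              (hB0 j))
            rw [abs_mul]
            refine mul_le_of_le_one_right (abs_nonneg _) ?_
            have h1 := Int.floor_le (γ n)
            have h2 := Int.lt_floor_add_one (γ n)
            rw [abs_of_nonneg (by linarith)]
            linarith
          · have e : ((β j i : ℤ) : ℝ) = (a j n i - u j i n) - (a j (b t) i - u j i (b t)) +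
                (u j i n - u j i (b t)) := by
              simp only [hβ, Pi.sub_apply, Pi.single_eq_of_ne hi, hs, if_neg hi]
              push_cast
              ring
            have h1 := abs_sub_le_of_forall_abs_diff_le (u := u j i) (γ := γ) (c := (L : ℝ)⁻¹) hn.1
              fun k hk _ => hn₁ k (hbt.trans hk) j i hi
            have h2 := hrange n hn.1 hn.2
            have h3 := hrange (b t) le_rfl (lt_of_le_of_lt hn.1 hn.2)
            have h4 : (L : ℝ)⁻¹ * (γ n - γ (b t)) ≤ 1 := by
              rw [inv_mul_le_iff₀ hLpos]
              linarith
            have h5 := hD j i hi n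
            have h6 := hD j i hi (b t)
            have h7 := hD0 j i
            have h8 := le_abs_self (D j i)
            rw [e]
            refine (abs_add_le _ _).trans ?_
            have h9 := abs_sub ((a j n i : ℝ) - u j i n) (a j (b t) i - u j i (b t))
            linarith
        exact_mod_cast this
      have hyeq : y n = Y β (k' n) := by
        simp only [hy, hY]
        congr 2
        funext x
        congr 1
        refine Finset.prod_congr rfl fun j _ => ?_
        congr 2
        simp only [hβ]
        abel
      rw [hyeq]
      exact Finset.single_le_sum (f := fun β => Y β (k' n)) (fun _ _ => norm_nonneg _) hβbox
    -- M bounds the multiplicity of each value of ⌊γ⌋ on the block.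
    set M : ℝ := 3 * (b (t + 2) - b (t + 1)) / L with hM
    have hfib : ∀ β, ∑ n ∈ Finset.Ico (b t) (b (t + 1)), Y β (k' n) ≤ M * (L * ε₁) := by
      intro β
      have hM0 : 0 ≤ M := by
        have := (hcard 0).trans' (by positivity : (0 : ℝ) ≤ _)
        positivity
      rw [← Finset.sum_fiberwise_of_maps_to (t := Finset.range L) (g := k')
        fun n hn => Finset.mem_range.2 (hk'eq n hn).2]
      calc _ ≤ ∑ k ∈ Finset.range L, M * Y β k := ?_
        _ = M * ∑ k ∈ Finset.range L, Y β k := by rw [Finset.mul_sum]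
        _ ≤ _ := mul_le_mul_of_nonneg_left (hlin β) hM0
      refine Finset.sum_le_sum fun k _ => ?_
      have e1 : ∑ n ∈ (Finset.Ico (b t) (b (t + 1))).filter (fun n => k' n = k), Y β (k' n) =
          ((Finset.Ico (b t) (b (t + 1))).filter fun n => k' n = k).card * Y β k := by
        rw [← nsmul_eq_mul, ← Finset.sum_const]
        exact Finset.sum_congr rfl fun n hn => by rw [(Finset.mem_filter.1 hn).2]
      rw [e1]
      refine mul_le_mul_of_nonneg_right ?_ (norm_nonneg _)
      rw [hM, le_div_iff₀ hLpos]
      refine le_trans ?_ (hcard (t * L + k))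
      refine mul_le_mul_of_nonneg_right ?_ hLpos.le
      exact_mod_cast Finset.card_le_card fun n hn => by
        rw [Finset.mem_filter] at hn ⊢
        refine ⟨hn.1, ?_⟩
        have := (hk'eq n hn.1).1
        rw [hn.2] at this
        omega
    calc _ ≤ ∑ n ∈ Finset.Ico (b t) (b (t + 1)), ∑ β ∈ box, Y β (k' n) := Finset.sum_le_sum hyY
      _ = ∑ β ∈ box, ∑ n ∈ Finset.Ico (b t) (b (t + 1)), Y β (k' n) := Finset.sum_comm
      _ ≤ ∑ β ∈ box, M * (L * ε₁) := Finset.sum_le_sum fun β _ => hfib β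
      _ = η * (b (t + 2) - b (t + 1)) := by
          rw [Finset.sum_const, nsmul_eq_mul, hM, hη]
          field_simp
  obtain ⟨t, ht, hNt, hNt'⟩ := hN₀ N hNN₀
  have hN0' : (0 : ℝ) < N := by exact_mod_cast hN0
  refine (avg_le_of_block_sums_le (by positivity) (fun n => norm_nonneg _)
    (fun n => (hφ.mul_prod hτ hf _).norm_integral_le μ) (fun t ht => (hblock t ht).2.1)
    hsum ht hNt hNt' hN0).trans ?_
  have h1 : K * b t₀ / N ≤ ε / 2 := by
    rw [div_lt_iff₀ hε] at hN₁
    rw [div_le_iff₀ hN0']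
    have : (N₁ : ℝ) ≤ N := by exact_mod_cast hNN₁
    nlinarith
  have h2 : 2 * η ≤ ε / 2 := by
    have e : 2 * η = ε / 2 * (box.card / (box.card + 1)) := by
      rw [hη, hε₁]; field_simp; ring
    rw [e]
    refine mul_le_of_le_one_right (by positivity) ?_
    rw [div_le_one (by positivity)]
    linarith
  linarith

end

/-! ### Two reductions for correlations: differencing and discarding bounded iterates -/

section

variable {X : Type*} [MeasurableSpace X] {μ : Measure X} [IsProbabilityMeasure μ] {ℓ : ℕ}

/-- Van der Corput's trick: after differencing with step `h` and normalizing the `z`-th iterate, the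
correlations involve the iterates `aⱼ(n + h) - a_z(n)` and `aⱼ(n) - a_z(n)`. -/
theorem SmallCorrelations.of_differences {τ : (Fin ℓ → ℤ) → X → X} (hτ : IsMPAction μ τ)
    {ι : Type*} [Fintype ι] {f : ι → X → ℂ} {C : ℝ} (hf : ∀ j, BddMeas C (f j))
    {a : ι → ℕ → Fin ℓ → ℤ} (z : ι) {h₀ : ℕ}
    (h : ∀ h ≥ h₀, SmallCorrelations μ τ (Sum.elim f fun j x => conj (f j x))
      (Sum.elim (fun j n => a j (n + h) - a z n) fun j n => a j n - a z n)) :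
    SmallCorrelations μ τ f a := by
  intro R ε hε
  set C₁ : ℝ := 1 * C ^ Fintype.card ι with hC₁
  set ε₁ : ℝ := ε ^ 2 / (9 * (R ^ 2 + 1)) with hε₁
  have hε₁0 : 0 < ε₁ := by positivity
  choose! N₁ hN₁ using fun k hk => h k hk 1 ε₁ hε₁0
  -- So large that the steps below h₀, for which nothing is known, contribute at most ε₁ through the
  -- trivial bound.
  obtain ⟨H', hH'⟩ := exists_nat_gt (h₀ * C₁ ^ 2 / ε₁)
  set H : ℕ := H' + 1 with hH
  have hH0 : 0 < H := by omega
  have hH0' : (0 : ℝ) < H := by exact_mod_cast hH0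
  obtain ⟨L₁, hL₁⟩ := exists_nat_gt (12 * C₁ ^ 2 * H ^ 2 / ε₁)
  refine ⟨(∑ k ∈ Finset.range H, N₁ k) + L₁ + 1, fun N hN φ hφ => ?_⟩
  have hN0 : 0 < N := by omega
  have hN0' : (0 : ℝ) < N := by exact_mod_cast hN0
  have h1 : BddMeas 1 fun _ : X => (1 : ℂ) := ⟨measurable_const, fun _ => by simp⟩
  set F : ℕ → X → ℂ := fun n x => ∏ j, f j (τ (a j n) x) with hF
  have hFb : ∀ n, BddMeas C₁ (F n) := fun n => by
    simpa only [hF, hC₁, one_mul] using h1.mul_prod hτ hf fun j => a j n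
  have h4 := sq_avg_norm_integral_le (μ := μ) hφ hFb hH0 hN0
  have h5 : ∀ k ∈ Finset.range H, (N : ℝ)⁻¹ * ∑ n ∈ Finset.range N,
      ‖∫ x, conj (F n x) * F (n + k) x ∂μ‖ ≤ ε₁ + if k < h₀ then C₁ ^ 2 else 0 := by
    intro k hk
    split_ifs with hkh
    · have e1 : ∀ n, ‖∫ x, conj (F n x) * F (n + k) x ∂μ‖ ≤ C₁ ^ 2 := fun n => by
        rw [sq]
        exact ((hFb n).conj.mul (hFb (n + k))).norm_integral_le μ
      calc _ ≤ (N : ℝ)⁻¹ * ∑ n ∈ Finset.range N, C₁ ^ 2 := by gcongr with n _; exact e1 n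
        _ = C₁ ^ 2 := by simp; field_simp
        _ ≤ _ := by linarith
    · have hNk : N₁ k ≤ N := by
        have := Finset.single_le_sum (f := N₁) (fun i _ => Nat.zero_le _) hk
        omega
      refine le_trans (le_of_eq ?_) ((hN₁ k (not_lt.1 hkh) N hNk _ h1).trans (by simp))
      congr 1
      refine Finset.sum_congr rfl fun n _ => ?_
      rw [← hτ.integral_comp (-a z n) ((hFb n).conj.mul (hFb (n + k))).1]
      congr 2
      funext x
      simp only [hF, Fintype.prod_sum_type, Sum.elim_inl, Sum.elim_inr, one_mul, map_prod,
        ← hτ.add, sub_eq_add_neg]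
      rw [mul_comm]
  have h6 : (H : ℝ)⁻¹ * ∑ k ∈ Finset.range H, (N : ℝ)⁻¹ * ∑ n ∈ Finset.range N,
      ‖∫ x, conj (F n x) * F (n + k) x ∂μ‖ ≤ 2 * ε₁ := by
    have e1 : ∑ k ∈ Finset.range H, (if k < h₀ then C₁ ^ 2 else 0) ≤ h₀ * C₁ ^ 2 := by
      rw [← Finset.sum_filter, Finset.sum_const, nsmul_eq_mul]
      gcongr
      calc _ ≤ (Finset.range h₀).card := Finset.card_le_card fun k hk => by
              simp only [Finset.mem_filter, Finset.mem_range] at hk ⊢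
              exact hk.2
        _ = h₀ := Finset.card_range h₀
    have e2 : h₀ * C₁ ^ 2 ≤ H * ε₁ := by
      rw [div_lt_iff₀ hε₁0] at hH'
      rw [hH]
      push_cast
      nlinarith
    rw [inv_mul_le_iff₀ hH0']
    refine (Finset.sum_le_sum h5).trans ?_
    rw [Finset.sum_add_distrib, Finset.sum_const, Finset.card_range, nsmul_eq_mul]
    linarith
  have h7 : 12 * C₁ ^ 2 * H ^ 2 / N ≤ ε₁ := by
    rw [div_le_iff₀ hN0']
    rw [div_lt_iff₀ hε₁0] at hL₁
    have : (L₁ : ℝ) ≤ N := by exact_mod_cast (by omega : L₁ ≤ N)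
    nlinarith
  have h8 : ((N : ℝ)⁻¹ * ∑ n ∈ Finset.range N, ‖∫ x, φ x * F n x ∂μ‖) ^ 2 ≤ ε ^ 2 := by
    refine h4.trans ?_
    calc _ ≤ R ^ 2 * (4 * (2 * ε₁) + ε₁) := by gcongr
      _ = R ^ 2 / (R ^ 2 + 1) * ε ^ 2 := by rw [hε₁]; field_simp; ring
      _ ≤ 1 * ε ^ 2 := by
          gcongr
          rw [div_le_one (by positivity)]
          linarith
      _ = ε ^ 2 := one_mul _
  exact (sq_le_sq₀ (mul_nonneg (by positivity) (Finset.sum_nonneg fun _ _ => norm_nonneg _))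
    hε.le).1 h8

omit [IsProbabilityMeasure μ] in
/-- Iterates with finitely many values can be discarded. -/
theorem SmallCorrelations.of_subtype {τ : (Fin ℓ → ℤ) → X → X} (hτ : IsMPAction μ τ)
    {ι : Type*} [Fintype ι] {f : ι → X → ℂ} {C : ℝ} (hf : ∀ j, BddMeas C (f j))
    {a : ι → ℕ → Fin ℓ → ℤ} (p : ι → Prop) [DecidablePred p]
    (hp : ∀ j, ¬ p j → ∀ i, ∃ B : ℝ, ∀ n, |(a j n i : ℝ)| ≤ B)
    (h : SmallCorrelations μ τ (fun j : {j // p j} => f j) fun j => a j) :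
    SmallCorrelations μ τ f a := by
  intro R ε hε
  choose! B hB using hp
  obtain ⟨B₂, hB₂⟩ := exists_nat_ge (∑ j, ∑ i, |B j i|)
  have hB0 : ∀ j i, |B j i| ≤ B₂ := fun j i => by
    have h1 := Finset.single_le_sum (f := fun j => ∑ i, |B j i|)
      (fun i _ => by positivity) (Finset.mem_univ j)
    have h2 := Finset.single_le_sum (f := fun i => |B j i|)
      (fun i _ => by positivity) (Finset.mem_univ i)
    exact h2.trans (h1.trans hB₂)
  classical
  set box : Finset ({j // ¬ p j} → Fin ℓ → ℤ) :=
    Fintype.piFinset fun _ => Fintype.piFinset fun _ => Finset.Icc (-(B₂ : ℤ)) B₂ with hbox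
  obtain ⟨N₀, hN₀⟩ := h (R * C ^ Fintype.card {j // ¬ p j}) (ε / (box.card + 1)) (by positivity)
  refine ⟨N₀, fun N hN φ hφ => ?_⟩
  -- The discarded factors take finitely many values; each of them is absorbed into the test
  -- function, which the uniformity in φ permits.
  set ψ : ({j // ¬ p j} → Fin ℓ → ℤ) → X → ℂ :=
    fun β x => φ x * ∏ j : {j // ¬ p j}, f j (τ (β j) x) with hψ
  have hψb : ∀ β, BddMeas (R * C ^ Fintype.card {j // ¬ p j}) (ψ β) := fun β =>
    hφ.mul_prod hτ (f := fun j : {j // ¬ p j} => f j) (fun j => hf j) β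
  have h1 : ∀ n, ‖∫ x, φ x * ∏ j, f j (τ (a j n) x) ∂μ‖ ≤
      ∑ β ∈ box, ‖∫ x, ψ β x * ∏ j : {j // p j}, f j (τ (a j n) x) ∂μ‖ := by
    intro n
    have hmem : (fun j : {j // ¬ p j} => a j n) ∈ box := by
      simp only [hbox, Fintype.mem_piFinset, Finset.mem_Icc, ← abs_le]
      intro j i
      have := ((hB j j.2 i n).trans (le_abs_self _)).trans (hB0 j i)
      exact_mod_cast this
    refine le_trans (le_of_eq ?_) (Finset.single_le_sum
      (f := fun β => ‖∫ x, ψ β x * ∏ j : {j // p j}, f j (τ (a j n) x) ∂μ‖)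
      (fun _ _ => norm_nonneg _) hmem)
    congr 2
    funext x
    rw [← Fintype.prod_subtype_mul_prod_subtype p]
    simp only [hψ]
    ring
  calc _ ≤ (N : ℝ)⁻¹ * ∑ n ∈ Finset.range N, ∑ β ∈ box,
        ‖∫ x, ψ β x * ∏ j : {j // p j}, f j (τ (a j n) x) ∂μ‖ := by
        gcongr with n _; exact h1 n
    _ = ∑ β ∈ box, (N : ℝ)⁻¹ * ∑ n ∈ Finset.range N,
        ‖∫ x, ψ β x * ∏ j : {j // p j}, f j (τ (a j n) x) ∂μ‖ := by
        rw [Finset.sum_comm, Finset.mul_sum]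
    _ ≤ ∑ β ∈ box, ε / (box.card + 1) := Finset.sum_le_sum fun β _ => hN₀ N hN _ (hψb β)
    _ = ε * (box.card / (box.card + 1)) := by
        rw [Finset.sum_const, nsmul_eq_mul]; ring
    _ ≤ ε * 1 := by
        gcongr
        rw [div_le_one (by positivity)]
        linarith
    _ = ε := mul_one ε

end

/-! ### Nice families of polynomials in the shift -/

section

open Polynomial

theorem exists_X_pow_sub_one_eq (h : ℕ) :
    ∃ e : ℤ[X], (X ^ h - 1 : ℤ[X]) = (X - 1) * e ∧ e.eval 1 = h :=
  ⟨∑ i ∈ Finset.range h, X ^ i, (mul_geom_sum X h).symm, by simp [eval_finsetSum]⟩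

theorem polyShift_X_pow_mul (h : ℕ) (q : ℤ[X]) (a : ℕ → ℝ) :
    polyShift (X ^ h * q) a = fun n => polyShift q a (n + h) := by
  rw [polyShift_mul, polyShift_X_pow]

theorem X_sub_one_pow_dvd_X_pow_mul_iff (h s : ℕ) (q : ℤ[X]) :
    (X - 1) ^ s ∣ X ^ h * q ↔ (X - 1) ^ s ∣ q := by
  refine ⟨fun H => ?_, fun H => H.mul_left _⟩
  have h1 : IsCoprime (X - 1 : ℤ[X]) X := ⟨-1, 1, by ring⟩
  exact (h1.pow : IsCoprime ((X - 1 : ℤ[X]) ^ s) (X ^ h)).dvd_of_dvd_mul_left H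

/-- The order at `1` of `(X ^ h - 1) q + r` is as small as possible, for all but finitely many
`h`. -/
theorem exists_order_X_pow_sub_one_mul_add {q r u v : ℤ[X]} {t s : ℕ} (hq : q = (X - 1) ^ t * u)
    (hu : u.eval 1 ≠ 0) (hr : r = (X - 1) ^ s * v) (hv : v.eval 1 ≠ 0) :
    ∀ᶠ h in atTop, ∃ c : ℤ[X], (X ^ h - 1) * q + r = (X - 1) ^ min s (t + 1) * c ∧
      c.eval 1 ≠ 0 := by
  filter_upwards [eventually_gt_atTop (v.eval 1).natAbs] with h hh
  obtain ⟨e, he, he1⟩ := exists_X_pow_sub_one_eq h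
  rcases lt_trichotomy s (t + 1) with hs | hs | hs
  · rw [min_eq_left hs.le]
    obtain ⟨k, rfl⟩ : ∃ k, t = s + k := ⟨t - s, by omega⟩
    refine ⟨(X - 1) ^ (k + 1) * (e * u) + v, ?_, by simpa using hv⟩
    rw [hq, hr, he]
    ring
  · subst hs
    rw [min_self]
    refine ⟨e * u + v, by rw [hq, hr, he]; ring, ?_⟩
    rw [eval_add, eval_mul, he1]
    intro h0
    have h1 : (h : ℤ) * u.eval 1 = -v.eval 1 := by linarith
    have h2 := congrArg Int.natAbs h1
    rw [Int.natAbs_mul, Int.natAbs_neg, Int.natAbs_natCast] at h2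
    have h3 : 1 ≤ (u.eval 1).natAbs := Int.natAbs_pos.2 hu
    nlinarith
  · rw [min_eq_right hs.le]
    obtain ⟨k, rfl⟩ : ∃ k, s = t + 1 + (k + 1) := ⟨s - (t + 1) - 1, by omega⟩
    refine ⟨e * u + (X - 1) ^ (k + 1) * v, by rw [hq, hr, he]; ring, ?_⟩
    have : h ≠ 0 := by omega
    simp [he1, this, hu]

theorem IsTemperedSeq.diff_isBigO_of_le {δ : ℕ} {a : ℕ → ℝ} (ha : IsTemperedSeq δ a) {r s : ℕ}
    (hrs : r ≤ s) (hs : s ≤ δ) : diffSeq s a =O[atTop] diffSeq r a := by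
  rcases hrs.eq_or_lt with rfl | h
  · exact isBigO_refl _ _
  · exact (ha.diff_isLittleO_of_lt h hs).isBigO

/-- For large h the terms (X^h - 1)q and r do not cancel: the order of the sum is the smaller of
their orders, so it dominates both. -/
theorem IsTemperedSeq.eventually_combination {δ : ℕ} {a : ℕ → ℝ} (ha : IsTemperedSeq δ a)
    {q r u : ℤ[X]} {t : ℕ} (ht : t < δ) (hq : q = (X - 1) ^ t * u) (hu : u.eval 1 ≠ 0)
    (hr : ¬ (X - 1) ^ (δ + 1) ∣ r) :
    ∀ᶠ h in atTop, ¬ (X - 1) ^ (δ + 1) ∣ (X ^ h - 1) * q + r ∧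
      diffSeq (t + 1) a =O[atTop] polyShift ((X ^ h - 1) * q + r) a ∧
      polyShift r a =O[atTop] polyShift ((X ^ h - 1) * q + r) a := by
  obtain ⟨s, hs, v, hv, hv1⟩ := (X_sub_one_pow_dvd_or r (δ + 1)).resolve_left hr
  filter_upwards [exists_order_X_pow_sub_one_mul_add hq hu hv hv1] with h ⟨c, hc, hc1⟩
  have hm : min s (t + 1) ≤ δ := by omega
  have hO : diffSeq (min s (t + 1)) a =O[atTop] polyShift ((X ^ h - 1) * q + r) a := by
    rw [hc]
    exact ha.isBigO_polyShift hm hc1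
  refine ⟨?_, (ha.diff_isBigO_of_le (min_le_right _ _) ht).trans hO, ?_⟩
  · rw [hc, X_sub_one_pow_dvd_mul_iff hc1]
    omega
  · exact ((ha.polyShift_isBigO (by omega) ⟨v, hv⟩).trans
      (ha.diff_isBigO_of_le (min_le_left _ _) (by omega))).trans hO

/-- A family of tuples `p j` of polynomials in the shift, to be applied to the sequences `A i`,
whose member `o` dominates in the first row. -/
structure IsNiceFamily {ℓ : ℕ} [NeZero ℓ] {ι : Type*} (δ : Fin ℓ → ℕ) (A : Fin ℓ → ℕ → ℝ) (o : ι)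
    (t : ℕ) (p : ι → Fin ℓ → ℤ[X]) : Prop where
  le : t ≤ δ 0
  lead : ∃ u : ℤ[X], p o 0 = (X - 1) ^ t * u ∧ u.eval 1 ≠ 0
  dvd : ∀ j, (X - 1) ^ t ∣ p j 0
  sep : ∀ j, j ≠ o → ¬ (X - 1) ^ (δ 0 + 1) ∣ p o 0 - p j 0
  slow : ∀ j i, i ≠ 0 → polyShift (p j i) (A i) =o[atTop] diffSeq t (A 0)
  slow_sub : ∀ j i, j ≠ o → i ≠ 0 →
    polyShift (p o i - p j i) (A i) =o[atTop] polyShift (p o 0 - p j 0) (A 0)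

/-- The family obtained from `p` by van der Corput's trick with step `h`, normalized by the member
`z`. -/
noncomputable def vdcFamily {ℓ : ℕ} {ι : Type*} (p : ι → Fin ℓ → ℤ[X]) (z : ι) (h : ℕ) :
    ι ⊕ ι → Fin ℓ → ℤ[X] :=
  Sum.elim (fun j i => X ^ h * p j i - p z i) fun j i => p j i - p z i

namespace IsNiceFamily

variable {ℓ : ℕ} [NeZero ℓ] {ι : Type*} {δ : Fin ℓ → ℕ} {A : Fin ℓ → ℕ → ℝ} {o : ι} {t : ℕ}
  {p : ι → Fin ℓ → ℤ[X]}

theorem comp {κ : Type*} (hp : IsNiceFamily δ A o t p) {e : κ → ι} (he : Function.Injective e)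
    {o' : κ} (ho : e o' = o) : IsNiceFamily δ A o' t (p ∘ e) := by
  subst ho
  exact ⟨hp.le, hp.lead, fun j => hp.dvd _, fun j hj => hp.sep _ (he.ne hj),
    fun j => hp.slow _, fun j i hj => hp.slow_sub _ i (he.ne hj)⟩

/-- The conditions on differences survive van der Corput's trick. -/
theorem eventually_vdcFamily_sub [Finite ι] (hA : ∀ i, IsTemperedSeq (δ i) (A i))
    (hp : IsNiceFamily δ A o t p) (ht : t < δ 0) (z : ι) :
    ∀ᶠ h in atTop, ∀ J, J ≠ Sum.inl o →
      ¬ (X - 1) ^ (δ 0 + 1) ∣ vdcFamily p z h (Sum.inl o) 0 - vdcFamily p z h J 0 ∧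
      ∀ i, i ≠ 0 → polyShift (vdcFamily p z h (Sum.inl o) i - vdcFamily p z h J i) (A i)
        =o[atTop] polyShift (vdcFamily p z h (Sum.inl o) 0 - vdcFamily p z h J 0) (A 0) := by
  obtain ⟨u, hu, hu1⟩ := hp.lead
  have h1 : ∀ᶠ h in atTop, ∀ j, j ≠ o → _ := eventually_all.2 fun j => eventually_imp_distrib_left.2
    fun hj => (hA 0).eventually_combination ht hu hu1 (hp.sep j hj)
  filter_upwards [h1, eventually_gt_atTop 0] with h hh h0 J hJ
  have hslow : ∀ j i, i ≠ 0 →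
      polyShift ((X ^ h - 1) * p j i) (A i) =o[atTop] diffSeq (t + 1) (A 0) := fun j i hi =>
    (hA i).polyShift_diff_isLittleO (hA 0) ht (X_sub_one_dvd_X_pow_sub_one h) (hp.slow j i hi)
  -- The normalizing member cancels. Against X^h p_j the difference is a shift of p_o - p_j; against
  -- p_j it is (X^h - 1)p_o + (p_o - p_j), in which large h excludes cancellation.
  rcases J with j | j
  · have hj : j ≠ o := fun h => hJ (by rw [h])
    have e : ∀ i, vdcFamily p z h (Sum.inl o) i - vdcFamily p z h (Sum.inl j) i =
        X ^ h * (p o i - p j i) := fun i => by simp only [vdcFamily, Sum.elim_inl]; ring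
    simp only [e, X_sub_one_pow_dvd_X_pow_mul_iff, polyShift_X_pow_mul]
    exact ⟨hp.sep j hj, fun i hi => (hp.slow_sub j i hj hi).comp_tendsto (tendsto_add_nat h)⟩
  · have e : ∀ i, vdcFamily p z h (Sum.inl o) i - vdcFamily p z h (Sum.inr j) i =
        (X ^ h - 1) * p o i + (p o i - p j i) := fun i => by
      simp only [vdcFamily, Sum.elim_inl, Sum.elim_inr]; ring
    by_cases hj : j = o
    · subst hj
      obtain ⟨e₁, he, he1⟩ := exists_X_pow_sub_one_eq h
      have h2 : (e₁ * u).eval 1 ≠ 0 := by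
        rw [eval_mul, he1]
        exact mul_ne_zero (by exact_mod_cast h0.ne') hu1
      have h3 : (X ^ h - 1) * p j 0 = (X - 1) ^ (t + 1) * (e₁ * u) := by rw [hu, he]; ring
      simp only [e, sub_self, add_zero]
      rw [h3, X_sub_one_pow_dvd_mul_iff h2]
      exact ⟨by omega, fun i hi => (hslow j i hi).trans_isBigO ((hA 0).isBigO_polyShift ht h2)⟩
    · obtain ⟨h2, h3, h4⟩ := hh j hj
      simp only [e]
      refine ⟨h2, fun i hi => ?_⟩
      rw [polyShift_add]
      exact ((hslow o i hi).trans_isBigO h3).add ((hp.slow_sub j i hj hi).trans_isBigO h4)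

/-- Van der Corput's trick, normalized by a member with a different leading coefficient. -/
theorem eventually_vdcFamily_of_not_dvd [Finite ι] (hA : ∀ i, IsTemperedSeq (δ i) (A i))
    (hp : IsNiceFamily δ A o t p) (ht : t < δ 0) {z : ι}
    (hz : ¬ (X - 1) ^ (t + 1) ∣ p o 0 - p z 0) :
    ∀ᶠ h in atTop, IsNiceFamily δ A (Sum.inl o) t (vdcFamily p z h) := by
  filter_upwards [hp.eventually_vdcFamily_sub hA ht z] with h hh
  obtain ⟨u, hu, hu1⟩ := hp.lead
  refine ⟨ht.le, ?_, ?_, fun J hJ => (hh J hJ).1, ?_, fun J i hJ => (hh J hJ).2 i⟩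
  · obtain ⟨v, hv⟩ := hp.dvd z
    obtain ⟨e, he, -⟩ := exists_X_pow_sub_one_eq h
    -- As p_z has another coefficient at order t, the difference p_o - p_z keeps the order t, and
    -- (X^h - 1)p_o has higher order.
    have h1 : (u - v).eval 1 ≠ 0 := fun h0 => hz <| by
      rw [hu, hv, ← mul_sub, pow_succ]
      exact mul_dvd_mul_left _ ((X_sub_one_dvd_iff _).2 h0)
    refine ⟨(X - 1) * (e * u) + (u - v), ?_, by simpa using h1⟩
    have : vdcFamily p z h (Sum.inl o) 0 = (X ^ h - 1) * p o 0 + (p o 0 - p z 0) := by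
      simp only [vdcFamily, Sum.elim_inl]; ring
    rw [this, hu, hv, he]
    ring
  · rintro (j | j)
    · exact dvd_sub ((hp.dvd j).mul_left _) (hp.dvd z)
    · exact dvd_sub (hp.dvd j) (hp.dvd z)
  · have hslow : ∀ j i, i ≠ 0 →
        polyShift ((X ^ h - 1) * p j i) (A i) =o[atTop] diffSeq t (A 0) := fun j i hi =>
      ((hA i).polyShift_diff_isLittleO (hA 0) ht (X_sub_one_dvd_X_pow_sub_one h)
        (hp.slow j i hi)).trans ((hA 0).diff_isLittleO ht.le)
    rintro (j | j) i hi
    · have : vdcFamily p z h (Sum.inl j) i = (X ^ h - 1) * p j i + (p j i - p z i) := by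
        simp only [vdcFamily, Sum.elim_inl]; ring
      rw [this, polyShift_add, polyShift_sub]
      exact (hslow j i hi).add ((hp.slow j i hi).sub (hp.slow z i hi))
    · simp only [vdcFamily, Sum.elim_inr]
      rw [polyShift_sub]
      exact (hp.slow j i hi).sub (hp.slow z i hi)

/-- Van der Corput's trick, normalized by the dominating member. -/
theorem eventually_vdcFamily_of_dvd [Finite ι] (hA : ∀ i, IsTemperedSeq (δ i) (A i))
    (hp : IsNiceFamily δ A o t p) (ht : t < δ 0)
    (ho : ∀ j, (X - 1) ^ (t + 1) ∣ p o 0 - p j 0) :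
    ∀ᶠ h in atTop, IsNiceFamily δ A (Sum.inl o) (t + 1) (vdcFamily p o h) := by
  filter_upwards [hp.eventually_vdcFamily_sub hA ht o, eventually_gt_atTop 0] with h hh h0
  obtain ⟨u, hu, hu1⟩ := hp.lead
  have hl : ∀ j i, vdcFamily p o h (Sum.inl j) i = (X ^ h - 1) * p j i - (p o i - p j i) :=
    fun j i => by simp only [vdcFamily, Sum.elim_inl]; ring
  have hr : ∀ j i, vdcFamily p o h (Sum.inr j) i = 0 - (p o i - p j i) :=
    fun j i => by simp only [vdcFamily, Sum.elim_inr]; ring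
  obtain ⟨e, he, he1⟩ := exists_X_pow_sub_one_eq h
  refine ⟨ht, ?_, ?_, fun J hJ => (hh J hJ).1, ?_, fun J i hJ => (hh J hJ).2 i⟩
  -- The first row of the new leading member is (X^h - 1)p_o, of exact order t + 1 with coefficient
  -- h·u(1) ≠ 0.
  · refine ⟨e * u, by rw [hl, hu, he]; ring, ?_⟩
    rw [eval_mul, he1]
    exact mul_ne_zero (by exact_mod_cast h0.ne') hu1
  · rintro (j | j)
    · rw [hl, he]
      obtain ⟨v, hv⟩ := hp.dvd j
      exact dvd_sub ⟨e * v, by rw [hv]; ring⟩ (ho j)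
    · rw [hr]
      exact dvd_sub (dvd_zero _) (ho j)
  · have hsub : ∀ j i, i ≠ 0 →
        polyShift (p o i - p j i) (A i) =o[atTop] diffSeq (t + 1) (A 0) := fun j i hi => by
      by_cases hj : j = o
      · subst hj
        rw [sub_self, polyShift_zero]
        exact isLittleO_zero _ _
      · exact (hp.slow_sub j i hj hi).trans_isBigO ((hA 0).polyShift_isBigO ht (ho j))
    rintro (j | j) i hi
    · rw [hl, polyShift_sub]
      exact ((hA i).polyShift_diff_isLittleO (hA 0) ht (X_sub_one_dvd_X_pow_sub_one h)
        (hp.slow j i hi)).sub (hsub j i hi)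
    · rw [hr, polyShift_sub, polyShift_zero]
      exact (isLittleO_zero _ _).sub (hsub j i hi)

end IsNiceFamily

end

/-! ### The weight of a family -/

section

open Polynomial

/-- The filtration of tuples of polynomials by their orders at `1`, row after row. The order in row
`i` matters up to `δ i + 1`, and each row takes `D` steps. -/
def orderFiltration {ℓ : ℕ} (δ : Fin ℓ → ℕ) (D s : ℕ) : AddSubgroup (Fin ℓ → ℤ[X]) where
  carrier := {q | ∀ i, (X - 1) ^ min (δ i + 1) (s - i * D) ∣ q i}
  add_mem' := fun ha hb i => dvd_add (ha i) (hb i)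
  zero_mem' := fun _ => dvd_zero _
  neg_mem' := fun ha i => (dvd_neg).2 (ha i)

variable {ℓ : ℕ} {δ : Fin ℓ → ℕ} {D : ℕ}

theorem mem_orderFiltration {s : ℕ} {q : Fin ℓ → ℤ[X]} :
    q ∈ orderFiltration δ D s ↔ ∀ i, (X - 1) ^ min (δ i + 1) (s - i * D) ∣ q i := Iff.rfl

theorem orderFiltration_anti : Antitone (orderFiltration δ D) := fun _ _ h _ hq i =>
  (pow_dvd_pow _ (by omega)).trans (hq i)

theorem X_pow_smul_mem_orderFiltration_iff {s : ℕ} {q : Fin ℓ → ℤ[X]} (h : ℕ) :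
    (fun i => X ^ h * q i) ∈ orderFiltration δ D s ↔ q ∈ orderFiltration δ D s := by
  simp only [mem_orderFiltration, X_sub_one_pow_dvd_X_pow_mul_iff]

/-- The factor X^h - 1 raises every order by one, so the shift acts trivially on the quotients of
consecutive levels. -/
theorem X_pow_sub_one_smul_mem_orderFiltration {s : ℕ} {q : Fin ℓ → ℤ[X]} (h : ℕ)
    (hq : q ∈ orderFiltration δ D s) :
    (fun i => X ^ h * q i) - q ∈ orderFiltration δ D (s + 1) := by
  intro i
  have h1 : ((fun i => X ^ h * q i : Fin ℓ → ℤ[X]) - q) i = (X ^ h - 1) * q i := by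
    rw [Pi.sub_apply, sub_mul, one_mul]
  rw [h1]
  refine (pow_dvd_pow _ (by omega : min (δ i + 1) (s + 1 - i * D) ≤
    1 + min (δ i + 1) (s - i * D))).trans ?_
  rw [pow_add, pow_one]
  exact mul_dvd_mul (X_sub_one_dvd_X_pow_sub_one h) (hq i)

/-- Level ℓ·D leaves at least D ≥ δ i + 1 steps for each row. The tuples it contains tend to zero
and give bounded iterates. -/
theorem mem_orderFiltration_last_iff (hδ : ∀ i, δ i + 1 ≤ D) {q : Fin ℓ → ℤ[X]} :
    q ∈ orderFiltration δ D (ℓ * D) ↔ ∀ i, (X - 1) ^ (δ i + 1) ∣ q i := by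
  rw [mem_orderFiltration]
  refine forall_congr' fun i => ?_
  rw [min_eq_left]
  rw [← Nat.sub_mul]
  exact (hδ i).trans (Nat.le_mul_of_pos_left _ (by omega))

theorem mem_orderFiltration_of_dvd [NeZero ℓ] {s : ℕ} (hs : s ≤ D) {q : Fin ℓ → ℤ[X]}
    (h : (X - 1) ^ s ∣ q 0) : q ∈ orderFiltration δ D s := by
  intro i
  by_cases hi : i = 0
  · subst hi
    exact (pow_dvd_pow _ (by simp)).trans h
  · have : 0 < (i : ℕ) := Nat.pos_of_ne_zero fun h0 => hi (Fin.ext h0)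
    have : D ≤ i * D := Nat.le_mul_of_pos_left _ this
    rw [show s - i * D = 0 by omega]
    simp

theorem dvd_of_mem_orderFiltration [NeZero ℓ] {s t : ℕ} (hs : t ≤ s) (ht : t ≤ δ 0 + 1)
    {q : Fin ℓ → ℤ[X]} (h : q ∈ orderFiltration δ D s) : (X - 1) ^ t ∣ q 0 := by
  refine (pow_dvd_pow _ ?_).trans (h 0)
  simp only [Fin.coe_ofNat_eq_mod, Nat.zero_mod, zero_mul, Nat.sub_zero]
  omega

/-- The classes modulo level `s + 1` of the members of exact level `s`. -/
def levelClasses {ι : Type*} (δ : Fin ℓ → ℕ) (D : ℕ) (p : ι → Fin ℓ → ℤ[X]) (s : ℕ) :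
    Set ((Fin ℓ → ℤ[X]) ⧸ orderFiltration δ D (s + 1)) :=
  {c | ∃ j, p j ∈ orderFiltration δ D s ∧ p j ∉ orderFiltration δ D (s + 1) ∧
    QuotientAddGroup.mk (p j) = c}

/-- The numbers of classes on all levels; shallow levels come first in the lexicographic order. -/
noncomputable def familyWeight {ι : Type*} (δ : Fin ℓ → ℕ) (D : ℕ) (p : ι → Fin ℓ → ℤ[X]) :
    Lex (Fin (ℓ * D) → ℕ) :=
  toLex fun s => (levelClasses δ D p s).ncard

variable {ι : Type*} {p : ι → Fin ℓ → ℤ[X]}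

theorem levelClasses_subset_range (s : ℕ) :
    levelClasses δ D p s ⊆ Set.range fun j => QuotientAddGroup.mk (p j) := by
  rintro c ⟨j, -, -, rfl⟩
  exact ⟨j, rfl⟩

theorem finite_levelClasses [Finite ι] (s : ℕ) : (levelClasses δ D p s).Finite :=
  (Set.finite_range _).subset (levelClasses_subset_range s)

theorem ncard_levelClasses_le [Fintype ι] (s : ℕ) :
    (levelClasses δ D p s).ncard ≤ Fintype.card ι := by
  refine (Set.ncard_le_ncard (levelClasses_subset_range s) (Set.finite_range _)).trans ?_
  rw [← Set.image_univ, ← Nat.card_eq_fintype_card, ← Set.ncard_univ]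
  exact Set.ncard_image_le Set.finite_univ

theorem toLex_lt_toLex_of_le_of_lt {n : ℕ} {v w : Fin n → ℕ} {s : Fin n}
    (h : ∀ i < s, v i ≤ w i) (hs : v s < w s) : toLex v < toLex w := by
  classical
  obtain ⟨i, hi, hmin⟩ := WellFounded.has_min (wellFounded_lt (α := Fin n)) {i | v i < w i} ⟨s, hs⟩
  refine ⟨i, fun j hj => ?_, hi⟩
  have h1 : ¬ v j < w j := fun H => hmin j H hj
  have h2 : ¬ s < i := fun H => hmin s hs H
  exact le_antisymm (h j (lt_of_lt_of_le hj (not_lt.1 h2))) (not_lt.1 h1)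

/-- A member of exact level `s` of the new family comes from one of the old family, if the
normalizing member lies on level `s`. -/
theorem vdcFamily_mem_orderFiltration {z : ι} {h s : ℕ} (hz : p z ∈ orderFiltration δ D s)
    {J : ι ⊕ ι} (hJ : vdcFamily p z h J ∈ orderFiltration δ D s) :
    ∃ j, p j ∈ orderFiltration δ D s ∧
      p j - (vdcFamily p z h J + p z) ∈ orderFiltration δ D (s + 1) := by
  rcases J with j | j
  · have e : vdcFamily p z h (Sum.inl j) + p z = fun i => X ^ h * p j i := by
      funext i; simp [vdcFamily]
    have h1 := add_mem hJ hz
    rw [e, X_pow_smul_mem_orderFiltration_iff] at h1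
    refine ⟨j, h1, ?_⟩
    rw [e, ← neg_sub]
    exact neg_mem (X_pow_sub_one_smul_mem_orderFiltration h h1)
  · have e : vdcFamily p z h (Sum.inr j) + p z = p j := by
      funext i; simp [vdcFamily]
    have h1 := add_mem hJ hz
    rw [e] at h1
    refine ⟨j, h1, ?_⟩
    rw [e, sub_self]
    exact zero_mem _

/-- Normalizing by a member of the deepest level lowers the weight. -/
theorem familyWeight_vdcFamily_lt [Finite ι] {z : ι} {s₀ : ℕ} (hs₀ : s₀ < ℓ * D)
    (hz : p z ∈ orderFiltration δ D s₀) (hp : ∀ j, p j ∉ orderFiltration δ D (s₀ + 1)) (h : ℕ)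
    {κ : Type*} (e : κ → ι ⊕ ι) :
    familyWeight δ D (vdcFamily p z h ∘ e) < familyWeight δ D p := by
  refine toLex_lt_toLex_of_le_of_lt (s := ⟨s₀, hs₀⟩) (fun s hs => ?_) ?_
  -- On levels shallower than s₀ the normalizing member is zero modulo level s + 1, so no new class
  -- arises.
  · refine Set.ncard_le_ncard ?_ (finite_levelClasses _)
    rintro c ⟨J, hJ, hJ', rfl⟩
    have hs' : (s : ℕ) + 1 ≤ s₀ := hs
    have hz' := orderFiltration_anti hs' hz
    obtain ⟨j, hj, hj'⟩ := vdcFamily_mem_orderFiltration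
      (orderFiltration_anti (Nat.le_succ _) hz') hJ
    have h1 : p j - vdcFamily p z h (e J) ∈ orderFiltration δ D (s + 1) := by
      have := add_mem hj' hz'
      rwa [← sub_sub, sub_add_cancel] at this
    refine ⟨j, hj, fun H => hJ' ?_, ?_⟩
    · have := sub_mem H h1
      rwa [sub_sub_cancel] at this
    · refine (QuotientAddGroup.eq.2 ?_).symm
      rwa [neg_add_eq_sub]
  · set b : (Fin ℓ → ℤ[X]) ⧸ orderFiltration δ D (s₀ + 1) := QuotientAddGroup.mk (p z)
    have hb : b ∈ levelClasses δ D p s₀ := ⟨z, hz, hp z, rfl⟩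
    -- On level s₀, adding the class b of p_z sends new classes to old ones, and never to b itself,
    -- since new classes are nonzero: one class is lost.
    have hmaps : ∀ c ∈ levelClasses δ D (vdcFamily p z h ∘ e) s₀,
        c + b ∈ levelClasses δ D p s₀ \ {b} := by
      rintro c ⟨J, hJ, hJ', rfl⟩
      obtain ⟨j, hj, hj'⟩ := vdcFamily_mem_orderFiltration hz hJ
      refine ⟨⟨j, hj, hp j, ?_⟩, fun H => hJ' ?_⟩
      · refine (QuotientAddGroup.eq.2 ?_).symm
        rwa [neg_add_eq_sub]
      · exact (QuotientAddGroup.eq_zero_iff _).1 (add_eq_right.1 H)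
    have h1 : (levelClasses δ D (vdcFamily p z h ∘ e) s₀).ncard ≤
        (levelClasses δ D p s₀ \ {b}).ncard :=
      Set.ncard_le_ncard_of_injOn (· + b) hmaps (add_left_injective b).injOn
        ((finite_levelClasses s₀).sdiff)
    exact h1.trans_lt (Set.ncard_sdiff_singleton_lt_of_mem hb (finite_levelClasses s₀))

variable [NeZero ℓ] {A : Fin ℓ → ℕ → ℝ} {o : ι} {t : ℕ}

theorem IsNiceFamily.not_dvd (hp : IsNiceFamily δ A o t p) : ¬ (X - 1) ^ (t + 1) ∣ p o 0 := by
  obtain ⟨u, hu, hu1⟩ := hp.lead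
  rw [hu, X_sub_one_pow_dvd_mul_iff hu1]
  omega

theorem IsNiceFamily.not_mem_last (hp : IsNiceFamily δ A o t p) (hδ : ∀ i, δ i + 1 ≤ D) :
    p o ∉ orderFiltration δ D (ℓ * D) := fun h =>
  hp.not_dvd ((pow_dvd_pow _ (Nat.succ_le_succ hp.le)).trans
    ((mem_orderFiltration_last_iff hδ).1 h 0))

/-- The choice of the normalizing member. -/
theorem IsNiceFamily.exists_vdcFamily [Finite ι] (hA : ∀ i, IsTemperedSeq (δ i) (A i))
    (hδ : ∀ i, δ i + 1 ≤ D) (hp : IsNiceFamily δ A o t p) (ht : t < δ 0)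
    (hnull : ∀ j, p j ∉ orderFiltration δ D (ℓ * D)) :
    ∃ (z : ι) (s₀ t' : ℕ), s₀ < ℓ * D ∧ p z ∈ orderFiltration δ D s₀ ∧
      (∀ j, p j ∉ orderFiltration δ D (s₀ + 1)) ∧
      ∀ᶠ h in atTop, IsNiceFamily δ A (Sum.inl o) t' (vdcFamily p z h) := by
  classical
  have htD : t ≤ D := by have := hδ 0; omega
  have hmem : ∀ j, p j ∈ orderFiltration δ D t := fun j => mem_orderFiltration_of_dvd htD (hp.dvd j)
  have htℓ : t ≤ ℓ * D := htD.trans (Nat.le_mul_of_pos_left _ (NeZero.pos ℓ))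
  set P : ℕ → Prop := fun s => ∃ j, p j ∈ orderFiltration δ D s with hP
  obtain ⟨s₀, hs₀⟩ : ∃ s₀, s₀ = Nat.findGreatest P (ℓ * D) := ⟨_, rfl⟩
  have hspec : P s₀ := hs₀ ▸ Nat.findGreatest_spec htℓ ⟨o, hmem o⟩
  have hts : t ≤ s₀ := hs₀ ▸ Nat.le_findGreatest htℓ ⟨o, hmem o⟩
  have hlt : s₀ < ℓ * D := by
    refine lt_of_le_of_ne (hs₀ ▸ Nat.findGreatest_le _) fun h => ?_
    obtain ⟨j, hj⟩ := hspec
    exact hnull j (h ▸ hj)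
  have hdeep : ∀ j, p j ∉ orderFiltration δ D (s₀ + 1) := fun j hj =>
    Nat.findGreatest_is_greatest (P := P) (n := ℓ * D) (k := s₀ + 1) (by omega) hlt ⟨j, hj⟩
  -- A deepest member with another leading coefficient in the first row normalizes with t unchanged.
  -- If there is none, then s₀ = t, because a deeper member would have order at least t + 1 in the
  -- first row, and p_o with it. All members are then deepest, and normalizing by o raises t.
  by_cases hz : ∃ z, p z ∈ orderFiltration δ D s₀ ∧ ¬ (X - 1) ^ (t + 1) ∣ p o 0 - p z 0
  · obtain ⟨z, hz, hz'⟩ := hz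
    exact ⟨z, s₀, t, hlt, hz, hdeep, hp.eventually_vdcFamily_of_not_dvd hA ht hz'⟩
  · push Not at hz
    have hst : s₀ = t := by
      by_contra hne
      obtain ⟨z, hz'⟩ := hspec
      have h1 : (X - 1) ^ (t + 1) ∣ p z 0 := dvd_of_mem_orderFiltration (by omega) (by omega) hz'
      exact hp.not_dvd ((dvd_iff_dvd_of_dvd_sub (hz z hz')).2 h1)
    subst hst
    exact ⟨o, s₀, s₀ + 1, hlt, hmem o, hdeep,
      hp.eventually_vdcFamily_of_dvd hA ht fun j => hz j (hmem j)⟩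

end

/-! ### Induction on the weight -/

section

open Polynomial

/-- Up to a sign, the `δ`-th difference of a tempered sequence of degree `δ` is slowly growing. -/
theorem IsTemperedSeq.exists_isSlowlyGrowing {δ : ℕ} {a : ℕ → ℝ} (ha : IsTemperedSeq δ a) :
    ∃ ε : ℤ, ε * ε = 1 ∧ IsSlowlyGrowing fun n => (ε : ℝ) * diffSeq δ a n := by
  have h0 : Tendsto (fun n : ℕ => |(n : ℝ) * diffSeq (δ + 1) a n|) atTop atTop := by
    have h1 : (fun _ : ℕ => (1 : ℝ)) =o[atTop] diffSeq δ a :=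
      isLittleO_const_left.2 (Or.inr (ha.tendsto_abs δ le_rfl))
    have h2 := h1.trans_isBigO (ha.isBigO_diff δ le_rfl)
    exact (isLittleO_const_left.1 h2).resolve_left one_ne_zero
  have hz := ha.tendsto_zero
  have hm := ha.monotone
  simp only [diffSeq_succ] at h0 hm
  have hz' : Tendsto (fun n => diffSeq δ a (n + 1) - diffSeq δ a n) atTop (𝓝 0) := by
    simpa only [← diffSeq_succ] using hz
  rcases hm with hm | hm
  · refine ⟨1, by norm_num, ?_, ?_, ?_⟩
    · simpa using hm
    · simpa using hz'
    · refine h0.congr' ?_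
      filter_upwards [hm] with n hn
      rw [abs_mul, Nat.abs_cast, abs_of_pos hn.1]
      simp
  · refine ⟨-1, by norm_num, ?_, ?_, ?_⟩
    · filter_upwards [hm] with n hn
      push_cast
      constructor <;> linarith
    · refine (neg_zero (G := ℝ) ▸ hz'.neg).congr fun n => ?_
      push_cast
      ring
    · refine h0.congr' ?_
      filter_upwards [hm] with n hn
      rw [abs_mul, Nat.abs_cast, abs_of_neg hn.1]
      push_cast
      ring

theorem exists_bound_of_tendsto {b : ℕ → ℝ} {x : ℝ} (h : Tendsto b atTop (𝓝 x)) :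
    ∃ B : ℝ, ∀ n, |b n| ≤ B := by
  obtain ⟨B, hB⟩ := (Metric.isBounded_range_of_tendsto b h).exists_norm_le
  exact ⟨B, fun n => hB _ ⟨n, rfl⟩⟩

variable {Ω : Type*} [MeasurableSpace Ω] {μ : Measure Ω} [IsProbabilityMeasure μ]
  {ℓ : ℕ} [NeZero ℓ] {τ : (Fin ℓ → ℤ) → Ω → Ω} {T : Ω ≃ᵐ Ω}
  {δ : Fin ℓ → ℕ} {A : Fin ℓ → ℕ → ℝ}

/-- Families whose first row cannot be reduced any further. -/
theorem IsNiceFamily.smallCorrelations_of_eq (hτ : IsMPAction μ τ) (hT : MeasurePreserving T μ μ)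
    (hTτ : ∀ n x, iter T n x = τ (Pi.single 0 n) x) {ι : Type*} [Fintype ι] {o : ι} {t : ℕ}
    {p : ι → Fin ℓ → ℤ[X]} (hA : ∀ i, IsTemperedSeq (δ i) (A i)) (hp : IsNiceFamily δ A o t p)
    (ht : t = δ 0) {f : ι → Ω → ℂ} {M : ℝ} (hf : ∀ j, BddMeas M (f j)) {a : ι → ℕ → Fin ℓ → ℤ}
    (ha : ∀ j i, ∃ B : ℝ, ∀ n, |(a j n i : ℝ) - polyShift (p j i) (A i) n| ≤ B)
    (hQ : hostKraPow μ T (Fintype.card ι + 1) (f o) = 0) : SmallCorrelations μ τ f a := by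
  obtain ⟨ε, hε, hγ⟩ := (hA 0).exists_isSlowlyGrowing
  have hε0 : ε ≠ 0 := fun h => by simp [h] at hε
  choose u hu using hp.dvd
  have hεR : (ε : ℝ) * ε = 1 := by exact_mod_cast hε
  have hlead := hp.not_dvd
  -- The sign ε makes γ = ε·Δᵗ(A 0) increasing; since ε² = 1, the coefficient of γ is ε times the
  -- leading coefficient.
  refine smallCorrelations_of_isSlowlyGrowing hτ hT hTτ hf hγ (c := fun j => ε * (u j).eval 1)
    (mul_ne_zero hε0 fun h0 => hlead ?_) (fun j hj h0 => hp.sep j hj ?_) (fun j => ?_)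
    (fun j i hi => ?_) hQ
  · rw [hu o, pow_succ]
    exact mul_dvd_mul_left _ ((X_sub_one_dvd_iff _).2 h0)
  · rw [hu o, hu j, ← mul_sub, ← ht, pow_succ]
    refine mul_dvd_mul_left _ ((X_sub_one_dvd_iff _).2 ?_)
    have := mul_left_cancel₀ hε0 h0
    simp [this]
  · obtain ⟨B, hB⟩ := ha j 0
    have h1 : (X - 1) ^ (δ 0 + 1) ∣ p j 0 - C ((u j).eval 1) * (X - 1) ^ t := by
      rw [hu j, mul_comm _ ((X - 1) ^ t), ← mul_sub, ← ht, pow_succ]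
      exact mul_dvd_mul_left _ ((X_sub_one_dvd_iff _).2 (by simp))
    obtain ⟨B', hB'⟩ := exists_bound_of_tendsto ((hA 0).tendsto_polyShift_zero h1)
    refine ⟨B + B', fun n => ?_⟩
    have h2 := hB' n
    rw [polyShift_sub, polyShift_mul, polyShift_C] at h2
    have h3 : (a j n 0 : ℝ) - ((ε * (u j).eval 1 : ℤ) : ℝ) * (ε * diffSeq (δ 0) (A 0) n) =
        (a j n 0 - polyShift (p j 0) (A 0) n) + (polyShift (p j 0) (A 0) n -
          ((u j).eval 1 : ℤ) * diffSeq t (A 0) n) := by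
      push_cast
      rw [ht]
      linear_combination (-((u j).eval 1 : ℤ) * diffSeq (δ 0) (A 0) n) * hεR
    rw [h3]
    exact (abs_add_le _ _).trans (add_le_add (hB n) h2)
  · obtain ⟨B, hB⟩ := ha j i
    -- An annihilated row is bounded and compared with 0; for any other row slowness passes to the
    -- increments.
    by_cases hn : (X - 1) ^ (δ i + 1) ∣ p j i
    · obtain ⟨B', hB'⟩ := exists_bound_of_tendsto ((hA i).tendsto_polyShift_zero hn)
      refine ⟨0, B + B', fun n => ?_, ?_⟩
      · have := abs_add_le ((a j n i : ℝ) - polyShift (p j i) (A i) n) (polyShift (p j i) (A i) n)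
        rw [sub_add_cancel] at this
        simpa using this.trans (add_le_add (hB n) (hB' n))
      · simp
    · refine ⟨_, B, hB, ?_⟩
      have h1 := (hA i).polyShift_diff_isLittleO_of_not_dvd (hA 0) hp.le hn dvd_rfl (hp.slow j i hi)
      rw [polyShift_mul, polyShift_X_sub_one] at h1
      simp only [← mul_sub, ← diffSeq_succ]
      refine (h1.trans_isBigO ?_)
      rw [ht]
      exact isBigO_self_const_mul (by exact_mod_cast hε0) _ _

end

section

open Polynomial

/-- The statement that the order `K` of the seminorm suffices for all families of at most `m`
members with given weight, with rows of degree less than `D`. -/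
def SeminormOrderSuffices.{u} (ℓ D m : ℕ) [NeZero ℓ] (W : Lex (Fin (ℓ * D) → ℕ)) (K : ℕ) : Prop :=
  ∀ {Ω : Type u} [MeasurableSpace Ω] (μ : Measure Ω) [IsProbabilityMeasure μ]
    {τ : (Fin ℓ → ℤ) → Ω → Ω} {T : Ω ≃ᵐ Ω}, IsMPAction μ τ → MeasurePreserving T μ μ →
    (∀ n x, iter T n x = τ (Pi.single 0 n) x) →
    ∀ {ι : Type} [Fintype ι], Fintype.card ι ≤ m →
    ∀ {δ : Fin ℓ → ℕ} {A : Fin ℓ → ℕ → ℝ} {o : ι} {t : ℕ} {p : ι → Fin ℓ → ℤ[X]},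
    (∀ i, IsTemperedSeq (δ i) (A i)) → (∀ i, δ i + 1 ≤ D) → IsNiceFamily δ A o t p →
    (∀ j, p j ∉ orderFiltration δ D (ℓ * D)) → familyWeight δ D p = W →
    ∀ {f : ι → Ω → ℂ} {M : ℝ}, (∀ j, BddMeas M (f j)) → ∀ {a : ι → ℕ → Fin ℓ → ℤ},
    (∀ j i, ∃ B : ℝ, ∀ n, |(a j n i : ℝ) - polyShift (p j i) (A i) n| ≤ B) →
    hostKraPow μ T K (f o) = 0 → SmallCorrelations μ τ f a

/-- Well-founded induction on the weight, for all m at once because differencing doubles the number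
of members. The new family has smaller weight, and its class counts are at most 2m, so finitely many
orders from the induction hypothesis have to be majorized, besides m + 1 for the irreducible case.
-/
theorem exists_seminormOrderSuffices.{u} (ℓ D : ℕ) [NeZero ℓ] (W : Lex (Fin (ℓ * D) → ℕ)) :
    ∀ m, ∃ K, SeminormOrderSuffices.{u} ℓ D m W K := by
  classical
  induction W using WellFoundedLT.induction with
  | ind W ih =>
    intro m
    choose! k hk using ih
    -- The box also contains weights not below W, where k has an arbitrary value; they can only
    -- enlarge the maximum.
    set box : Finset (Lex (Fin (ℓ * D) → ℕ)) :=
      (Fintype.piFinset fun _ => Finset.range (2 * m + 1)).map toLex.toEmbedding with hbox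
    refine ⟨max (m + 1) (box.sup fun W' => k W' (2 * m)), ?_⟩
    intro Ω _ μ _ τ T hτ hT hTτ ι _ hι δ A o t p hA hδ hp hnull hW f M hf a ha hQ
    have hQ' : ∀ n ≤ max (m + 1) (box.sup fun W' => k W' (2 * m)), hostKraPow μ T n (f o) = 0 :=
      fun n hn => hostKraPow_eq_zero_of_le hT (hf o) hn hQ
    rcases hp.le.eq_or_lt with ht | ht
    · exact hp.smallCorrelations_of_eq hτ hT hTτ hA ht hf ha
        (hQ' _ ((Nat.succ_le_succ hι).trans (le_max_left _ _)))
    obtain ⟨z, s₀, t', hs₀, hz, hdeep, hnice⟩ := hp.exists_vdcFamily hA hδ ht hnull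
    obtain ⟨h₀, hh₀⟩ := eventually_atTop.1 hnice
    refine SmallCorrelations.of_differences hτ hf z (h₀ := h₀) fun h hh => ?_
    have hnice' := hh₀ h hh
    have hf' : ∀ J, BddMeas M (Sum.elim f (fun j x => conj (f j x)) J) := by
      rintro (j | j)
      · exact hf j
      · exact (hf j).conj
    have ha' : ∀ J i, ∃ B : ℝ, ∀ n, |((Sum.elim (fun j n => a j (n + h) - a z n)
        (fun j n => a j n - a z n) J n i : ℤ) : ℝ) - polyShift (vdcFamily p z h J i) (A i) n| ≤ B := by
      rintro (j | j) i <;> obtain ⟨B, hB⟩ := ha j i <;> obtain ⟨B', hB'⟩ := ha z i <;>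
        refine ⟨B + B', fun n => ?_⟩
      · have h1 := abs_sub _ _ |>.trans (add_le_add (hB (n + h)) (hB' n))
        refine le_trans (le_of_eq ?_) h1
        simp only [vdcFamily, Sum.elim_inl, polyShift_sub, polyShift_X_pow_mul, Pi.sub_apply]
        push_cast
        congr 1
        ring
      · have h1 := abs_sub _ _ |>.trans (add_le_add (hB n) (hB' n))
        refine le_trans (le_of_eq ?_) h1
        simp only [vdcFamily, Sum.elim_inr, polyShift_sub, Pi.sub_apply]
        push_cast
        congr 1
        ring
    set q := fun J => vdcFamily p z h J ∉ orderFiltration δ D (ℓ * D) with hq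
    refine SmallCorrelations.of_subtype hτ hf' q (fun J hJ i => ?_) ?_
    · obtain ⟨B, hB⟩ := ha' J i
      obtain ⟨B', hB'⟩ := exists_bound_of_tendsto ((hA i).tendsto_polyShift_zero
        ((mem_orderFiltration_last_iff hδ).1 (not_not.1 hJ) i))
      refine ⟨B + B', fun n => ?_⟩
      have h1 := (abs_add_le _ _).trans (add_le_add (hB n) (hB' n))
      rwa [sub_add_cancel] at h1
    set W' := familyWeight δ D (vdcFamily p z h ∘ (Subtype.val : {J // q J} → ι ⊕ ι)) with hW'
    have hlt : W' < W := hW ▸ familyWeight_vdcFamily_lt hs₀ hz hdeep h _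
    have hcard : Fintype.card {J // q J} ≤ 2 * m := by
      refine (Fintype.card_subtype_le _).trans ?_
      rw [Fintype.card_sum]
      omega
    have hbox' : W' ∈ box := by
      refine Finset.mem_map.2 ⟨ofLex W', Fintype.mem_piFinset.2 fun s => Finset.mem_range.2 ?_, rfl⟩
      exact Nat.lt_succ_of_le ((ncard_levelClasses_le _).trans hcard)
    exact hk W' hlt (2 * m) μ hτ hT hTτ hcard hA hδ
      (hnice'.comp (o' := ⟨Sum.inl o, hnice'.not_mem_last hδ⟩) Subtype.val_injective rfl)
      (fun J => J.2) rfl (fun J => hf' J) (fun J => ha' J)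
      (hQ' _ ((Finset.le_sup (f := fun W' => k W' (2 * m)) hbox').trans (le_max_right _ _)))

end

/-! ### Sampling functions of class `𝓣` -/

theorem hasDerivAt_iteratedDeriv {n : ℕ∞ω} {g : ℝ → ℝ} {x₀ x : ℝ}
    (hg : ContDiffOn ℝ n g (Set.Ici x₀)) (hx : x₀ < x) {j : ℕ} (hj : (j : ℕ∞ω) < n) :
    HasDerivAt (iteratedDeriv j g) (iteratedDeriv (j + 1) g x) x := by
  have h1 : ContDiffWithinAt ℝ n g Set.univ x := (hg.contDiffAt (Ici_mem_nhds hx))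
  have h2 := h1.differentiableWithinAt_iteratedDerivWithin hj (by simp)
  rw [iteratedDerivWithin_univ, differentiableWithinAt_univ] at h2
  rw [iteratedDeriv_succ]
  exact h2.hasDerivAt

/-- The mean value theorem on a half-line. -/
theorem exists_sub_eq_mul_sub {f f' : ℝ → ℝ} {x₀ : ℝ} (h : ∀ x > x₀, HasDerivAt f (f' x) x)
    {a b : ℝ} (ha : x₀ < a) (hab : a ≤ b) : ∃ c ∈ Set.Icc a b, f b - f a = f' c * (b - a) := by
  rcases hab.eq_or_lt with rfl | hab
  · exact ⟨a, by simp, by simp⟩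
  · obtain ⟨c, hc, h1⟩ := exists_hasDerivAt_eq_slope f f' hab
      (fun x hx => (h x (ha.trans_le hx.1)).continuousAt.continuousWithinAt)
      fun x hx => h x (ha.trans hx.1)
    exact ⟨c, Set.Ioo_subset_Icc_self hc, by rw [h1, div_mul_cancel₀ _ (sub_ne_zero.2 hab.ne')]⟩

/-- The iterated difference of a sampled function is a value of its derivative. -/
theorem exists_diffSeq_eq {x₀ : ℝ} (r : ℕ) {D : ℕ → ℝ → ℝ}
    (h : ∀ j < r, ∀ x > x₀, HasDerivAt (D j) (D (j + 1) x) x) {n : ℕ} (hn : x₀ < n) :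
    ∃ ξ ∈ Set.Icc (n : ℝ) (n + r), diffSeq r (fun k => D 0 k) n = D r ξ := by
  induction r generalizing D with
  | zero => exact ⟨n, by simp, by rw [diffSeq_zero]⟩
  | succ r ih =>
    have h1 : ∀ j < r, ∀ x > x₀, HasDerivAt (fun x => D j (x + 1) - D j x)
        (D (j + 1) (x + 1) - D (j + 1) x) x := fun j hj x hx =>
      ((h j (by omega) (x + 1) (by linarith)).comp_add_const x 1).sub (h j (by omega) x hx)
    -- The induction is applied to the forward differences of all D j; the mean value theorem on [ξ,
    -- ξ + 1] then gives the last derivative.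
    obtain ⟨ξ, hξ, h2⟩ := ih (D := fun j x => D j (x + 1) - D j x) h1
    obtain ⟨ζ, hζ, h3⟩ := exists_sub_eq_mul_sub (h r (by omega)) (hn.trans_le hξ.1)
      (by linarith : ξ ≤ ξ + 1)
    refine ⟨ζ, ⟨hξ.1.trans hζ.1, ?_⟩, ?_⟩
    · have := hζ.2.trans (add_le_add_left hξ.2 1)
      push_cast
      linarith
    · have h4 : diffSeq 1 (fun k : ℕ => D 0 k) = fun k : ℕ => D 0 (k + 1 : ℝ) - D 0 k := by
        funext k
        rw [diffSeq_succ, diffSeq_zero]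
        push_cast
        rfl
      rw [diffSeq_add, h4, h2, h3]
      ring

/-! ### Functions with convergent logarithmic derivative -/

section

variable {f f' : ℝ → ℝ} {x₀ β : ℝ}

/-- A convergent function whose derivative is asymptotic to `c / x` has `c = 0`. -/
theorem eq_zero_of_tendsto_mul_deriv {c : ℝ} (h : ∀ x > x₀, HasDerivAt f (f' x) x)
    (hf : Tendsto f atTop (𝓝 β)) (hc : Tendsto (fun x => x * f' x) atTop (𝓝 c)) : c = 0 := by
  by_contra hne
  have h1 : Tendsto (fun x : ℝ => f (2 * x) - f x) atTop (𝓝 0) := by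
    rw [← sub_self β]
    exact (hf.comp (tendsto_id.const_mul_atTop two_pos)).sub hf
  have h2 := (hc.abs.eventually_const_lt (half_lt_self (abs_pos.2 hne)))
  obtain ⟨x₁, hx₁⟩ := eventually_atTop.1 h2
  have h3 := h1.abs.eventually_lt_const (by simpa using hne : |(0 : ℝ)| < |c| / 4)
  obtain ⟨x, hx, hxx₀, hxx₁, hx0⟩ := (h3.and ((eventually_gt_atTop x₀).and
    ((eventually_ge_atTop x₁).and (eventually_gt_atTop 0)))).exists
  -- The increment over [x, 2x] is x·f'(ζ) with ζ ≤ 2x, so its size is at least |c|/4 although it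
  -- tends to 0.
  obtain ⟨ζ, hζ, h4⟩ := exists_sub_eq_mul_sub h hxx₀ (by linarith : x ≤ 2 * x)
  have h5 := hx₁ ζ (hxx₁.trans hζ.1)
  rw [h4, show 2 * x - x = x by ring, abs_mul, abs_of_pos hx0] at hx
  rw [abs_mul, abs_of_pos (hx0.trans_le hζ.1)] at h5
  nlinarith [abs_nonneg (f' ζ), hζ.2]

theorem exists_abs_le_of_tendsto {φ : ℝ → ℝ} (h : Tendsto φ atTop (𝓝 β)) :
    ∀ᶠ x in atTop, |φ x| ≤ |β| + 1 := by
  filter_upwards [h.abs.eventually_lt_const (lt_add_one |β|)] with x hx using hx.le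

/-- Eventually (log |f|)' ≥ (β/2)/x, so log |f| grows at least like (β/2) log x. -/
theorem tendsto_abs_atTop_of_logDeriv (h : ∀ x > x₀, HasDerivAt f (f' x) x)
    (h0 : ∀ᶠ x in atTop, f x ≠ 0) (hβ : 0 < β)
    (hf : Tendsto (fun x => x * f' x / f x) atTop (𝓝 β)) :
    Tendsto (fun x => |f x|) atTop atTop := by
  obtain ⟨x₁, hx₁⟩ := eventually_atTop.1 (h0.and ((hf.eventually_const_lt (half_lt_self hβ)).and
    ((eventually_gt_atTop 0).and (eventually_gt_atTop x₀))))
  have hd : ∀ x > x₁, HasDerivAt (fun x => Real.log (f x) - β / 2 * Real.log x)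
      (f' x / f x - β / 2 * x⁻¹) x := fun x hx => by
    obtain ⟨h1, -, h3, h4⟩ := hx₁ x hx.le
    exact ((h x h4).log h1).sub ((Real.hasDerivAt_log h3.ne').const_mul _)
  have h2 : ∀ x ≥ x₁ + 1, Real.log (f (x₁ + 1)) - β / 2 * Real.log (x₁ + 1) +
      β / 2 * Real.log x ≤ Real.log (f x) := fun x hx => by
    obtain ⟨ζ, hζ, h3⟩ := exists_sub_eq_mul_sub hd (lt_add_one x₁) hx
    obtain ⟨h1, h4, h5, -⟩ := hx₁ ζ (by linarith [hζ.1])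
    have h6 : 0 ≤ f' ζ / f ζ - β / 2 * ζ⁻¹ := by
      have : f' ζ / f ζ - β / 2 * ζ⁻¹ = (ζ * f' ζ / f ζ - β / 2) * ζ⁻¹ := by
        field_simp
      rw [this]
      exact mul_nonneg (by linarith) (inv_nonneg.2 h5.le)
    have h7 := mul_nonneg h6 (sub_nonneg.2 hx)
    rw [← h3] at h7
    linarith
  have h3 : Tendsto (fun x => Real.log (f x)) atTop atTop := by
    refine tendsto_atTop_mono' _ ?_ (tendsto_atTop_add_const_left _
      (Real.log (f (x₁ + 1)) - β / 2 * Real.log (x₁ + 1))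
      (Real.tendsto_log_atTop.const_mul_atTop (half_pos hβ)))
    filter_upwards [eventually_ge_atTop (x₁ + 1)] with x hx using h2 x hx
  refine (Real.tendsto_exp_atTop.comp h3).congr' ?_
  filter_upwards [h0] with x hx
  exact Real.exp_log_eq_abs hx

/-- A function with bounded `x f' / f` varies little over bounded distances. -/
theorem eventually_abs_le_two_mul (h : ∀ x > x₀, HasDerivAt f (f' x) x)
    (h0 : ∀ᶠ x in atTop, f x ≠ 0) (hf : Tendsto (fun x => x * f' x / f x) atTop (𝓝 β)) (r : ℝ) :
    ∀ᶠ x in atTop, ∀ ξ ∈ Set.Icc x (x + r), |f ξ| ≤ 2 * |f x| ∧ |f x| ≤ 2 * |f ξ| := by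
  obtain ⟨x₁, hx₁⟩ := eventually_atTop.1 (h0.and ((exists_abs_le_of_tendsto hf).and
    ((eventually_gt_atTop 0).and (eventually_gt_atTop x₀))))
  have hd : ∀ x > x₁, HasDerivAt (fun x => Real.log (f x)) (f' x / f x) x := fun x hx => by
    obtain ⟨h1, -, -, h4⟩ := hx₁ x hx.le
    exact (h x h4).log h1
  have hl : 0 < Real.log 2 := Real.log_pos one_lt_two
  filter_upwards [eventually_gt_atTop x₁, eventually_ge_atTop ((|β| + 1) * r / Real.log 2)]
    with x hx hxr ξ hξ
  obtain ⟨ζ, hζ, h3⟩ := exists_sub_eq_mul_sub hd hx hξ.1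
  obtain ⟨-, h4, h5, -⟩ := hx₁ ζ (by linarith [hζ.1])
  have hx0 : 0 < x := (hx₁ x hx.le).2.2.1
  rw [div_le_iff₀ hl] at hxr
  have h6 : |Real.log (f ξ) - Real.log (f x)| ≤ Real.log 2 := by
    have e : f' ζ / f ζ * (ξ - x) = ζ * f' ζ / f ζ * ((ξ - x) / ζ) := by field_simp
    have h7 : 0 ≤ (ξ - x) / ζ := div_nonneg (by linarith [hξ.1]) h5.le
    rw [h3, e, abs_mul, abs_of_nonneg h7]
    refine (mul_le_mul_of_nonneg_right h4 h7).trans ?_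
    rw [← mul_div_assoc, div_le_iff₀ h5]
    have h8 : (|β| + 1) * (ξ - x) ≤ (|β| + 1) * r := by
      gcongr
      linarith [hξ.2]
    nlinarith [hζ.1]
  rw [abs_le] at h6
  have h1 := (hx₁ x hx.le).1
  have h2 := (hx₁ ξ (hx.le.trans hξ.1)).1
  have e1 := Real.exp_log_eq_abs h1
  have e2 := Real.exp_log_eq_abs h2
  rw [← e1, ← e2, ← Real.exp_log two_pos, ← Real.exp_add, ← Real.exp_add, Real.exp_le_exp,
    Real.exp_le_exp]
  constructor <;> linarith

end

/-! ### Samples of functions of class 𝓡 and 𝓣, and of tempered functions -/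

section

variable {g : ℝ → ℝ}

theorem exists_hasDerivAt_of_mem_classR (hg : g ∈ ClassR) :
    ∃ x₀ : ℝ, ∀ j, ∀ x > x₀, HasDerivAt (iteratedDeriv j g) (iteratedDeriv (j + 1) g x) x := by
  obtain ⟨⟨x₀, -, h⟩, -⟩ := hg
  exact ⟨x₀, fun j x hx => hasDerivAt_iteratedDeriv h hx (by exact_mod_cast ENat.natCast_lt_top j)⟩

/-- The exponents of the derivatives drop by one at each step, as long as they are nonzero. -/
theorem tendsto_logDeriv_succ (hg : g ∈ ClassR) {j : ℕ} {β : ℝ}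
    (hβ : Tendsto (fun x => x * iteratedDeriv (j + 1) g x / iteratedDeriv j g x) atTop (𝓝 β))
    (hβ0 : β ≠ 0) : Tendsto (fun x => x * iteratedDeriv (j + 2) g x / iteratedDeriv (j + 1) g x)
      atTop (𝓝 (β - 1)) := by
  obtain ⟨x₀, hd⟩ := exists_hasDerivAt_of_mem_classR hg
  obtain ⟨h0, -⟩ := hg.2 j
  obtain ⟨h0', β', hβ'⟩ := hg.2 (j + 1)
  obtain ⟨x₁, hx₁⟩ := eventually_atTop.1 (h0.and (eventually_gt_atTop x₀))
  have h1 : ∀ x > x₁, HasDerivAt (fun x => x * iteratedDeriv (j + 1) g x / iteratedDeriv j g x)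
      (((1 * iteratedDeriv (j + 1) g x + x * iteratedDeriv (j + 2) g x) * iteratedDeriv j g x -
        x * iteratedDeriv (j + 1) g x * iteratedDeriv (j + 1) g x) / iteratedDeriv j g x ^ 2) x :=
    fun x hx => by
      obtain ⟨h2, h3⟩ := hx₁ x hx.le
      exact ((hasDerivAt_id x).mul (hd (j + 1) x h3)).div (hd j x h3) h2
  -- The quotient converges to β, and x times its derivative converges to β(1 + β' - β), which must
  -- therefore vanish.
  have h2 : Tendsto (fun x => x * (((1 * iteratedDeriv (j + 1) g x +
      x * iteratedDeriv (j + 2) g x) * iteratedDeriv j g x -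
        x * iteratedDeriv (j + 1) g x * iteratedDeriv (j + 1) g x) / iteratedDeriv j g x ^ 2))
      atTop (𝓝 (β + β * β' - β * β)) := by
    refine ((hβ.add (hβ.mul hβ')).sub (hβ.mul hβ)).congr' ?_
    filter_upwards [h0, h0'] with x hx hx'
    field_simp
  have h3 := eq_zero_of_tendsto_mul_deriv h1 hβ h2
  have h4 : β * (1 + β' - β) = 0 := by linarith
  have h5 := (mul_eq_zero.1 h4).resolve_left hβ0
  rwa [show β - 1 = β' by linarith]

/-- The exponent of the j-th derivative is α - j, positive because j ≤ i < α. -/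
theorem tendsto_logDeriv_of_mem_classTi {i : ℕ} (hg : g ∈ ClassTi i) {j : ℕ} (hj : j ≤ i) :
    ∃ β : ℝ, 0 < β ∧
      Tendsto (fun x => x * iteratedDeriv (j + 1) g x / iteratedDeriv j g x) atTop (𝓝 β) := by
  obtain ⟨hR, ⟨α, hα, -, hlim⟩, -⟩ := hg
  suffices Tendsto (fun x => x * iteratedDeriv (j + 1) g x / iteratedDeriv j g x) atTop
      (𝓝 (α - j)) from
    ⟨α - j, by have : (j : ℝ) ≤ i := by exact_mod_cast hj
               linarith, this⟩
  induction j with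
  | zero => simpa [iteratedDeriv_one] using hlim
  | succ j ih =>
    have h1 : (j : ℝ) + 1 ≤ i := by exact_mod_cast hj
    have := tendsto_logDeriv_succ hR (ih (by omega)) (by linarith)
    rwa [sub_sub, ← Nat.cast_succ] at this

/-- The iterated differences of a sampled function of class `𝓡` have the order of magnitude of the
derivatives. -/
theorem diffSeq_isTheta_of_mem_classR (hg : g ∈ ClassR) (r : ℕ) :
    diffSeq r (fun n => g n) =Θ[atTop] fun n : ℕ => iteratedDeriv r g n := by
  obtain ⟨x₀, hd⟩ := exists_hasDerivAt_of_mem_classR hg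
  obtain ⟨h0, β, hβ⟩ := hg.2 r
  have h1 := tendsto_natCast_atTop_atTop.eventually (eventually_abs_le_two_mul (hd r) h0 hβ r)
  have h2 := tendsto_natCast_atTop_atTop.eventually (eventually_gt_atTop x₀)
  have h3 : ∀ᶠ n : ℕ in atTop, |diffSeq r (fun n => g n) n| ≤ 2 * |iteratedDeriv r g n| ∧
      |iteratedDeriv r g n| ≤ 2 * |diffSeq r (fun n => g n) n| := by
    filter_upwards [h1, h2] with n hn hn'
    obtain ⟨ξ, hξ, h4⟩ := exists_diffSeq_eq r (D := fun j => iteratedDeriv j g)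
      (fun j _ => hd j) hn'
    simp only [iteratedDeriv_zero] at h4
    rw [h4]
    exact hn ξ hξ
  exact ⟨IsBigO.of_bound 2 (h3.mono fun n hn => hn.1), IsBigO.of_bound 2 (h3.mono fun n hn => hn.2)⟩

theorem eventually_pos_or_neg_of_ne_zero {f : ℝ → ℝ} {x₀ : ℝ} (hf : ContinuousOn f (Set.Ioi x₀))
    (h0 : ∀ᶠ x in atTop, f x ≠ 0) :
    (∀ᶠ x in atTop, 0 < f x) ∨ ∀ᶠ x in atTop, f x < 0 := by
  obtain ⟨x₁, hx₁⟩ := eventually_atTop.1 (h0.and (eventually_gt_atTop x₀))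
  by_contra! h
  obtain ⟨a, ha, ha'⟩ := frequently_atTop.1 h.1 x₁
  obtain ⟨b, hb, hb'⟩ := frequently_atTop.1 h.2 x₁
  obtain ⟨c, hc, hc'⟩ := isPreconnected_Ici.intermediate_value (s := Set.Ici x₁) ha hb
    (hf.mono fun x hx => (hx₁ x hx).2) ⟨ha', hb'⟩
  exact (hx₁ c hc).1 hc'

theorem diffSeq_eventually_pos_or_neg (hg : g ∈ ClassR) (r : ℕ) :
    (∀ᶠ n in atTop, 0 < diffSeq r (fun n => g n) n) ∨
      ∀ᶠ n in atTop, diffSeq r (fun n => g n) n < 0 := by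
  obtain ⟨x₀, hd⟩ := exists_hasDerivAt_of_mem_classR hg
  have h2 := tendsto_natCast_atTop_atTop.eventually (eventually_gt_atTop x₀)
  have key : ∀ P : ℝ → Prop, (∀ᶠ x in atTop, P (iteratedDeriv r g x)) →
      ∀ᶠ n in atTop, P (diffSeq r (fun n => g n) n) := fun P hP => by
    filter_upwards [h2, tendsto_natCast_atTop_atTop.eventually (eventually_forall_ge_atTop.2 hP)]
      with n hn hn'
    obtain ⟨ξ, hξ, h4⟩ := exists_diffSeq_eq r (D := fun j => iteratedDeriv j g)
      (fun j _ => hd j) hn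
    simp only [iteratedDeriv_zero] at h4
    rw [h4]
    exact hn' ξ hξ.1
  exact (eventually_pos_or_neg_of_ne_zero
    (fun x hx => (hd r x hx).continuousAt.continuousWithinAt) (hg.2 r).1).imp
    (key fun y => 0 < y) (key fun y => y < 0)

theorem not_tendsto_zero_of_increasing {b : ℕ → ℝ} (h0 : ∀ᶠ n in atTop, 0 < b n)
    (h1 : ∀ᶠ n in atTop, 0 < b (n + 1) - b n) : ¬ Tendsto b atTop (𝓝 0) := by
  intro h
  obtain ⟨N, hN⟩ := eventually_atTop.1 (h0.and h1)
  have h2 : ∀ n ≥ N, b N ≤ b n := fun n hn => by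
    induction n, hn using Nat.le_induction with
    | base => exact le_rfl
    | succ n hn ih => linarith [(hN n hn).2]
  exact absurd (ge_of_tendsto h (eventually_atTop.2 ⟨N, h2⟩)) (not_le.2 (hN N le_rfl).1)

/-- Differences inherit their size from derivatives with positive exponents. Monotonicity comes from
the eventual signs of the differences of order i + 1 and i + 2: equal signs would contradict
convergence to zero. -/
theorem isTemperedSeq_of_mem_classTi {i : ℕ} (hg : g ∈ ClassTi i) :
    IsTemperedSeq i fun n => g n := by
  have hR : g ∈ ClassR := hg.1
  obtain ⟨x₀, hd⟩ := exists_hasDerivAt_of_mem_classR hR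
  have hθ := diffSeq_isTheta_of_mem_classR hR
  have hn0 : ∀ j, ∀ᶠ n : ℕ in atTop, iteratedDeriv j g n ≠ 0 := fun j =>
    tendsto_natCast_atTop_atTop.eventually (hR.2 j).1
  have hzero : Tendsto (diffSeq (i + 1) fun n => g n) atTop (𝓝 0) :=
    (hθ (i + 1)).1.trans_tendsto (hg.2.2.comp tendsto_natCast_atTop_atTop)
  refine ⟨fun r hr => ?_, fun r hr => ?_, fun r hr => ?_, hzero, ?_⟩
  · obtain ⟨β, -, hβ⟩ := tendsto_logDeriv_of_mem_classTi hg hr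
    have h1 : (fun n : ℕ => (n : ℝ) * iteratedDeriv (r + 1) g n) =O[atTop]
        fun n : ℕ => iteratedDeriv r g n := by
      refine isBigO_of_div_tendsto_nhds ?_ β (hβ.comp tendsto_natCast_atTop_atTop)
      filter_upwards [hn0 r] with n hn h
      exact absurd h hn
    exact (((isBigO_refl (fun n : ℕ => (n : ℝ)) atTop).mul (hθ (r + 1)).1).trans h1).trans (hθ r).2
  · obtain ⟨β, hβ0, hβ⟩ := tendsto_logDeriv_of_mem_classTi hg hr
    have h1 : (fun n : ℕ => iteratedDeriv r g n) =O[atTop]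
        fun n : ℕ => (n : ℝ) * iteratedDeriv (r + 1) g n := by
      have h2 := (hβ.comp tendsto_natCast_atTop_atTop).inv₀ hβ0.ne'
      refine isBigO_of_div_tendsto_nhds ?_ β⁻¹ (h2.congr fun n => by simp)
      filter_upwards [hn0 (r + 1), eventually_gt_atTop 0] with n hn hn' h
      have : (n : ℝ) ≠ 0 := by exact_mod_cast hn'.ne'
      exact absurd h (mul_ne_zero this hn)
    exact ((hθ r).1.trans h1).trans ((isBigO_refl (fun n : ℕ => (n : ℝ)) atTop).mul (hθ (r + 1)).2)
  · obtain ⟨β, hβ0, hβ⟩ := tendsto_logDeriv_of_mem_classTi hg hr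
    have h1 := (tendsto_abs_atTop_of_logDeriv (hd r) (hR.2 r).1 hβ0 hβ).comp
      (tendsto_natCast_atTop_atTop (R := ℝ))
    have h2 : (fun _ : ℕ => (1 : ℝ)) =o[atTop] fun n : ℕ => iteratedDeriv r g n :=
      isLittleO_const_left.2 (Or.inr h1)
    exact (isLittleO_const_left.1 (h2.trans_isBigO (hθ r).2)).resolve_left one_ne_zero
  · have hs := diffSeq_eventually_pos_or_neg hR (i + 2)
    rcases diffSeq_eventually_pos_or_neg hR (i + 1) with h1 | h1
    · left
      rcases hs with h2 | h2
      · simp only [diffSeq_succ (i + 1)] at h2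
        exact absurd hzero (not_tendsto_zero_of_increasing h1 h2)
      · filter_upwards [h1, h2] with n hn hn'
        rw [diffSeq_succ] at hn'
        exact ⟨hn, by linarith⟩
    · right
      rcases hs with h2 | h2
      · filter_upwards [h1, h2] with n hn hn'
        rw [diffSeq_succ] at hn'
        exact ⟨hn, by linarith⟩
      · simp only [diffSeq_succ (i + 1)] at h2
        refine absurd (neg_zero (G := ℝ) ▸ hzero.neg) (not_tendsto_zero_of_increasing
          (h1.mono fun n hn => neg_pos.2 hn) (h2.mono fun n hn => ?_))
        linarith

theorem tendsto_diffSeq_of_isTempered {d : ℕ} (hg : IsTempered d g) :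
    Tendsto (diffSeq (d + 1) fun n => g n) atTop (𝓝 0) := by
  obtain ⟨x₀, -, hc, -, hz, -⟩ := hg
  have hd : ∀ j < d + 1, ∀ x > x₀, HasDerivAt (iteratedDeriv j g) (iteratedDeriv (j + 1) g x) x :=
    fun j hj x hx => hasDerivAt_iteratedDeriv hc hx (by exact_mod_cast hj)
  rw [Metric.tendsto_atTop'] at hz ⊢
  intro ε hε
  obtain ⟨x₁, hx₁⟩ := hz ε hε
  obtain ⟨N, hN⟩ := exists_nat_gt (max x₀ x₁)
  refine ⟨N, fun n hn => ?_⟩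
  have hn' : (N : ℝ) < n := by exact_mod_cast hn
  obtain ⟨ξ, hξ, h1⟩ := exists_diffSeq_eq (d + 1) (D := fun j => iteratedDeriv j g) hd
    ((le_max_left _ _).trans_lt (hN.trans hn'))
  simp only [iteratedDeriv_zero] at h1
  rw [h1]
  exact hx₁ ξ (((le_max_right _ _).trans_lt (hN.trans hn')).trans_le hξ.1)

/-- If Δᵈg tended to zero, so would its increment from n to 2n. This increment is n·g^{(d+1)}(ζ)
with n ≤ ζ ≤ (d + 2)n, and ζ|g^{(d+1)}(ζ)| ≥ d + 2 makes it at least 1 in size. -/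
theorem not_tendsto_diffSeq_of_isTempered {d : ℕ} (hg : IsTempered d g) :
    ¬ Tendsto (diffSeq d fun n => g n) atTop (𝓝 0) := by
  intro hzero
  obtain ⟨x₀, -, hc, -, -, hinf⟩ := hg
  have hd : ∀ j < d + 1, ∀ x > x₀, HasDerivAt (iteratedDeriv j g) (iteratedDeriv (j + 1) g x) x :=
    fun j hj x hx => hasDerivAt_iteratedDeriv hc hx (by exact_mod_cast hj)
  obtain ⟨x₁, hx₁⟩ := eventually_atTop.1 (hinf.eventually_ge_atTop (d + 2))
  have hb := hzero.abs
  rw [abs_zero] at hb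
  obtain ⟨N, hN⟩ := eventually_atTop.1 (hb.eventually_lt_const (by norm_num : (0 : ℝ) < 1 / 2))
  obtain ⟨n', hn'⟩ := exists_nat_gt (max x₀ x₁)
  set n := max N n' + 1 with hn
  have hn0 : (1 : ℝ) ≤ n := by exact_mod_cast Nat.le_add_left 1 _
  have hnN : N ≤ n := by omega
  have hnn : max x₀ x₁ < (n : ℝ) := hn'.trans_le (by exact_mod_cast (by omega : n' ≤ n))
  have hshift : ∀ j < d, ∀ x > x₀, HasDerivAt
      (fun x => iteratedDeriv j g (x + n) - iteratedDeriv j g x)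
      (iteratedDeriv (j + 1) g (x + n) - iteratedDeriv (j + 1) g x) x := fun j hj x hx =>
    ((hd j (by omega) (x + n) (by linarith)).comp_add_const x n).sub (hd j (by omega) x hx)
  obtain ⟨ξ, hξ, h1⟩ := exists_diffSeq_eq d
    (D := fun j x => iteratedDeriv j g (x + n) - iteratedDeriv j g x) hshift
    ((le_max_left _ _).trans_lt hnn)
  obtain ⟨ζ, hζ, h2⟩ := exists_sub_eq_mul_sub (hd d (by omega))
    (((le_max_left _ _).trans_lt hnn).trans_le hξ.1) (by linarith : ξ ≤ ξ + n)
  have h3 : diffSeq d (fun k : ℕ => iteratedDeriv 0 g (k + n) - iteratedDeriv 0 g k) n =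
      diffSeq d (fun n => g n) (n + n) - diffSeq d (fun n => g n) n := by
    have e : (fun k : ℕ => iteratedDeriv 0 g (k + n) - iteratedDeriv 0 g k) =
        polyShift (Polynomial.X ^ n - 1) fun k => g k := by
      rw [polyShift_sub, polyShift_X_pow, polyShift_one]
      funext k
      simp
    rw [e, diffSeq, ← polyShift_mul, mul_comm, sub_mul, one_mul, polyShift_sub, polyShift_mul,
      polyShift_X_pow]
    rfl
  rw [h3, h2] at h1
  have h4 := hx₁ ζ (((le_max_right _ _).trans hnn.le).trans (hξ.1.trans hζ.1))
  have h5 : 1 ≤ |iteratedDeriv (d + 1) g ζ * (ξ + n - ξ)| := by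
    rw [add_sub_cancel_left, abs_mul, Nat.abs_cast]
    have h6 : ζ ≤ (d + 2) * n := by
      have : (d : ℝ) * 1 ≤ d * n := by gcongr
      linarith [hζ.2, hξ.2]
    have h7 : ((d : ℝ) + 2) ≤ (d + 2) * n * |iteratedDeriv (d + 1) g ζ| :=
      h4.trans (by gcongr)
    have h8 : (0 : ℝ) < d + 2 := by positivity
    nlinarith
  rw [← h1] at h5
  have h6 := hN (n + n) (by omega)
  have h7 := hN n hnN
  have h8 := abs_sub (diffSeq d (fun n => g n) (n + n)) (diffSeq d (fun n => g n) n)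
  linarith

end

/-! ### From nice families of functions to nice families of polynomials -/

section

open Polynomial

theorem polyShift_sum {ι : Type*} (s : Finset ι) (q : ι → ℤ[X]) (a : ℕ → ℝ) (n : ℕ) :
    polyShift (∑ i ∈ s, q i) a n = ∑ i ∈ s, polyShift (q i) a n := by
  classical
  induction s using Finset.induction_on with
  | empty => simp [polyShift_zero]
  | insert i s hi ih => rw [Finset.sum_insert hi, Finset.sum_insert hi, polyShift_add, Pi.add_apply, ih]

theorem exists_polyShift_of_mem_shiftComb {g φ : ℝ → ℝ} (h : φ ∈ ShiftComb g) :
    ∃ q : ℤ[X], (fun n : ℕ => φ n) =ᶠ[atTop] polyShift q fun n => g n := by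
  obtain ⟨r, k, s, h⟩ := h
  refine ⟨∑ i, Polynomial.C (k i) * X ^ s i, ?_⟩
  filter_upwards [tendsto_natCast_atTop_atTop.eventually h] with n hn
  rw [hn, polyShift_sum]
  refine Finset.sum_congr rfl fun i _ => ?_
  rw [polyShift_mul, polyShift_C, polyShift_X_pow]
  push_cast
  rfl

/-- The order at `1` of a polynomial which turns a tempered sequence into one of degree `d`. -/
theorem IsTemperedSeq.exists_order_eq {δ d : ℕ} {a : ℕ → ℝ} (ha : IsTemperedSeq δ a) {q : ℤ[X]}
    (h0 : ¬ Tendsto (diffSeq d (polyShift q a)) atTop (𝓝 0))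
    (h1 : Tendsto (diffSeq (d + 1) (polyShift q a)) atTop (𝓝 0)) :
    ∃ u : ℤ[X], q = (X - 1) ^ (δ - d) * u ∧ u.eval 1 ≠ 0 ∧ d ≤ δ := by
  have e : ∀ r, diffSeq r (polyShift q a) = polyShift ((X - 1) ^ r * q) a := fun r => by
    rw [diffSeq, ← polyShift_mul]
  rw [e] at h0 h1
  obtain ⟨r, hr, u, hu, hu1⟩ := (X_sub_one_pow_dvd_or q (δ + 1)).resolve_left fun h =>
    h0 (ha.tendsto_polyShift_zero (h.mul_left _))
  have h2 : d + r ≤ δ := by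
    by_contra hlt
    refine h0 (ha.tendsto_polyShift_zero ?_)
    rw [hu, ← mul_assoc, ← pow_add]
    exact (pow_dvd_pow _ (by omega)).mul_right _
  have h3 : ¬ d + 1 + r ≤ δ := fun hle => by
    rw [hu, ← mul_assoc, ← pow_add] at h1
    exact isLittleO_irrefl (ha.eventually_ne_zero hle).frequently
      ((ha.isBigO_polyShift hle hu1).trans_isLittleO (ha.isLittleO_of_tendsto_zero hle h1))
  exact ⟨u, by rw [show δ - d = r by omega]; exact hu, hu1, by omega⟩

/-- A polynomial that turns a tempered sequence into one dominated by a sequence of degree `d`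
vanishes at `1` to the order that lowers the degree to `d`. -/
theorem IsTemperedSeq.dvd_of_isLittleO {δ δ' d : ℕ} {a b : ℕ → ℝ} (ha : IsTemperedSeq δ a)
    (hb : IsTemperedSeq δ' b) (hd : d ≤ δ') {q : ℤ[X]}
    (h : polyShift q a =o[atTop] diffSeq (δ' - d) b) : (X - 1) ^ (δ - d) ∣ q := by
  rcases X_sub_one_pow_dvd_or q (δ - d) with h1 | ⟨s, hs, v, hv, hv1⟩
  · exact h1
  exfalso
  -- Domination survives d + 1 differences as long as the left side is not annihilated. At the end
  -- the right side tends to zero, whereas an order s < δ - d leaves the left side unbounded.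
  have key : ∀ k ≤ d + 1, polyShift ((X - 1) ^ k * q) a =o[atTop] diffSeq (δ' - d + k) b := by
    intro k hk
    induction k with
    | zero => simpa using h
    | succ k ih =>
      have hnd : ¬ (X - 1) ^ (δ + 1) ∣ (X - 1) ^ k * q := by
        rw [hv, ← mul_assoc, ← pow_add, X_sub_one_pow_dvd_mul_iff hv1]
        omega
      have := ha.polyShift_diff_isLittleO_of_not_dvd hb (t := δ' - d + k) (by omega) hnd dvd_rfl
        (ih (by omega))
      rwa [← mul_assoc, ← pow_succ'] at this
  have h2 := key (d + 1) le_rfl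
  rw [show δ' - d + (d + 1) = δ' + 1 by omega] at h2
  have h3 := h2.trans_tendsto hb.tendsto_zero
  have hle : d + 1 + s ≤ δ := by omega
  rw [hv, ← mul_assoc, ← pow_add] at h3
  exact isLittleO_irrefl (ha.eventually_ne_zero hle).frequently
    ((ha.isBigO_polyShift hle hv1).trans_isLittleO (ha.isLittleO_of_tendsto_zero hle h3))

/-- Temperedness of degree d fixes the order of the leading polynomial at δ' 0 - d. Domination
forces order at least δ' i - d in every row i, so this power of X - 1 is moved into the sequence.
Rows with δ' i ≤ d are left alone by the truncated subtraction. All degrees become at most d, and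
the family starts with t = 0. -/
theorem IsNice.exists_isNiceFamily {ℓ m d : ℕ} [NeZero ℓ] [NeZero m] {g : Fin ℓ → Fin m → ℝ → ℝ}
    (hg : IsNice g) (hd : IsTempered d (g 0 0)) :
    ∃ (δ : Fin ℓ → ℕ) (A : Fin ℓ → ℕ → ℝ) (p : Fin m → Fin ℓ → ℤ[X]),
      (∀ i, IsTemperedSeq (δ i) (A i)) ∧ (∀ i, δ i + 1 ≤ d + 1) ∧ IsNiceFamily δ A 0 0 p ∧
      ∀ i j, (fun n : ℕ => g i j n) =ᶠ[atTop] polyShift (p j i) (A i) := by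
  obtain ⟨G, hG, hgG⟩ := hg.mem
  have hδ' : ∀ i, ∃ δ', IsTemperedSeq δ' fun n => G i n := fun i => by
    obtain ⟨δ', h⟩ := Set.mem_iUnion.1 (hG i)
    exact ⟨δ', isTemperedSeq_of_mem_classTi h⟩
  choose δ' ha using hδ'
  choose Q hQ using fun i j => exists_polyShift_of_mem_shiftComb (hgG i j)
  have hcast := tendsto_natCast_atTop_atTop (R := ℝ)
  have hdiff : ∀ r, diffSeq r (fun n : ℕ => g 0 0 n) =ᶠ[atTop]
      diffSeq r (polyShift (Q 0 0) fun n => G 0 n) := fun r => by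
    have h1 := hQ 0 0
    induction r with
    | zero => simpa only [diffSeq_zero] using h1
    | succ r ih =>
      filter_upwards [ih, (tendsto_add_nat 1).eventually ih] with n hn hn'
      rw [diffSeq_succ, diffSeq_succ, hn, hn']
  obtain ⟨u, hu, hu1, hle⟩ := (ha 0).exists_order_eq (d := d) (q := Q 0 0)
    (fun h => not_tendsto_diffSeq_of_isTempered hd (h.congr' (hdiff d).symm))
    ((tendsto_diffSeq_of_isTempered hd).congr' (hdiff (d + 1)))
  have h00 : polyShift (Q 0 0) (fun n => G 0 n) =O[atTop] diffSeq (δ' 0 - d) fun n => G 0 n :=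
    (ha 0).polyShift_isBigO (Nat.sub_le _ _) ⟨u, hu⟩
  have hdvd : ∀ i j, (X - 1) ^ (δ' i - d) ∣ Q i j := by
    intro i j
    by_cases hi : i = 0
    · subst hi
      by_cases hj : j = 0
      · subst hj
        exact ⟨u, hu⟩
      · refine (ha 0).dvd_of_polyShift_isBigO (Nat.sub_le _ _) ?_
        exact (((hg.first_ll j hj).comp_tendsto hcast).congr' (hQ 0 j) (hQ 0 0)).trans h00
    · refine (ha i).dvd_of_isLittleO (ha 0) hle ?_
      exact (((hg.prec_first i j hi).comp_tendsto hcast).congr' (hQ i j) (hQ 0 0)).trans_isBigO h00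
  choose p hp using hdvd
  have hgp : ∀ i j, (fun n : ℕ => g i j n) =ᶠ[atTop]
      polyShift (p i j) (diffSeq (δ' i - d) fun n => G i n) := fun i j => by
    have := hQ i j
    rwa [hp i j, polyShift_pow_mul] at this
  have hA : ∀ i, IsTemperedSeq (δ' i - (δ' i - d)) (diffSeq (δ' i - d) fun n => G i n) := fun i =>
    (ha i).iterDiff (Nat.sub_le _ _)
  have hsub : ∀ i j, (fun n : ℕ => (g i 0 - g i j) n) =ᶠ[atTop]
      polyShift (p i 0 - p i j) (diffSeq (δ' i - d) fun n => G i n) := fun i j => by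
    rw [polyShift_sub]
    exact (hgp i 0).sub (hgp i j)
  refine ⟨_, _, fun j i => p i j, hA, fun i => by omega, ?_, hgp⟩
  refine ⟨Nat.zero_le _, ⟨p 0 0, by simp, fun h => ?_⟩, fun j => by simp, fun j hj h => ?_,
    fun j i hi => ?_, fun j i hj hi => ?_⟩
  · have h1 : (X - 1) ^ (δ' 0 - d + 1) ∣ Q 0 0 := by
      rw [hp 0 0, pow_succ]
      exact mul_dvd_mul_left _ ((X_sub_one_dvd_iff _).2 h)
    rw [hu, X_sub_one_pow_dvd_mul_iff hu1] at h1
    omega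
  · have h1 := ((hg.one_prec j hj).comp_tendsto hcast).congr' EventuallyEq.rfl (hsub 0 j)
    have h2 := h1.trans_tendsto ((hA 0).tendsto_polyShift_zero h)
    exact one_ne_zero (tendsto_nhds_unique tendsto_const_nhds h2)
  · rw [diffSeq_zero]
    exact ((((hg.prec_first i j hi).comp_tendsto hcast).congr' (hQ i j) (hQ 0 0)).trans_isBigO
      h00).congr' ((hQ i j).symm.trans (hgp i j)) EventuallyEq.rfl
  · exact ((hg.diff_prec i j hi hj).comp_tendsto hcast).congr' (hsub i j) (hsub 0 j)

end

/-! ### Uniform choice of the order -/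

theorem exists_bound_of_eventually {b : ℕ → ℝ} {B : ℝ} (h : ∀ᶠ n in atTop, |b n| ≤ B) :
    ∃ B' : ℝ, ∀ n, |b n| ≤ B' := by
  obtain ⟨N, hN⟩ := eventually_atTop.1 h
  refine ⟨|B| + ∑ n ∈ Finset.range N, |b n|, fun n => ?_⟩
  have h0 : 0 ≤ ∑ n ∈ Finset.range N, |b n| := Finset.sum_nonneg fun _ _ => abs_nonneg _
  rcases le_or_gt N n with hn | hn
  · linarith [hN n hn, le_abs_self B]
  · linarith [abs_nonneg B, Finset.single_le_sum (f := fun n => |b n|) (fun _ _ => abs_nonneg _)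
      (Finset.mem_range.2 hn)]

/-- The order of the seminorm can be chosen uniformly for all nice families. -/
theorem exists_order_smallCorrelations.{u} (d ℓ m : ℕ) [NeZero ℓ] [NeZero m] :
    ∃ k : ℕ, 1 ≤ k ∧ ∀ {X : Type u} [MeasurableSpace X] (μ : Measure X) [IsProbabilityMeasure μ]
      {τ : (Fin ℓ → ℤ) → X → X} {T : X ≃ᵐ X}, IsMPAction μ τ → MeasurePreserving T μ μ →
      (∀ n x, iter T n x = τ (Pi.single 0 n) x) →
      ∀ {g : Fin ℓ → Fin m → ℝ → ℝ}, IsNice g → IsTempered d (g 0 0) →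
      ∀ {f : Fin m → X → ℂ} {C : ℝ}, (∀ j, BddMeas C (f j)) → hostKraPow μ T k (f 0) = 0 →
      SmallCorrelations μ τ f fun j n i => ⌊g i j n⌋ := by
  classical
  choose K hK using fun W => exists_seminormOrderSuffices.{u} ℓ (d + 1) W m
  -- Weights of families with at most m members have entries at most m: finitely many, depending on
  -- d, ℓ and m only.
  set box : Finset (Lex (Fin (ℓ * (d + 1)) → ℕ)) :=
    (Fintype.piFinset fun _ => Finset.range (m + 1)).map toLex.toEmbedding with hbox
  refine ⟨max 1 (box.sup K), le_max_left _ _, ?_⟩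
  intro X _ μ _ τ T hτ hT hTτ g hg hd f C hf hQ
  obtain ⟨δ, A, p, hA, hδ, hp, hgp⟩ := hg.exists_isNiceFamily hd
  have hnear : ∀ j i, ∃ B : ℝ, ∀ n : ℕ,
      |((⌊g i j n⌋ : ℤ) : ℝ) - polyShift (p j i) (A i) n| ≤ B := fun j i => by
    refine exists_bound_of_eventually (B := 1) ?_
    filter_upwards [hgp i j] with n hn
    rw [← hn, abs_sub_comm, abs_le]
    constructor <;> linarith [Int.floor_le (g i j n), Int.lt_floor_add_one (g i j n)]
  set q := fun j => p j ∉ orderFiltration δ (d + 1) (ℓ * (d + 1)) with hq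
  refine SmallCorrelations.of_subtype hτ hf q (fun j hj i => ?_) ?_
  · obtain ⟨B, hB⟩ := hnear j i
    obtain ⟨B', hB'⟩ := exists_bound_of_tendsto ((hA i).tendsto_polyShift_zero
      ((mem_orderFiltration_last_iff hδ).1 (not_not.1 hj) i))
    refine ⟨B + B', fun n => ?_⟩
    have h1 := (abs_add_le _ _).trans (add_le_add (hB n) (hB' n))
    rwa [sub_add_cancel] at h1
  set W := familyWeight δ (d + 1) (p ∘ (Subtype.val : {j // q j} → Fin m)) with hW
  have hcard : Fintype.card {j // q j} ≤ m :=
    (Fintype.card_subtype_le _).trans (Fintype.card_fin m).le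
  have hmem : W ∈ box := by
    refine Finset.mem_map.2 ⟨ofLex W, Fintype.mem_piFinset.2 fun s => Finset.mem_range.2 ?_, rfl⟩
    exact Nat.lt_succ_of_le ((ncard_levelClasses_le _).trans hcard)
  exact hK W μ hτ hT hTτ hcard hA hδ
    (hp.comp (o' := ⟨0, hp.not_mem_last hδ⟩) Subtype.val_injective rfl)
    (fun J => J.2) rfl (fun J => hf J) (fun J => hnear J)
    (hostKraPow_eq_zero_of_le hT (hf 0) ((Finset.le_sup hmem).trans (le_max_right _ _)) hQ)

/-! ### Averages of commuting transformations -/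

theorem list_ofFn_zpow_add_prod {G : Type*} [Group G] {ℓ : ℕ} (P : Fin ℓ → G)
    (hP : ∀ i j, Commute (P i) (P j)) (a b : Fin ℓ → ℤ) :
    (List.ofFn fun i => P i ^ (a + b) i).prod =
      (List.ofFn fun i => P i ^ a i).prod * (List.ofFn fun i => P i ^ b i).prod := by
  induction ℓ with
  | zero => simp
  | succ ℓ ih =>
    have h1 : Commute (P 0 ^ b 0) (List.ofFn fun i : Fin ℓ => P i.succ ^ a i.succ).prod := by
      refine Commute.list_prod_right _ _ fun x hx => ?_
      obtain ⟨i, rfl⟩ := List.mem_ofFn.1 hx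
      exact ((hP 0 i.succ).zpow_left _).zpow_right _
    have h2 := ih (fun i => P i.succ) (fun i j => hP _ _) (fun i => a i.succ) fun i => b i.succ
    simp only [Pi.add_apply] at h2
    simp only [List.ofFn_succ, List.prod_cons, Pi.add_apply, h2]
    rw [zpow_add, mul_assoc, mul_assoc, ← mul_assoc (P 0 ^ b 0), h1.eq, mul_assoc]

variable {X : Type*} [MeasurableSpace X] {μ : Measure X} {ℓ : ℕ}

theorem measurePreserving_jointIter {T : Fin ℓ → X ≃ᵐ X} (hT : ∀ i, MeasurePreserving (T i) μ μ)
    (a : Fin ℓ → ℤ) : MeasurePreserving (jointIter T a) μ μ := by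
  induction ℓ with
  | zero => exact MeasurePreserving.id μ
  | succ ℓ ih =>
    have h1 : jointIter T a = iter (T 0) (a 0) ∘ jointIter (fun i => T i.succ) fun i => a i.succ := by
      simp only [jointIter, iter, List.ofFn_succ, List.prod_cons, Equiv.Perm.coe_mul]
    rw [h1]
    exact (measurePreserving_iter (hT 0) _).comp (ih (fun i => hT _) _)

theorem isMPAction_jointIter {T : Fin ℓ → X ≃ᵐ X} (hT : ∀ i, MeasurePreserving (T i) μ μ)
    (hc : ∀ i i' x, T i (T i' x) = T i' (T i x)) : IsMPAction μ (jointIter T) where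
  zero x := by
    have : (List.ofFn fun i => ((T i).toEquiv : Equiv.Perm X) ^ (0 : Fin ℓ → ℤ) i).prod = 1 :=
      List.prod_eq_one fun x hx => by
        obtain ⟨i, rfl⟩ := List.mem_ofFn.1 hx
        simp
    rw [jointIter, this]
    rfl
  add a b x := by
    rw [jointIter, list_ofFn_zpow_add_prod _ (fun i j => Equiv.ext fun x => hc i j x)]
    rfl
  measurePreserving := measurePreserving_jointIter hT

theorem iter_eq_jointIter [NeZero ℓ] (T : Fin ℓ → X ≃ᵐ X) (n : ℤ) (x : X) :
    iter (T 0) n x = jointIter T (Pi.single 0 n) x := by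
  obtain ⟨k, rfl⟩ := Nat.exists_eq_succ_of_ne_zero (NeZero.ne ℓ)
  have h1 : (List.ofFn fun i : Fin k => ((T i.succ).toEquiv : Equiv.Perm X) ^
      (Pi.single 0 n : Fin (k + 1) → ℤ) i.succ).prod = 1 :=
    List.prod_eq_one fun x hx => by
      obtain ⟨i, rfl⟩ := List.mem_ofFn.1 hx
      rw [Pi.single_eq_of_ne (Fin.succ_ne_zero i), zpow_zero]
  simp only [jointIter, List.ofFn_succ, List.prod_cons, h1, mul_one, iter]
  simp

theorem eLpNorm_two_eq [IsProbabilityMeasure μ] {R : ℝ} {f : X → ℂ} (hf : BddMeas R f) :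
    eLpNorm f 2 μ = ENNReal.ofReal (Real.sqrt ‖∫ x, conj (f x) * f x ∂μ‖) := by
  rw [← inner_toLp (hf.memLp μ 2) (hf.memLp μ 2), inner_self_eq_norm_sq_to_K, norm_pow,
    RCLike.norm_ofReal, abs_norm, Real.sqrt_sq (norm_nonneg _), Lp.norm_toLp,
    ENNReal.ofReal_toReal (hf.memLp μ 2).eLpNorm_ne_top]

/-- Small correlations make the averages small, uniformly over all sets of times. -/
theorem SmallCorrelations.tendsto_iSup_eLpNorm [IsProbabilityMeasure μ] {m : ℕ}
    {T : Fin ℓ → X ≃ᵐ X} (hτ : IsMPAction μ (jointIter T)) {f : Fin m → X → ℂ} {C : ℝ}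
    (hf : ∀ j, BddMeas C (f j)) {g : Fin ℓ → Fin m → ℝ → ℝ}
    (h : SmallCorrelations μ (jointIter T) f fun j n i => ⌊g i j n⌋) :
    Tendsto (fun N : ℕ => ⨆ E : Set ℕ, eLpNorm (niceAverage T f g E N) 2 μ) atTop (𝓝 0) := by
  rw [ENNReal.tendsto_atTop_zero]
  intro ε hε
  obtain ⟨η, hη, hηε⟩ := ENNReal.lt_iff_exists_nnreal_btwn.1 hε
  have hη0 : (0 : ℝ) < η := by exact_mod_cast hη
  set M : ℝ := 1 * C ^ Fintype.card (Fin m) with hM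
  -- The correlations are summed over n ≤ N, including 0, so N + 1 terms are divided by N; the
  -- factor 1/2 pays for (N + 1)/N ≤ 2.
  obtain ⟨N₀, hN₀⟩ := h M ((η : ℝ) ^ 2 / 2) (by positivity)
  refine ⟨N₀ + 1, fun N hN => iSup_le fun E => le_trans ?_ hηε.le⟩
  have hN0 : (0 : ℝ) < N := by exact_mod_cast (by omega : 0 < N)
  set F : ℕ → X → ℂ := fun n x => ∏ j, f j (jointIter T (fun i => ⌊g i j n⌋) x) with hF
  set w : ℕ → ℂ := E.indicator fun _ => (1 : ℂ) with hw
  have hw1 : ∀ n, ‖w n‖ ≤ 1 := fun n => by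
    rw [hw]
    refine (norm_indicator_le_norm_self _ _).trans (by simp)
  have h1 : BddMeas 1 fun _ : X => (1 : ℂ) := ⟨measurable_const, fun _ => by simp⟩
  have hFb : ∀ n, BddMeas M (F n) := fun n => by
    simpa only [hF, hM, one_mul] using h1.mul_prod hτ hf fun j i => ⌊g i j n⌋
  have hM0 : 0 ≤ M := (hFb 0).nonneg μ
  have hgen : niceAverage T f g E N = fun x => (N : ℂ)⁻¹ * ∑ n ∈ Finset.Icc 1 N, F n x * w n := rfl
  have hb : BddMeas M (niceAverage T f g E N) := by
    rw [hgen]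
    refine ⟨(Finset.measurable_sum _ fun n _ => (hFb n).1.mul_const _).const_mul _, fun x => ?_⟩
    rw [norm_mul, norm_inv, RCLike.norm_natCast, inv_mul_le_iff₀ hN0]
    refine (norm_sum_le _ _).trans ?_
    calc _ ≤ ∑ n ∈ Finset.Icc 1 N, M := Finset.sum_le_sum fun n _ => by
            rw [norm_mul]
            exact (mul_le_mul ((hFb n).2 x) (hw1 n) (norm_nonneg _) hM0).trans (mul_one M).le
      _ = N * M := by simp
  rw [eLpNorm_two_eq hb, ← ENNReal.ofReal_coe_nnreal]
  refine ENNReal.ofReal_le_ofReal (Real.sqrt_le_iff.2 ⟨hη0.le, ?_⟩)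
  -- The test function depends on E and N, but its bound M does not.
  set φ : X → ℂ := fun x => conj (niceAverage T f g E N x) with hφ
  have h2 : ∫ x, φ x * niceAverage T f g E N x ∂μ =
      (N : ℂ)⁻¹ * ∑ n ∈ Finset.Icc 1 N, (∫ x, φ x * F n x ∂μ) * w n := by
    have e : ∀ x, φ x * niceAverage T f g E N x =
        (N : ℂ)⁻¹ * ∑ n ∈ Finset.Icc 1 N, φ x * F n x * w n := fun x => by
      rw [hgen]
      simp only [Finset.mul_sum]
      refine Finset.sum_congr rfl fun n _ => by ring
    simp only [e]
    rw [integral_const_mul, integral_finsetSum _ fun n _ =>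
      ((hb.conj.mul (hFb n)).integrable μ).mul_const _]
    simp only [integral_mul_const, hφ]
  have h3 : ‖∫ x, φ x * niceAverage T f g E N x ∂μ‖ ≤
      (N : ℝ)⁻¹ * ∑ n ∈ Finset.range (N + 1), ‖∫ x, φ x * F n x ∂μ‖ := by
    rw [h2, norm_mul, norm_inv, RCLike.norm_natCast]
    gcongr
    refine (norm_sum_le _ _).trans ?_
    refine (Finset.sum_le_sum fun n _ => ?_).trans (Finset.sum_le_sum_of_subset_of_nonneg
      (f := fun n => ‖∫ x, φ x * F n x ∂μ‖) (fun n hn => ?_) fun _ _ _ => norm_nonneg _)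
    · rw [norm_mul]
      exact mul_le_of_le_one_right (norm_nonneg _) (hw1 n)
    · simp only [Finset.mem_Icc, Finset.mem_range] at hn ⊢
      omega
  have h4 := hN₀ (N + 1) (by omega) φ hb.conj
  rw [inv_mul_le_iff₀ (by positivity)] at h4
  push_cast at h4
  refine h3.trans ?_
  rw [inv_mul_le_iff₀ hN0]
  refine h4.trans ?_
  have : (1 : ℝ) ≤ N := by exact_mod_cast (by omega : 1 ≤ N)
  nlinarith [sq_nonneg (η : ℝ)]

/-- Essentially bounded functions have bounded measurable versions. -/
theorem exists_bddMeas_ae_eq [IsProbabilityMeasure μ] {f : X → ℂ} (hf : MemLp f ∞ μ) :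
    ∃ (R : ℝ) (f' : X → ℂ), BddMeas R f' ∧ f =ᵐ[μ] f' := by
  obtain ⟨h0, h1⟩ := hf
  rw [eLpNorm_exponent_top] at h1
  set R : ℝ := (eLpNormEssSup f μ).toReal
  have h2 : ∀ᵐ x ∂μ, ‖f x‖ ≤ R := by
    filter_upwards [ae_le_eLpNormEssSup (f := f) (μ := μ)] with x hx
    rw [← toReal_enorm]
    exact ENNReal.toReal_mono h1.ne hx
  have hm : Measurable (h0.mk f) := h0.stronglyMeasurable_mk.measurable
  have hs : MeasurableSet {x | ‖h0.mk f x‖ ≤ R} := measurableSet_le hm.norm measurable_const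
  refine ⟨R, {x | ‖h0.mk f x‖ ≤ R}.indicator (h0.mk f), ⟨hm.indicator hs, fun x => ?_⟩, ?_⟩
  · by_cases hx : x ∈ {x | ‖h0.mk f x‖ ≤ R}
    · rw [Set.indicator_of_mem hx]
      exact hx
    · rw [Set.indicator_of_notMem hx, norm_zero]
      exact ENNReal.toReal_nonneg
  · filter_upwards [h0.ae_eq_mk, h2] with x hx hx'
    rw [Set.indicator_of_mem, hx]
    rw [Set.mem_ofPred_eq, ← hx]
    exact hx'

theorem eLpNorm_niceAverage_congr {m : ℕ} {T : Fin ℓ → X ≃ᵐ X}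
    (hT : ∀ i, MeasurePreserving (T i) μ μ) {f f' : Fin m → X → ℂ} (h : ∀ j, f j =ᵐ[μ] f' j)
    (g : Fin ℓ → Fin m → ℝ → ℝ) (E : Set ℕ) (N : ℕ) :
    eLpNorm (niceAverage T f g E N) 2 μ = eLpNorm (niceAverage T f' g E N) 2 μ := by
  refine eLpNorm_congr_ae ?_
  have h1 : ∀ᵐ x ∂μ, ∀ (n : ℕ) (j : Fin m), f j (jointIter T (fun i => ⌊g i j n⌋) x) =
      f' j (jointIter T (fun i => ⌊g i j n⌋) x) :=
    ae_all_iff.2 fun n => ae_all_iff.2 fun j =>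
      (measurePreserving_jointIter hT _).quasiMeasurePreserving.ae (h j)
  filter_upwards [h1] with x hx
  simp only [niceAverage, hx]

end TemperedAverages

/-! ### The proposition -/

theorem propositionP (d ℓ m : ℕ) [NeZero ℓ] [NeZero m] :
    ∃ k : ℕ, 1 ≤ k ∧
      ∀ {X : Type*} [MeasurableSpace X] (μ : Measure X) [IsProbabilityMeasure μ]
        (T : Fin ℓ → X ≃ᵐ X), (∀ i, MeasurePreserving (T i) μ μ) →
        (∀ i i' x, T i (T i' x) = T i' (T i x)) →
        ∀ f : Fin m → X → ℂ, (∀ j, MemLp (f j) ∞ μ) →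
        ∀ g : Fin ℓ → Fin m → ℝ → ℝ, IsNice g → IsTempered d (g 0 0) →
        hostKraSeminorm μ (T 0) k (f 0) = 0 →
        Tendsto (fun N : ℕ => ⨆ E : Set ℕ, eLpNorm (niceAverage T f g E N) 2 μ) atTop (𝓝 0) := by
  obtain ⟨k, hk, h⟩ := exists_order_smallCorrelations d ℓ m
  refine ⟨k, hk, fun {X} _ μ _ T hT hc f hf g hg hd hQ => ?_⟩
  -- Bounded versions have the same averages and seminorms almost everywhere and in value,
  -- respectively, and a common bound.
  choose R f' hf' hff' using fun j => exists_bddMeas_ae_eq (hf j)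
  simp only [eLpNorm_niceAverage_congr hT hff']
  have hτ := isMPAction_jointIter hT hc
  have hb : ∀ j, BddMeas (∑ j, |R j|) (f' j) := fun j => (hf' j).mono
    ((le_abs_self _).trans (Finset.single_le_sum (f := fun j => |R j|)
      (fun _ _ => abs_nonneg _) (Finset.mem_univ j)))
  refine (h μ hτ (hT 0) (iter_eq_jointIter T) hg hd hb ?_).tendsto_iSup_eLpNorm hτ hb
  obtain ⟨n, rfl⟩ := Nat.exists_eq_succ_of_ne_zero (by omega : k ≠ 0)
  rw [hostKraPow, ← hostKraSeminorm_congr_ae (hT 0) _ (hff' 0), hQ, zero_pow (by positivity)]
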